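/- **Conventions.** For a cardinal $\chi$, $H(\chi)$ is the set of all $x$ whose transitive closure has cardinality $<\chi$. $[X]^{<\omega}=[X]^{<\aleph_0}$ is the set of finite subsets of $X$, and $\mathrm{otp}$ denotes order type. For sets of ordinals, $A\triangleleft D$ means $D\setminus A\neq\emptyset$ and $A=D\cap\min(D\setminus A)$. $\lambda\to(\alpha)^{<\omega}_\mu$ means: for every $F:[\lambda]^{<\omega}\to\mu$ there is $A\subseteq\lambda$ of order type $\alpha$ such that $F(w_1)=F(w_2)$ whenever $w_1,w_2\in[A]^{<\omega}$ and $|w_1|=|w_2|$. $\lambda\to^+(\alpha)^{<\omega}_\mu$ means: for every $F:[\lambda]^{<\omega}\to\lambda$ with $F(w)<\min(w)$ for all nonempty $w$ with $\min (w)\ne 0$, and every club $C\subseteq\lambda$, there is $A\subseteq C$ of order type $\alpha$ such that $F(w_1)=F(w_2)$ whenever $w_1,w_2\in[A]^{<\omega}$ and $|w_1|=|w_2|$ (the subscript $\mu$ plays no role in this definition). $\lambda$ is Ramsey if it is uncountable and $\lambda\to(\lambda)^{<\omega}_2$. **Systems.** Let $<^*$ be a well ordering of $H(\chi)$. A strong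 end-extension $(\chi,\lambda,\alpha,\theta,\aleph_0,\omega)$-system for $x$ consists of a set $B\subseteq\lambda$ with $\mathrm{otp}(B)=\alpha$, elementary submodels $N_s\prec(H(\chi),\in,<^*)$ for $s\in[B]^{<\aleph_0}$, and isomorphisms $H_{s,t}:N_s\to N_t$ for $|s|=|t|$ such that, for all $s,t,r\in[B]^{<\aleph_0}$: 1. $\theta+1\subseteq N_s$, $|N_s|=\theta$, and every finite sequence of elements of $N_s$ belongs to $N_s$; 2. $N_s\cap N_t=N_{s\cap t}$ and $N_s\cap B=s$; 3. if $|s|=|t|$, $s'\subseteq s$ and $t'=\{a\in t:\exists b\in s'\ |b\cap s|=|a\cap t|\}$, then $H_{s',t'}$ and $H_{s,t}$ are compatible functions; $H_{s,s}=\mathrm{id}$; $H_{s,t}$ extends the order isomorphism from $s$ onto $t$; $H_{t,s}=(H_{s,t})^{-1}$; and if $|r|=|s|=|t|$ then applying $H_{r,s}$ and then $H_{s,t}$ gives $H_{r,t}$; 4. $\sup(N_s\cap\lambda)<\min\{b\in B: b>c\text{ for all }c\in s\}$ whenever such a $b$ exists; 5. $s\triangleleft t$ implies $N_s\cap\lambda\triangleleft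 N_t\cap\lambda$; 6. $x\in N_s$, and $H_{s,t}(x)=x$ if $|s|=|t|$. **Claim.** Let $\mu<\lambda<\chi$ be cardinals with $\mu$ infinite, let $\alpha^*$ be an ordinal, $x\in H(\chi)$, and let $<^*$ be any well ordering of $H(\chi)$. (1) If $\lambda\to^+(\omega\alpha^*)^{<\omega}_\mu$, then there is a strong end-extension $(\chi,\lambda,\alpha^*,\mu,\aleph_0,\omega)$-system for $x$. (2) If either $\lambda$ is a Ramsey cardinal and $\alpha^*\le\lambda$, or $\lambda$ is the least cardinal with $\lambda\to(\omega\alpha^*)^{<\omega}_\mu$, then $\lambda\to^+(\omega\alpha^*)^{<\omega}_\mu$, and for every infinite cardinal $\theta\le\mu$ there is a strong end-extension $(\chi,\lambda,\alpha^*,\theta,\aleph_0,\omega)$-system for $x$. -/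

import Mathlib

universe u

open FirstOrder

/-! ### Partition relations -/

/-- The ordinal `κ`, i.e. the type of all ordinals below the initial ordinal of the cardinal `κ`. -/
abbrev OrdBelow (κ : Cardinal.{u}) : Type (u + 1) := Set.Iio κ.ord

/-- `A` has order type `α`. -/
def HasOrderType {X : Type (u + 1)} [Preorder X] (A : Set X) (α : Ordinal.{u}) : Prop :=
  Nonempty (Set.Iio α ≃o A)

/-- `F` takes the same value at any two finite subsets of `A` of the same size. -/
def Homogeneous {X : Type*} {Y : Type*} (F : Finset X → Y) (A : Set X) : Prop :=
  ∀ w₁ w₂ : Finset X, (w₁ : Set X) ⊆ A → (w₂ : Set X) ⊆ A → w₁.card = w₂.card → F w₁ = F w₂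

/-- The relation `κ → (α)^{<ω}_μ`. -/
def PartitionArrow (κ : Cardinal.{u}) (α : Ordinal.{u}) (μ : Cardinal.{u}) : Prop :=
  ∀ F : Finset (OrdBelow κ) → OrdBelow μ,
    ∃ A : Set (OrdBelow κ), HasOrderType A α ∧ Homogeneous F A

/-- `κ` is a Ramsey cardinal: it is uncountable and `κ → (κ)^{<ω}_2`. -/
def IsRamsey (κ : Cardinal.{u}) : Prop :=
  Cardinal.aleph0 < κ ∧ PartitionArrow κ κ.ord 2

/-- `F : [κ]^{<ω} → κ` is regressive: `F(w) < min(w)`. The inequality is demanded wherever it makes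
sense and is not absurd, that is for `w` nonempty with `min(w) ≠ 0`. -/
def Regressive {κ : Cardinal.{u}} (F : Finset (OrdBelow κ) → OrdBelow κ) : Prop :=
  ∀ (w : Finset (OrdBelow κ)) (hw : w.Nonempty),
    ((w.min' hw : OrdBelow κ) : Ordinal.{u}) ≠ 0 → F w < w.min' hw

/-- The relation `κ →⁺ (α)^{<ω}_μ`: for every regressive `F : [κ]^{<ω} → κ` and every club `C` of
`κ` there is a homogeneous `A ⊆ C` of order type `α`. (The subscript `μ` plays no role in it.) -/
def RegressiveArrow (κ : Cardinal.{u}) (α : Ordinal.{u}) : Prop :=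
  ∀ F : Finset (OrdBelow κ) → OrdBelow κ, Regressive F →
    ∀ C : Set (OrdBelow κ), IsClub C →
      ∃ A : Set (OrdBelow κ), A ⊆ C ∧ HasOrderType A α ∧ Homogeneous F A

/-! ### The structure `(H(χ), ∈, R)` -/

/-- `H(χ)`: the sets whose transitive closure has cardinality `< χ`. The members of the transitive
closure of `x` are the sets related to `x` by the transitive closure of `∈`. -/
def HSet (χ : Cardinal.{u}) : Set ZFSet.{u} :=
  {x | Cardinal.mk {y : ZFSet.{u} // Relation.TransGen (· ∈ ·) y x} < Cardinal.lift.{u + 1} χ}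

/-- Two binary relation symbols: membership, and one more. -/
inductive SetSymbol : ℕ → Type
  | mem : SetSymbol 2
  | extra : SetSymbol 2

/-- The language of set theory with one extra binary relation symbol. -/
def setLanguage : FirstOrder.Language.{0, 0} := ⟨fun _ => Empty, SetSymbol⟩

/-- The underlying set of the structure `(H(χ), ∈, R)`. -/
def HModel (χ : Cardinal.{u}) (_R : HSet χ → HSet χ → Prop) : Type (u + 1) := HSet χ

/-- An element of `(H(χ), ∈, R)` as a set. -/
def HModel.toSet {χ : Cardinal.{u}} {R : HSet χ → HSet χ → Prop} (y : HModel χ R) : ZFSet.{u} :=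
  Subtype.val (p := (· ∈ HSet χ)) y

/-- The structure `(H(χ), ∈, R)`. -/
instance HModel.instStructure (χ : Cardinal.{u}) (R : HSet χ → HSet χ → Prop) :
    setLanguage.Structure (HModel χ R) where
  funMap := fun f _ => Empty.elim f
  RelMap := fun {_} r =>
    match r with
    | SetSymbol.mem => fun v => (v 0).toSet ∈ (v 1).toSet
    | SetSymbol.extra => fun v => R (v 0) (v 1)

/-- An elementary submodel `N ≺ (H(χ), ∈, R)`. -/
abbrev ElemSub (χ : Cardinal.{u}) (R : HSet χ → HSet χ → Prop) : Type (u + 1) :=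
  setLanguage.ElementarySubstructure (HModel χ R)

/-- The elements of `N`, as a collection of sets. -/
def ElemSub.sets {χ : Cardinal.{u}} {R : HSet χ → HSet χ → Prop} (N : ElemSub χ R) :
    Set ZFSet.{u} :=
  {z | ∃ y ∈ N, y.toSet = z}

/-- The ordinals that belong to `N`. -/
def ElemSub.ords {χ : Cardinal.{u}} {R : HSet χ → HSet χ → Prop} (N : ElemSub χ R) :
    Set Ordinal.{u} :=
  {a | a.toZFSet ∈ N.sets}

/-! ### Systems of elementary submodels -/

/-- `A ◁ D`: `A` is a proper initial segment of the set of ordinals `D`, namely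
`A = D ∩ min (D \ A)`. -/
def ProperInit (A D : Set Ordinal.{u}) : Prop :=
  (D \ A).Nonempty ∧ A = D ∩ Set.Iio (sInf (D \ A))

/-- For ordinals `a`, the number `|a ∩ s|`. -/
noncomputable def posIn (s : Finset Ordinal.{u}) (a : Ordinal.{u}) : ℕ :=
  (s.filter (· < a)).card

/-- `[B]^{<1+n}`, for `n ≤ ω`: the finite subsets of `B` of size less than `1 + n`. -/
abbrev FinSub (B : Set Ordinal.{u}) (n : ℕ∞) : Type (u + 1) :=
  {s : Finset Ordinal.{u} // (s : Set Ordinal.{u}) ⊆ B ∧ (s.card : ℕ∞) < 1 + n}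

/-- A `(χ, κ, α, θ, σ, n)`-system `⟨N_s : s ∈ [B]^{<1+n}⟩` of elementary submodels of
`(H(χ), ∈, R)`, with its isomorphisms `H_{s,t}` from `N_s` onto `N_t` for `|s| = |t|`. -/
structure ModelSystem (χ κ : Cardinal.{u}) (R : HSet χ → HSet χ → Prop) (α : Ordinal.{u})
    (θ σ : Cardinal.{u}) (n : ℕ∞) where
  /-- the set of indices -/
  B : Set Ordinal.{u}
  /-- the models `N_s` -/
  N : FinSub B n → ElemSub χ R
  /-- the isomorphisms `H_{s,t}` -/
  H : ∀ s t : FinSub B n, s.1.card = t.1.card → (N s ≃[setLanguage] N t)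
  /-- `θ + 1 ⊆ N_s` -/
  succ_subset : ∀ s, ∀ i ≤ θ.ord, i ∈ (N s).ords
  /-- `‖N_s‖ = θ` -/
  card_eq : ∀ s, Cardinal.mk (N s) = Cardinal.lift.{u + 1} θ
  /-- `N_s` is closed under sequences of length less than `σ` -/
  seq_closed : ∀ s, ∀ i < σ.ord, ∀ y f : ZFSet.{u}, (∀ z ∈ y, z ∈ (N s).sets) →
    ZFSet.IsFunc i.toZFSet y f → f ∈ (N s).sets
  /-- `B ⊆ κ` -/
  subset_ord : B ⊆ Set.Iio κ.ord
  /-- `otp(B) = α` -/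
  otp_eq : HasOrderType B α
  /-- `N_s ∩ N_t ⊆ N_{s ∩ t}` -/
  inter_subset : ∀ s t r : FinSub B n, r.1 = s.1 ∩ t.1 → (N s).sets ∩ (N t).sets ⊆ (N r).sets
  /-- `N_s ∩ B = s` -/
  inter_index : ∀ s : FinSub B n, (N s).ords ∩ B = (s.1 : Set Ordinal.{u})
  /-- `H_{s',t'}` and `H_{s,t}` are compatible functions, if `s' ⊆ s` and `t'` is the subset of `t`
  corresponding to `s'` under the order isomorphism of `s` and `t` -/
  H_compat : ∀ (s t s' t' : FinSub B n) (h : s.1.card = t.1.card) (h' : s'.1.card = t'.1.card),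
    s'.1 ⊆ s.1 → (∀ a, a ∈ t'.1 ↔ a ∈ t.1 ∧ ∃ b ∈ s'.1, posIn s.1 b = posIn t.1 a) →
    ∀ (y : HModel χ R) (hy : y ∈ N s) (hy' : y ∈ N s'),
      (H s t h ⟨y, hy⟩ : HModel χ R) = (H s' t' h' ⟨y, hy'⟩ : HModel χ R)
  /-- `H_{s,s} = id` -/
  H_refl : ∀ (s : FinSub B n) (y : N s), H s s rfl y = y
  /-- `H_{s,t}` extends the order isomorphism of `s` and `t` -/
  H_order : ∀ (s t : FinSub B n) (h : s.1.card = t.1.card), ∀ a ∈ s.1, ∀ b ∈ t.1,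
    posIn s.1 a = posIn t.1 b →
    ∀ y : N s, (y : HModel χ R).toSet = a.toZFSet →
      (H s t h y : HModel χ R).toSet = b.toZFSet
  /-- composing `H_{r,s}` with `H_{s,t}` gives `H_{r,t}` -/
  H_trans : ∀ (r s t : FinSub B n) (h : r.1.card = s.1.card) (h' : s.1.card = t.1.card) (y : N r),
    H s t h' (H r s h y) = H r t (h.trans h') y
  /-- `H_{t,s}` is the inverse of `H_{s,t}` -/
  H_symm : ∀ (s t : FinSub B n) (h : s.1.card = t.1.card) (y : N s),
    H t s h.symm (H s t h y) = y
  /-- `sup(N_s ∩ κ) < min {b ∈ B : b is above all elements of s}`, if there is such a `b` -/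
  sup_lt : ∀ s : FinSub B n, ∀ b ∈ B, (∀ c ∈ s.1, c < b) →
    sSup ((N s).ords ∩ Set.Iio κ.ord) < b

namespace ModelSystem

variable {χ κ : Cardinal.{u}} {R : HSet χ → HSet χ → Prop} {α : Ordinal.{u}} {θ σ : Cardinal.{u}}
  {n : ℕ∞}

/-- The system is strong: `N_s ∩ N_t = N_{s ∩ t}`. -/
def IsStrong (S : ModelSystem χ κ R α θ σ n) : Prop :=
  ∀ s t r : FinSub S.B n, r.1 = s.1 ∩ t.1 → (S.N s).sets ∩ (S.N t).sets = (S.N r).sets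

/-- The system is an end extension system: `s ◁ t` implies `N_s ∩ κ ◁ N_t ∩ κ`. -/
def IsEndExtension (S : ModelSystem χ κ R α θ σ n) : Prop :=
  ∀ s t : FinSub S.B n, ProperInit (s.1 : Set Ordinal.{u}) (t.1 : Set Ordinal.{u}) →
    ProperInit ((S.N s).ords ∩ Set.Iio κ.ord) ((S.N t).ords ∩ Set.Iio κ.ord)

/-- The system is a system for `x`: each `N_s` contains `x` and each `H_{s,t}` fixes it. -/
def IsFor (S : ModelSystem χ κ R α θ σ n) (x : HModel χ R) : Prop :=
  (∀ s, x ∈ S.N s) ∧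
    ∀ (s t : FinSub S.B n) (h : s.1.card = t.1.card) (hx : x ∈ S.N s),
      (S.H s t h ⟨x, hx⟩ : HModel χ R) = x

end ModelSystem

/-! Finitary operations on `κ` are treated as unary functions on codes of finite lists, and a clone
is a family of them closed under composition, pairing and least search. The theorem reduces to
finding sets of order type `ω * α` that are indiscernible for a small clone.

Part (1). Enumerate by `κ` an elementary submodel of `H(χ)` of size `κ` that contains `x` and the
ordinals up to `κ`, and let `T` be the clone generated by its Skolem functions and a few others. The
regressive relation makes `κ` regular and yields a set `A` of closure points of `T` that is
indiscernible even with parameters below the lists compared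
(`RegressiveArrow.exists_endIndiscernible`): a regressive function returns the least code of a
counterexample, and homogeneity would then make three truth values pairwise different. The model
`N_s` is not the Skolem hull of `s`. It consists of the stable values at `s`: values `f(s, v)` that
do not depend on the long list `v` of elements of `A` beyond `s`. A value lying below `v` is
automatically stable (`EndIndiscernible.mem_stableHull_of_lt`). This gives end extension, and also
`N_s ∩ N_t = N_{s ∩ t}`, by induction on the last entries (`EndIndiscernible.mem_stableHull_inter`).
The isomorphisms carry the stable value of `f` at `s` to the stable value of `f` at `t`.

Part (2). Let `κ` be least with the partition relation. Among the indiscernible sets of type `ω * α`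
for a suitable countable clone, choose one, `H`, that contains the smallest possible ordinal `m`. On
consecutive blocks of `H` a function of the clone is constant or increasing. If it increases, the
images of blocks form an indiscernible set of the same type, so for a regressive function they would
reach below `m`. Hence regressive functions are constant on blocks. If `H` missed the club, the same
argument would confine it to one gap, below some `γ < κ`; collapsing `γ` to `|γ|` then contradicts
the leastness of `κ`. A Ramsey cardinal is the case of two colours and type `ω * κ = κ`. -/

/-! ### Algebras of unary functions on a set with a pairing function -/

/-- A pairing function on `K`, with its projections and a distinguished point. -/
structure Pairing (K : Type*) where
  /-- the pairing function -/
  pair : K → K → K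
  /-- the first projection -/
  fst : K → K
  /-- the second projection -/
  snd : K → K
  /-- the distinguished point -/
  zero : K
  fst_pair : ∀ a b, fst (pair a b) = a
  snd_pair : ∀ a b, snd (pair a b) = b

namespace Pairing

variable {K : Type*} (P : Pairing K)

/-- The code of a finite list. -/
def code (l : List K) : K := l.foldr P.pair P.zero

@[simp] theorem code_nil : P.code [] = P.zero := rfl

@[simp] theorem code_cons (a : K) (l : List K) : P.code (a :: l) = P.pair a (P.code l) := rfl

/-- The `n`-th entry of a coded list. -/
def nth (n : ℕ) (k : K) : K := P.fst (P.snd^[n] k)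

theorem nth_code (n : ℕ) (l : List K) (h : n < l.length) : P.nth n (P.code l) = l[n] := by
  induction l generalizing n with
  | nil => simp at h
  | cons a l ih =>
    cases n with
    | zero => simp [nth, P.fst_pair]
    | succ n =>
      have := ih n (by simpa using h)
      simpa [nth, P.snd_pair] using this

/-- The list of the first `n` entries of a coded list. -/
def decode (n : ℕ) (k : K) : List K := (List.range n).map fun i => P.nth i k

theorem decode_code (l : List K) : P.decode l.length (P.code l) = l := by
  apply List.ext_getElem
  · simp [decode]
  · intro i h1 h2
    simp [decode, P.nth_code i l h2]

end Pairing

/-- A set of unary functions on the well ordered set `K` that is closed under composition, pairing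
and the search for least solutions; it decides equality and order by comparison with `zero`. -/
structure Clone (K : Type*) [LinearOrder K] extends Pairing K where
  /-- the functions of the clone -/
  fns : Set (K → K)
  id_mem : id ∈ fns
  fst_mem : fst ∈ fns
  snd_mem : snd ∈ fns
  zero_mem : (fun _ => zero) ∈ fns
  comp_mem : ∀ f ∈ fns, ∀ g ∈ fns, f ∘ g ∈ fns
  prod_mem : ∀ f ∈ fns, ∀ g ∈ fns, (fun x => pair (f x) (g x)) ∈ fns
  least : ∀ f ∈ fns, ∃ g ∈ fns, ∀ η y q, f (pair η q) = y →
    f (pair (g (pair y q)) q) = y ∧ g (pair y q) ≤ η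
  eq_test : ∃ g ∈ fns, ∀ a b, g (pair a b) = zero ↔ a = b
  lt_test : ∃ g ∈ fns, ∀ a b, g (pair a b) = zero ↔ a < b

namespace Clone

variable {K : Type*} [LinearOrder K] (T : Clone K)

theorem iterate_snd_mem (n : ℕ) : T.snd^[n] ∈ T.fns := by
  induction n with
  | zero => exact T.id_mem
  | succ n ih => exact T.comp_mem _ ih _ T.snd_mem

theorem nth_mem (n : ℕ) : T.nth n ∈ T.fns :=
  T.comp_mem _ T.fst_mem _ (T.iterate_snd_mem n)

/-- The code of a list of values of functions of the clone is a function of the clone. -/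
theorem code_map_mem {ι : Type*} (f : ι → K → K) (l : List ι) (hf : ∀ i ∈ l, f i ∈ T.fns) :
    (fun x => T.code (l.map fun i => f i x)) ∈ T.fns := by
  induction l with
  | nil => exact T.zero_mem
  | cons i l ih =>
    exact T.prod_mem _ (hf i (by simp)) _ (ih fun j hj => hf j (by simp [hj]))

theorem decode_mem (n : ℕ) : (fun x => T.code (T.decode n x)) ∈ T.fns :=
  T.code_map_mem (fun i => T.nth i) _ fun i _ => T.nth_mem i

/-- Codes of lists are rearranged by functions of the clone. -/
theorem exists_reindex (L L' : List K) (h : ∀ a ∈ L', a ∈ L) :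
    ∃ r ∈ T.fns, ∀ σ : K → K, r (T.code (L.map σ)) = T.code (L'.map σ) := by
  classical
  refine ⟨_, T.code_map_mem (fun a => T.nth (L.idxOf a)) L' fun a _ => T.nth_mem _, fun σ => ?_⟩
  congr 1
  apply List.map_congr_left
  intro a ha
  have hlt := List.idxOf_lt_length_of_mem (h a ha)
  rw [T.nth_code _ _ (by simpa using hlt)]
  simp

theorem eq_test_mem {f g : K → K} (hf : f ∈ T.fns) (hg : g ∈ T.fns) :
    ∃ t ∈ T.fns, ∀ x, t x = T.zero ↔ f x = g x := by
  obtain ⟨e, he, h⟩ := T.eq_test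
  exact ⟨_, T.comp_mem _ he _ (T.prod_mem _ hf _ hg), fun x => h _ _⟩

theorem lt_test_mem {f g : K → K} (hf : f ∈ T.fns) (hg : g ∈ T.fns) :
    ∃ t ∈ T.fns, ∀ x, t x = T.zero ↔ f x < g x := by
  obtain ⟨e, he, h⟩ := T.lt_test
  exact ⟨_, T.comp_mem _ he _ (T.prod_mem _ hf _ hg), fun x => h _ _⟩

/-- A code does not record the length of its list, so list operations are available in the clone
only for prescribed lengths. -/
theorem exists_take (n : ℕ) :
    ∃ r ∈ T.fns, ∀ l l' : List K, l.length = n → r (T.code (l ++ l')) = T.code l := by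
  refine ⟨_, T.decode_mem n, fun l l' h => ?_⟩
  subst h
  congr 1
  apply List.ext_getElem
  · simp [Pairing.decode]
  · intro i h1 h2
    simp only [Pairing.decode, List.getElem_map, List.getElem_range]
    rw [T.nth_code i _ (by simp; omega)]
    simp [List.getElem_append_left h2]

theorem exists_drop (n : ℕ) :
    ∃ r ∈ T.fns, ∀ l l' : List K, l.length = n → r (T.code (l ++ l')) = T.code l' := by
  refine ⟨_, T.iterate_snd_mem n, fun l l' h => ?_⟩
  subst h
  induction l with
  | nil => rfl
  | cons a l ih => simpa [T.snd_pair] using ih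

theorem exists_append (n : ℕ) :
    ∃ r ∈ T.fns, ∀ l l' : List K, l.length = n →
      r (T.pair (T.code l) (T.code l')) = T.code (l ++ l') := by
  induction n with
  | zero =>
    refine ⟨_, T.snd_mem, fun l l' h => ?_⟩
    rw [List.length_eq_zero_iff] at h
    simp [h, T.snd_pair]
  | succ n ih =>
    obtain ⟨r, hr, h⟩ := ih
    refine ⟨_, T.prod_mem _ (T.comp_mem _ T.fst_mem _ T.fst_mem) _
      (T.comp_mem _ hr _ (T.prod_mem _ (T.comp_mem _ T.snd_mem _ T.fst_mem) _ T.snd_mem)),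
      fun l l' hl => ?_⟩
    cases l with
    | nil => simp at hl
    | cons a l => simp [T.fst_pair, T.snd_pair, h l l' (by simpa using hl)]

theorem exists_remove (n m : ℕ) :
    ∃ r ∈ T.fns, ∀ l l₁ l' : List K, l.length = n → l₁.length = m →
      r (T.code (l ++ (l₁ ++ l'))) = T.code (l ++ l') := by
  obtain ⟨t, ht, ht'⟩ := T.exists_take n
  obtain ⟨d, hd, hd'⟩ := T.exists_drop (n + m)
  obtain ⟨r, hr, hr'⟩ := T.exists_append n
  refine ⟨_, T.comp_mem _ hr _ (T.prod_mem _ ht _ hd), fun l l₁ l' h h₁ => ?_⟩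
  have hdl := hd' (l ++ l₁) l' (by simp [h, h₁])
  rw [List.append_assoc] at hdl
  simp only [Function.comp_apply, ht' l _ h, hdl, hr' l _ h]

/-- Rearranging the first entries of coded lists. -/
theorem exists_reindex_append (L L' : List K) (h : ∀ a ∈ L', a ∈ L) :
    ∃ r ∈ T.fns, ∀ (σ : K → K) (v : List K), r (T.code (L.map σ ++ v)) = T.code (L'.map σ ++ v) := by
  obtain ⟨i, hi, hi'⟩ := T.exists_reindex L L' h
  obtain ⟨t, ht, ht'⟩ := T.exists_take L.length
  obtain ⟨d, hd, hd'⟩ := T.exists_drop L.length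
  obtain ⟨r, hr, hr'⟩ := T.exists_append L'.length
  refine ⟨_, T.comp_mem _ hr _ (T.prod_mem _ (T.comp_mem _ hi _ ht) _ hd), fun σ v => ?_⟩
  simp only [Function.comp_apply, ht' _ v (L.length_map σ), hd' _ v (L.length_map σ), hi',
    hr' _ v (L'.length_map σ)]

end Clone

/-! ### Generation of clones -/

/-- The operations that generate a clone. -/
inductive CloneOp : ℕ → Type
  | least : CloneOp 1
  | comp : CloneOp 2
  | prod : CloneOp 2

/-- The language of clones. -/
def cloneLanguage : FirstOrder.Language.{0, 0} := ⟨CloneOp, fun _ => Empty⟩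

theorem card_cloneOp_le : Cardinal.mk (Σ n, cloneLanguage.Functions n) ≤ Cardinal.aleph0 := by
  rw [Cardinal.mk_le_aleph0_iff]
  have : ∀ n, Countable (cloneLanguage.Functions n) := by
    intro n
    refine ⟨⟨fun | CloneOp.least => 0 | CloneOp.comp => 1 | CloneOp.prod => 2, ?_⟩⟩
    intro a b h
    cases a <;> cases b <;> first | rfl | simp_all
  infer_instance

namespace Pairing

variable {K : Type*} [LinearOrder K] [WellFoundedLT K] (P : Pairing K)

/-- Target and parameter are packed into one argument to keep the search unary. It serves to replace
the code of a list by a smaller solution that can be computed from the value alone. -/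
theorem exists_least (f : K → K) : ∃ g : K → K, ∀ η y q, f (P.pair η q) = y →
    f (P.pair (g (P.pair y q)) q) = y ∧ g (P.pair y q) ≤ η := by
  classical
  have h : ∀ x : K, ∃ z, ∀ η, f (P.pair η (P.snd x)) = P.fst x →
      f (P.pair z (P.snd x)) = P.fst x ∧ z ≤ η := by
    intro x
    by_cases hx : ∃ η, f (P.pair η (P.snd x)) = P.fst x
    · let S := {η | f (P.pair η (P.snd x)) = P.fst x}
      have hS : S.Nonempty := hx
      exact ⟨wellFounded_lt.min S hS, fun η hη => ⟨wellFounded_lt.min_mem S hS,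
        not_lt.1 (wellFounded_lt.not_lt_min S hη)⟩⟩
    · exact ⟨x, fun η hη => (hx ⟨η, hη⟩).elim⟩
  choose g hg using h
  refine ⟨g, fun η y q h => ?_⟩
  have := hg (P.pair y q) η
  simp only [P.fst_pair, P.snd_pair] at this
  exact this h

/-- The action of the operations on functions. -/
noncomputable abbrev cloneStructure : cloneLanguage.Structure (K → K) where
  funMap := fun {_} o =>
    match o with
    | CloneOp.least => fun v => (P.exists_least (v 0)).choose
    | CloneOp.comp => fun v => v 0 ∘ v 1
    | CloneOp.prod => fun v => fun x => P.pair (v 0 x) (v 1 x)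
  RelMap := fun r => Empty.elim r

open Classical in
/-- The functions from which a clone is generated. -/
noncomputable def generators [Nontrivial K] (base : Set (K → K)) : Set (K → K) :=
  base ∪ {id, P.fst, P.snd, fun _ => P.zero,
    fun x => if P.fst x = P.snd x then P.zero else (exists_ne P.zero).choose,
    fun x => if P.fst x < P.snd x then P.zero else (exists_ne P.zero).choose}

/-- The functions of the clone generated by a set of functions. -/
noncomputable def genFns [Nontrivial K] (base : Set (K → K)) : Set (K → K) :=
  letI := P.cloneStructure
  ((FirstOrder.Language.Substructure.closure cloneLanguage (P.generators base) :
    cloneLanguage.Substructure (K → K)) : Set (K → K))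

variable [Nontrivial K]

theorem generators_subset (base : Set (K → K)) : P.generators base ⊆ P.genFns base :=
  letI := P.cloneStructure
  FirstOrder.Language.Substructure.subset_closure

theorem fun_mem_genFns (base : Set (K → K)) {n : ℕ} (o : CloneOp n) (v : Fin n → K → K)
    (hv : ∀ i, v i ∈ P.genFns base) :
    P.cloneStructure.funMap (L := cloneLanguage) o v ∈ P.genFns base :=
  letI := P.cloneStructure
  FirstOrder.Language.Substructure.fun_mem _ o v hv

/-- The clone generated by a set of functions. -/
noncomputable def genClone (base : Set (K → K)) : Clone K where
  toPairing := P
  fns := P.genFns base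
  id_mem := P.generators_subset base (by simp [generators])
  fst_mem := P.generators_subset base (by simp [generators])
  snd_mem := P.generators_subset base (by simp [generators])
  zero_mem := P.generators_subset base (by simp [generators])
  comp_mem f hf g hg := P.fun_mem_genFns base CloneOp.comp ![f, g]
    (fun i => by fin_cases i <;> assumption)
  prod_mem f hf g hg := P.fun_mem_genFns base CloneOp.prod ![f, g]
    (fun i => by fin_cases i <;> assumption)
  least f hf := ⟨_, P.fun_mem_genFns base CloneOp.least ![f] (fun i => by fin_cases i; assumption),
    (P.exists_least f).choose_spec⟩
  eq_test := by
    classical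
    refine ⟨_, P.generators_subset base (a := fun x => if P.fst x = P.snd x then P.zero else
      (exists_ne P.zero).choose) (by simp [generators]), fun a b => ?_⟩
    have := (exists_ne P.zero).choose_spec
    by_cases h : a = b <;> simp [P.fst_pair, P.snd_pair, h, this]
  lt_test := by
    classical
    refine ⟨_, P.generators_subset base (a := fun x => if P.fst x < P.snd x then P.zero else
      (exists_ne P.zero).choose) (by simp [generators]), fun a b => ?_⟩
    have := (exists_ne P.zero).choose_spec
    by_cases h : a < b <;> simp [P.fst_pair, P.snd_pair, h, this]

theorem base_subset_genClone (base : Set (K → K)) : base ⊆ (P.genClone base).fns :=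
  fun _ hf => P.generators_subset base (Or.inl hf)

/-- Since the clone is a generated substructure in a countable language, the usual bound for
closures applies. -/
theorem card_genClone_le (base : Set (K → K)) :
    Cardinal.mk (P.genClone base).fns ≤ max Cardinal.aleph0 (Cardinal.mk base) := by
  let := P.cloneStructure
  have h := FirstOrder.Language.Substructure.lift_card_closure_le (L := cloneLanguage)
    (s := P.generators base)
  have h1 : Cardinal.mk (P.generators base) ≤ max Cardinal.aleph0 (Cardinal.mk base) := by
    refine (Cardinal.mk_union_le _ _).trans ((Cardinal.add_le_max _ _).trans ?_)
    refine max_le (max_le (le_max_right _ _) (le_max_of_le_left ?_)) (le_max_left _ _)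
    exact (Set.Finite.lt_aleph0 (Set.toFinite _)).le
  simp only [Cardinal.lift_id'] at h
  refine h.trans (max_le (le_max_left _ _) ((Cardinal.add_le_max _ _).trans ?_))
  refine max_le (max_le h1 (le_max_of_le_left ?_)) (le_max_left _ _)
  simpa using Cardinal.lift_le.2 card_cloneOp_le

end Pairing

/-! ### Increasing lists -/

/-- `l` is a strictly increasing list of elements of `A`. -/
def IncIn {K : Type*} [LinearOrder K] (A : Set K) (l : List K) : Prop :=
  l.Pairwise (· < ·) ∧ ∀ a ∈ l, a ∈ A

namespace IncIn

variable {K : Type*} [LinearOrder K] {A : Set K} {l l' : List K}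

theorem nil : IncIn A [] := ⟨List.Pairwise.nil, by simp⟩

theorem singleton {a : K} (ha : a ∈ A) : IncIn A [a] := ⟨List.pairwise_singleton _ _, by simpa⟩

theorem append (h : IncIn A l) (h' : IncIn A l') (hlt : ∀ a ∈ l, ∀ b ∈ l', a < b) :
    IncIn A (l ++ l') :=
  ⟨List.pairwise_append.2 ⟨h.1, h'.1, hlt⟩, fun a ha => (List.mem_append.1 ha).elim (h.2 a) (h'.2 a)⟩

theorem left (h : IncIn A (l ++ l')) : IncIn A l :=
  ⟨(List.pairwise_append.1 h.1).1, fun a ha => h.2 a (by simp [ha])⟩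

theorem right (h : IncIn A (l ++ l')) : IncIn A l' :=
  ⟨(List.pairwise_append.1 h.1).2.1, fun a ha => h.2 a (by simp [ha])⟩

theorem lt_of_append (h : IncIn A (l ++ l')) : ∀ a ∈ l, ∀ b ∈ l', a < b :=
  (List.pairwise_append.1 h.1).2.2

theorem sort_toFinset [DecidableEq K] (h : IncIn A l) : l.toFinset.sort = l := by
  have hn : l.Nodup := h.1.imp fun h => h.ne
  exact (List.toFinset_sort (· ≤ ·) hn).2 (h.1.imp fun h => h.le)

theorem card_toFinset [DecidableEq K] (h : IncIn A l) : l.toFinset.card = l.length :=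
  List.toFinset_card_of_nodup (h.1.imp fun h => h.ne)

theorem sort {s : Finset K} (h : (s : Set K) ⊆ A) : IncIn A s.sort :=
  ⟨s.sortedLT_sort.pairwise, fun _ ha => h (by simpa using ha)⟩

end IncIn

/-- `A` is nonempty and has no last element. -/
def Endless {K : Type*} [LinearOrder K] (A : Set K) : Prop :=
  A.Nonempty ∧ ∀ a ∈ A, ∃ b ∈ A, a < b

namespace Endless

variable {K : Type*} [LinearOrder K] {A : Set K}

theorem exists_gt (hA : Endless A) (L : List K) (hL : ∀ a ∈ L, a ∈ A) :
    ∃ b ∈ A, ∀ a ∈ L, a < b := by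
  induction L with
  | nil => exact ⟨hA.1.some, hA.1.some_mem, by simp⟩
  | cons a L ih =>
    obtain ⟨b, hb, h⟩ := ih fun x hx => hL x (by simp [hx])
    have hm : max a b ∈ A := by
      rcases max_choice a b with h | h <;> rw [h]
      exacts [hL a (by simp), hb]
    obtain ⟨c, hc, hlt⟩ := hA.2 _ hm
    refine ⟨c, hc, fun x hx => ?_⟩
    rcases List.mem_cons.1 hx with rfl | hx
    · exact (le_max_left _ _).trans_lt hlt
    · exact (h x hx).trans ((le_max_right _ _).trans_lt hlt)

/-- There are increasing lists of any length above a given finite list. -/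
theorem exists_incIn (hA : Endless A) (L : List K) (hL : ∀ a ∈ L, a ∈ A) (n : ℕ) :
    ∃ l, IncIn A l ∧ l.length = n ∧ ∀ a ∈ L, ∀ b ∈ l, a < b := by
  induction n with
  | zero => exact ⟨[], IncIn.nil, rfl, by simp⟩
  | succ n ih =>
    obtain ⟨l, hl, hn, hlt⟩ := ih
    obtain ⟨b, hb, h⟩ := hA.exists_gt (L ++ l) (fun a ha => (List.mem_append.1 ha).elim (hL a) (hl.2 a))
    refine ⟨l ++ [b], hl.append (IncIn.singleton hb) fun a ha c hc => ?_, by simp [hn],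
      fun a ha c hc => ?_⟩
    · rw [List.mem_singleton.1 hc]
      exact h a (by simp [ha])
    · rcases List.mem_append.1 hc with hc | hc
      · exact hlt a ha c hc
      · rw [List.mem_singleton.1 hc]
        exact h a (by simp [ha])

end Endless

/-! ### Sets of order type `ω * α` and their blocks -/

theorem Ordinal.omega0_mul_add_one_lt {α ξ : Ordinal.{u}} (h : ξ < Ordinal.omega0 * α) :
    ξ + 1 < Ordinal.omega0 * α := by
  rcases eq_or_ne α 0 with rfl | hα
  · simp at h
  · have : Order.IsSuccLimit (Ordinal.omega0 * α) :=
      Ordinal.isSuccLimit_mul_left Ordinal.isSuccLimit_omega0 (pos_iff_ne_zero.2 hα)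
    simpa using this.succ_lt h

/-- As `n * ω = ω`, the ordinal `ω * α` absorbs `n` on the left. It therefore has room for `ω * α`
consecutive blocks of length `n`. -/
theorem Ordinal.natCast_mul_add_lt {α ξ : Ordinal.{u}} (h : ξ < Ordinal.omega0 * α) {n j : ℕ}
    (hj : j < n) : (n : Ordinal.{u}) * ξ + j < Ordinal.omega0 * α := by
  have hn : 0 < n := by omega
  calc (n : Ordinal.{u}) * ξ + j < (n : Ordinal.{u}) * ξ + n := by
        gcongr
    _ = (n : Ordinal.{u}) * (ξ + 1) := by rw [mul_add, mul_one]
    _ ≤ (n : Ordinal.{u}) * (Ordinal.omega0 * α) :=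
        mul_le_mul_right (Ordinal.omega0_mul_add_one_lt h).le _
    _ = Ordinal.omega0 * α := by rw [← mul_assoc, Ordinal.natCast_mul_omega0 hn]

namespace HasOrderType

variable {X : Type (u + 1)} [LinearOrder X] {A : Set X} {α : Ordinal.{u}}

theorem endless (h : HasOrderType A (Ordinal.omega0 * α)) (hα : α ≠ 0) : Endless A := by
  obtain ⟨e⟩ := h
  have h0 : (0 : Ordinal.{u}) < Ordinal.omega0 * α :=
    mul_pos Ordinal.omega0_pos (pos_iff_ne_zero.2 hα)
  refine ⟨⟨_, (e ⟨0, h0⟩).2⟩, fun a ha => ?_⟩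
  obtain ⟨⟨ξ, hξ⟩, hx⟩ := e.surjective ⟨a, ha⟩
  refine ⟨_, (e ⟨ξ + 1, Ordinal.omega0_mul_add_one_lt hξ⟩).2, ?_⟩
  have : (⟨a, ha⟩ : A) < e ⟨ξ + 1, Ordinal.omega0_mul_add_one_lt hξ⟩ := by
    rw [← hx, e.lt_iff_lt]
    exact Subtype.mk_lt_mk.2 (lt_add_one ξ)
  exact this

/-- A set of type `ω * α` splits into `ω * α` consecutive blocks of length `n`. -/
theorem exists_blocks (h : HasOrderType A (Ordinal.omega0 * α)) (n : ℕ) :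
    ∃ s : Set.Iio (Ordinal.omega0 * α) → List X, (∀ ξ, IncIn A (s ξ) ∧ (s ξ).length = n) ∧
      (∀ ξ ξ', ξ < ξ' → ∀ a ∈ s ξ, ∀ b ∈ s ξ', a < b) ∧
      (n ≠ 0 → ∀ a ∈ A, (∀ b ∈ A, a ≤ b) → ∃ ξ, a ∈ s ξ) := by
  obtain ⟨e⟩ := h
  let g : Set.Iio (Ordinal.omega0 * α) → Fin n → A := fun ξ j =>
    e ⟨(n : Ordinal.{u}) * ξ.1 + (j : ℕ), Ordinal.natCast_mul_add_lt ξ.2 j.2⟩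
  refine ⟨fun ξ => List.ofFn fun j => (g ξ j : X), fun ξ => ⟨⟨?_, ?_⟩, by simp⟩, ?_, ?_⟩
  · rw [List.pairwise_ofFn]
    intro i j hij
    refine Subtype.coe_lt_coe.2 (e.lt_iff_lt.2 (Subtype.mk_lt_mk.2 ?_))
    gcongr
    exact hij
  · intro a ha
    obtain ⟨j, rfl⟩ := (List.mem_ofFn' _ _).1 ha
    exact (g ξ j).2
  · intro ξ ξ' hlt a ha b hb
    obtain ⟨j, rfl⟩ := (List.mem_ofFn' _ _).1 ha
    obtain ⟨j', rfl⟩ := (List.mem_ofFn' _ _).1 hb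
    have hlt' : ξ.1 < ξ'.1 := hlt
    have key : (n : Ordinal.{u}) * ξ.1 + (j : ℕ) < (n : Ordinal.{u}) * ξ'.1 + (j' : ℕ) :=
      calc (n : Ordinal.{u}) * ξ.1 + (j : ℕ) < (n : Ordinal.{u}) * ξ.1 + n := by
            gcongr
            exact j.2
        _ = (n : Ordinal.{u}) * (ξ.1 + 1) := by rw [mul_add, mul_one]
        _ ≤ (n : Ordinal.{u}) * ξ'.1 := mul_le_mul_right (Order.add_one_le_of_lt hlt') _
        _ ≤ _ := le_self_add
    exact Subtype.coe_lt_coe.2 (e.lt_iff_lt.2 (Subtype.mk_lt_mk.2 key))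
  · intro hn a ha hmin
    obtain ⟨⟨ξ, hξ⟩, hx⟩ := e.surjective ⟨a, ha⟩
    have hpos : (0 : Ordinal.{u}) < Ordinal.omega0 * α := (zero_le).trans_lt hξ
    refine ⟨⟨0, hpos⟩, (List.mem_ofFn' _ _).2 ⟨⟨0, by omega⟩, ?_⟩⟩
    apply le_antisymm
    · have : e ⟨(n : Ordinal.{u}) * 0 + (0 : ℕ), by simpa using hpos⟩ ≤ e ⟨ξ, hξ⟩ := by
        rw [e.le_iff_le]
        simp
      rw [hx] at this
      exact this
    · exact hmin _ (g _ _).2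

end HasOrderType

/-- The partition relation gives sets that are homogeneous for countably many colourings. -/
theorem PartitionArrow.exists_homogeneous {κ μ : Cardinal.{u}} {α : Ordinal.{u}}
    (h : PartitionArrow κ (Ordinal.omega0 * α) μ) (hα : α ≠ 0)
    (G : ℕ → List (OrdBelow κ) → OrdBelow μ) :
    ∃ A : Set (OrdBelow κ), HasOrderType A (Ordinal.omega0 * α) ∧
      ∀ i l l', IncIn A l → IncIn A l' → l.length = l'.length → G i l = G i l' := by
  -- The size of `W` codes a pair `(i, j)`, and `F` applies colouring `i` to the first `j` elements.
  -- A list of length `j` is padded beyond its end to size `Nat.pair i j`, so one homogeneous set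
  -- serves all the colourings.
  let F : Finset (OrdBelow κ) → OrdBelow μ := fun W =>
    G W.card.unpair.1 (W.sort.take W.card.unpair.2)
  obtain ⟨A, hA, hF⟩ := h F
  refine ⟨A, hA, fun i l l' hl hl' hlen => ?_⟩
  have key : ∀ l, IncIn A l → ∃ W : Finset (OrdBelow κ), (W : Set _) ⊆ A ∧
      W.card = Nat.pair i l.length ∧ W.sort.take l.length = l := by
    intro l hl
    obtain ⟨u, hu, hun, hlt⟩ := (hA.endless hα).exists_incIn l hl.2 (Nat.pair i l.length - l.length)
    have happ := hl.append hu hlt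
    refine ⟨(l ++ u).toFinset, fun a ha => happ.2 a (by simpa using ha), ?_, ?_⟩
    · rw [happ.card_toFinset, List.length_append, hun]
      have := Nat.right_le_pair i l.length
      omega
    · rw [happ.sort_toFinset]
      simp
  obtain ⟨W, hWA, hc, ht⟩ := key l hl
  obtain ⟨W', hWA', hc', ht'⟩ := key l' hl'
  have := hF W W' hWA hWA' (by rw [hc, hc', hlen])
  simpa [F, hc, hc', ht, ht'] using this

/-! ### Indiscernibles -/

/-- The functions of the clone take the same value in `M`, or no value in `M`, at all increasing
lists of elements of `H` of the same length. -/
def Indiscernible {K : Type*} [LinearOrder K] (T : Clone K) (M H : Set K) : Prop :=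
  ∀ φ ∈ T.fns, ∀ l l', IncIn H l → IncIn H l' → l.length = l'.length →
    φ (T.code l) ∈ M → φ (T.code l') = φ (T.code l)

namespace Indiscernible

variable {K : Type (u + 1)} [LinearOrder K] {T : Clone K} {M H : Set K} {α : Ordinal.{u}}

/-- A successful test has the value `T.zero`, which lies in `M`. This transfers success in both
directions, wherever the value on failure may lie. -/
theorem test (hH : Indiscernible T M H) (hM : T.zero ∈ M) {t : K → K} (ht : t ∈ T.fns)
    {l l' : List K} (hl : IncIn H l) (hl' : IncIn H l') (hlen : l.length = l'.length) :
    t (T.code l) = T.zero ↔ t (T.code l') = T.zero :=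
  ⟨fun h => (hH t ht l l' hl hl' hlen (h ▸ hM)).trans h,
    fun h => (hH t ht l' l hl' hl hlen.symm (h ▸ hM)).trans h⟩

/-- On consecutive lists of indiscernibles a function of the clone is constant or increasing. -/
theorem const_or_increasing [WellFoundedLT K] (hH : Indiscernible T M H) (hM : T.zero ∈ M)
    (hα : α ≠ 0) (hT : HasOrderType H (Ordinal.omega0 * α)) {φ : K → K} (hφ : φ ∈ T.fns) (n : ℕ) :
    (∀ l l', IncIn H (l ++ l') → l.length = n → l'.length = n → φ (T.code l) = φ (T.code l')) ∨
    (∀ l l', IncIn H (l ++ l') → l.length = n → l'.length = n → φ (T.code l) < φ (T.code l')) := by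
  obtain ⟨r, hr, hr'⟩ := T.exists_take n
  obtain ⟨d, hd, hd'⟩ := T.exists_drop n
  obtain ⟨te, hte, hte'⟩ := T.eq_test_mem (T.comp_mem _ hφ _ hr) (T.comp_mem _ hφ _ hd)
  obtain ⟨tl, htl, htl'⟩ := T.lt_test_mem (T.comp_mem _ hφ _ hr) (T.comp_mem _ hφ _ hd)
  obtain ⟨s, hs, hlt, -⟩ := hT.exists_blocks n
  have hpos : (0 : Ordinal.{u}) < Ordinal.omega0 * α :=
    mul_pos Ordinal.omega0_pos (pos_iff_ne_zero.2 hα)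
  have hk : ∀ k : ℕ, (k : Ordinal.{u}) < Ordinal.omega0 * α := by
    intro k
    induction k with
    | zero => simpa using hpos
    | succ k ih => simpa using Ordinal.omega0_mul_add_one_lt ih
  have happ : ∀ ξ ξ', ξ < ξ' → IncIn H (s ξ ++ s ξ') := fun ξ ξ' h =>
    (hs ξ).1.append (hs ξ').1 (hlt ξ ξ' h)
  let j : ℕ → Set.Iio (Ordinal.omega0 * α) := fun k => ⟨k, hk k⟩
  have hj : ∀ k, j k < j (k + 1) := fun k => Subtype.mk_lt_mk.2 (by simp)
  have h01 : j 0 < j 1 := hj 0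
  rcases lt_trichotomy (φ (T.code (s (j 0)))) (φ (T.code (s (j 1)))) with h | h | h
  · right
    intro l l' hl hn hn'
    have := (hH.test hM htl (happ _ _ h01) hl (by simp [hs, hn, hn'])).1
      ((htl' _).2 (by simpa [hr', hd', hs] using h))
    simpa [htl', hr' l l' hn, hd' l l' hn] using this
  · left
    intro l l' hl hn hn'
    have := (hH.test hM hte (happ _ _ h01) hl (by simp [hs, hn, hn'])).1
      ((hte' _).2 (by simpa [hr', hd', hs] using h))
    simpa [hte', hr' l l' hn, hd' l l' hn] using this
  -- A drop between the first two blocks would recur at every consecutive pair of blocks, giving an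
  -- infinite descent.
  · exfalso
    let a : ℕ → K := fun k => φ (T.code (s (j k)))
    have hdesc : ∀ k, a (k + 1) < a k := by
      intro k
      by_contra hcon
      rcases lt_or_eq_of_le (not_lt.1 hcon) with h' | h'
      · have := (hH.test hM htl (happ _ _ (hj k)) (happ _ _ h01) (by simp [hs])).1
          ((htl' _).2 (by simpa [hr', hd', hs] using h'))
        rw [htl'] at this
        simp only [Function.comp_apply, hr' _ _ (hs _).2, hd' _ _ (hs _).2] at this
        exact absurd this h.le.not_gt
      · have := (hH.test hM hte (happ _ _ (hj k)) (happ _ _ h01) (by simp [hs])).1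
          ((hte' _).2 (by simpa [hr', hd', hs] using h'))
        rw [hte'] at this
        simp only [Function.comp_apply, hr' _ _ (hs _).2, hd' _ _ (hs _).2] at this
        exact absurd this h.ne'
    obtain ⟨k, hk'⟩ : ∃ k, ∀ j, ¬ a j < a k := by
      have := wellFounded_lt.min_mem (Set.range a) ⟨_, 0, rfl⟩
      obtain ⟨k, hk'⟩ := this
      exact ⟨k, fun j => hk' ▸ wellFounded_lt.not_lt_min (Set.range a) ⟨j, rfl⟩⟩
    exact hk' _ (hdesc k)

/-- Turns a function of a list of images `φ(block)` into a function of the concatenated blocks;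
through it indiscernibility passes from the blocks to their images. -/
theorem exists_code_flatMap {ι : Type*} {φ : K → K} (hφ : φ ∈ T.fns) (s : ι → List K) (n : ℕ)
    (hs : ∀ ξ, (s ξ).length = n) (m : ℕ) :
    ∃ ρ ∈ T.fns, ∀ ξs : List ι, ξs.length = m →
      ρ (T.code (ξs.flatMap s)) = T.code (ξs.map fun ξ => φ (T.code (s ξ))) := by
  induction m with
  | zero =>
    refine ⟨_, T.zero_mem, fun ξs h => ?_⟩
    rw [List.length_eq_zero_iff] at h
    simp [h]
  | succ m ih =>
    obtain ⟨ρ, hρ, h⟩ := ih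
    obtain ⟨r, hr, hr'⟩ := T.exists_take n
    obtain ⟨d, hd, hd'⟩ := T.exists_drop n
    refine ⟨_, T.prod_mem _ (T.comp_mem _ hφ _ hr) _ (T.comp_mem _ hρ _ hd), fun ξs hm => ?_⟩
    cases ξs with
    | nil => simp at hm
    | cons ξ ξs =>
      have hm' : ξs.length = m := by simpa using hm
      simp [hr' _ _ (hs ξ), hd' _ _ (hs ξ), h _ hm']

/-- The increasing images of blocks of indiscernibles are again indiscernible. -/
theorem exists_image [WellFoundedLT K] (hH : Indiscernible T M H)
    (hT : HasOrderType H (Ordinal.omega0 * α)) {φ : K → K} (hφ : φ ∈ T.fns) {n : ℕ} (hn : n ≠ 0)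
    (hinc : ∀ l l', IncIn H (l ++ l') → l.length = n → l'.length = n →
      φ (T.code l) < φ (T.code l')) {a : K} (ha : a ∈ H) (hmin : ∀ b ∈ H, a ≤ b) :
    ∃ X, HasOrderType X (Ordinal.omega0 * α) ∧ Indiscernible T M X ∧
      ∃ l, IncIn H l ∧ l.length = n ∧ a ∈ l ∧ φ (T.code l) ∈ X := by
  obtain ⟨s, hs, hlt, h0⟩ := hT.exists_blocks n
  obtain ⟨ξ0, hξ0⟩ := h0 hn a ha hmin
  let g : Set.Iio (Ordinal.omega0 * α) → K := fun ξ => φ (T.code (s ξ))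
  have hg : StrictMono g := fun ξ ξ' h =>
    hinc _ _ ((hs ξ).1.append (hs ξ').1 (hlt ξ ξ' h)) (hs ξ).2 (hs ξ').2
  refine ⟨Set.range g, ⟨hg.orderIso⟩, ?_, s ξ0, (hs ξ0).1, (hs ξ0).2, hξ0, ⟨ξ0, rfl⟩⟩
  intro ψ hψ x x' hx hx' hlen hxM
  have lift : ∀ x, IncIn (Set.range g) x → ∃ ξs : List _, ξs.map g = x ∧ ξs.length = x.length ∧
      IncIn H (ξs.flatMap s) := by
    intro x hx
    obtain ⟨ξs, rfl⟩ : ∃ ξs : List _, ξs.map g = x := by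
      have : x ∈ Set.range (List.map g) := by
        rw [Set.range_list_map]
        exact hx.2
      exact this
    have hp : ξs.Pairwise (· < ·) := (List.pairwise_map.1 hx.1).imp fun h => hg.lt_iff_lt.1 h
    refine ⟨ξs, rfl, by simp, ?_, ?_⟩
    · rw [List.pairwise_flatMap]
      exact ⟨fun ξ _ => (hs ξ).1.1, hp.imp fun h => hlt _ _ h⟩
    · intro b hb
      obtain ⟨ξ, -, hb⟩ := List.mem_flatMap.1 hb
      exact (hs ξ).1.2 b hb
  obtain ⟨ξs, rfl, h1, h2⟩ := lift x hx
  obtain ⟨ξs', rfl, h1', h2'⟩ := lift x' hx'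
  have hll : ξs.length = ξs'.length := by simpa using hlen
  obtain ⟨ρ, hρ, hρ'⟩ := exists_code_flatMap hφ s n (fun ξ => (hs ξ).2) ξs.length
  have := hH _ (T.comp_mem _ hψ _ hρ) _ _ h2 h2' (by simp [List.length_flatMap, hs, hll])
  simp only [Function.comp_apply, hρ' ξs rfl, hρ' ξs' hll.symm] at this
  exact this hxM

end Indiscernible

/-! ### Indiscernibles from a partition relation -/

theorem exists_pairing {K : Type*} [Infinite K] (z : K) : ∃ P : Pairing K, P.zero = z := by
  have h : Cardinal.mk (K × K) = Cardinal.mk K := by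
    rw [← Cardinal.mul_def]
    exact Cardinal.mul_eq_self (Cardinal.aleph0_le_mk K)
  obtain ⟨e⟩ := Cardinal.eq.1 h
  exact ⟨⟨fun a b => e (a, b), fun k => (e.symm k).1, fun k => (e.symm k).2, z,
    by simp, by simp⟩, rfl⟩

theorem mk_ordBelow (κ : Cardinal.{u}) : Cardinal.mk (OrdBelow κ) = Cardinal.lift.{u + 1} κ := by
  rw [Cardinal.mk_Iio_ordinal, Cardinal.card_ord]

theorem infinite_ordBelow {κ : Cardinal.{u}} (hκ : Cardinal.aleph0 ≤ κ) : Infinite (OrdBelow κ) := by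
  rw [Cardinal.infinite_iff, mk_ordBelow]
  simpa using hκ

/-- A partition relation yields indiscernibles for a countable clone. -/
theorem PartitionArrow.exists_indiscernible {κ μ : Cardinal.{u}} {α : Ordinal.{u}}
    (h : PartitionArrow κ (Ordinal.omega0 * α) μ) (hα : α ≠ 0) (h2 : 2 ≤ μ)
    (T : Clone (OrdBelow κ)) (hT : T.fns.Countable) :
    ∃ H, HasOrderType H (Ordinal.omega0 * α) ∧ Indiscernible T {k | k.1 < μ.ord} H := by
  classical
  obtain ⟨f, hf⟩ := hT.exists_eq_range ⟨_, T.id_mem⟩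
  have h1 : (1 : Ordinal.{u}) < μ.ord := by
    rw [Cardinal.lt_ord]
    simpa using (Cardinal.one_lt_two).trans_le h2
  let zero : OrdBelow μ := ⟨0, zero_lt_one.trans h1⟩
  let one : OrdBelow μ := ⟨1, h1⟩
  have h01 : zero ≠ one := fun h => zero_ne_one (congrArg Subtype.val h)
  -- Even colourings tell whether the value is below `μ`, odd ones record the value. The former
  -- ensure that equal odd colours are not due to the default `zero`.
  let G : ℕ → List (OrdBelow κ) → OrdBelow μ := fun i l =>
    if i % 2 = 0 then if (f (i / 2) (T.code l)).1 < μ.ord then zero else one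
    else if hlt : (f (i / 2) (T.code l)).1 < μ.ord then ⟨_, hlt⟩ else zero
  obtain ⟨A, hA, hG⟩ := h.exists_homogeneous hα G
  refine ⟨A, hA, fun φ hφ l l' hl hl' hlen hM => ?_⟩
  rw [hf] at hφ
  obtain ⟨i, rfl⟩ := hφ
  have hM : (f i (T.code l)).1 < μ.ord := hM
  have e0 := hG (2 * i) l l' hl hl' hlen
  have e1 := hG (2 * i + 1) l l' hl hl' hlen
  have hd : (2 * i + 1) / 2 = i := by omega
  have hM' : (f i (T.code l')).1 < μ.ord := by
    by_contra hcon
    simp [G, hM, hcon, h01] at e0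
  simp only [G, hd, hM, hM', dif_pos] at e1
  have hodd : ¬ (2 * i + 1) % 2 = 0 := by omega
  rw [if_neg hodd, if_neg hodd] at e1
  exact Subtype.ext (congrArg Subtype.val e1).symm

/-! ### The regressive relation at the least cardinal -/

theorem HasOrderType.image {X : Type (u + 1)} [LinearOrder X] {A : Set X} {α : Ordinal.{u}}
    (h : HasOrderType A α) {Y : Type (u + 1)} [Preorder Y] {f : X → Y} (hf : StrictMonoOn f A) :
    HasOrderType (f '' A) α := by
  obtain ⟨e⟩ := h
  exact ⟨e.trans (hf.orderIso f A)⟩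

/-- A colouring of `ν < κ` without homogeneous sets, as a colouring of `κ`. -/
theorem exists_bad_coloring {κ ν μ : Cardinal.{u}} {β : Ordinal.{u}} (hν : ν < κ)
    (h : ¬ PartitionArrow ν β μ) :
    ∃ Q : Finset (OrdBelow κ) → OrdBelow μ, ∀ X : Set (OrdBelow κ), (∀ x ∈ X, x.1 < ν.ord) →
      HasOrderType X β → ¬ Homogeneous Q X := by
  classical
  unfold PartitionArrow at h
  push Not at h
  obtain ⟨F, hF⟩ := h
  let i : OrdBelow ν → OrdBelow κ := fun x => ⟨x.1, x.2.trans (Cardinal.ord_lt_ord.2 hν)⟩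
  have hi : StrictMono i := fun _ _ h => h
  refine ⟨fun W => F (W.preimage i hi.injective.injOn), fun X hX hβ hQ => hF (i ⁻¹' X) ?_ ?_⟩
  · have himg : i '' (i ⁻¹' X) = X :=
      Set.image_preimage_eq_of_subset fun x hx => ⟨⟨x.1, hX x hx⟩, rfl⟩
    obtain ⟨e⟩ := hβ
    exact ⟨e.trans ((OrderIso.setCongr _ _ himg).symm.trans
      ((hi.strictMonoOn _).orderIso i (i ⁻¹' X)).symm)⟩
  · intro w₁ w₂ h₁ h₂ hc
    have := hQ (w₁.image i) (w₂.image i) 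
      (by rw [Finset.coe_image]; exact Set.image_subset_iff.2 h₁)
      (by rw [Finset.coe_image]; exact Set.image_subset_iff.2 h₂)
      (by rw [Finset.card_image_of_injective _ hi.injective,
        Finset.card_image_of_injective _ hi.injective, hc])
    have hpre : ∀ w : Finset (OrdBelow ν), (w.image i).preimage i hi.injective.injOn = w := by
      intro w
      ext x
      simp [hi.injective.eq_iff]
    simpa only [hpre] using this

/-- Functions of the clone that decrease are constant on indiscernibles with the least possible
first element. -/
theorem Indiscernible.const_of_regressive {K : Type (u + 1)} [LinearOrder K] [WellFoundedLT K]
    {T : Clone K} {M H : Set K} {α : Ordinal.{u}} (hH : Indiscernible T M H) (hM : T.zero ∈ M)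
    (hα : α ≠ 0) (hT : HasOrderType H (Ordinal.omega0 * α)) {m : K} (hm : m ∈ H)
    (hmin : ∀ X, HasOrderType X (Ordinal.omega0 * α) → Indiscernible T M X → ∀ x ∈ X, m ≤ x)
    {φ : K → K} (hφ : φ ∈ T.fns) {n : ℕ} (hn : n ≠ 0)
    (hreg : ∀ l, IncIn H l → l.length = n → ∀ a ∈ l, φ (T.code l) < a) :
    ∀ l l', IncIn H (l ++ l') → l.length = n → l'.length = n → φ (T.code l) = φ (T.code l') := by
  rcases hH.const_or_increasing hM hα hT hφ n with h | h
  · exact h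
  -- If `φ` increased, the images of blocks would form a competing indiscernible set, whose element
  -- coming from the block of `m` is below `m`.
  · obtain ⟨X, hX, hX', l, hl, hln, hml, hφX⟩ :=
      hH.exists_image hT hφ hn h hm (hmin H hT hH)
    exact absurd (hmin X hX hX' _ hφX) (hreg l hl hln m hml).not_ge

open Classical in
/-- The least cardinal with a given partition relation has the relation for regressive functions
and clubs. -/
theorem PartitionArrow.regressiveArrow {κ μ : Cardinal.{u}} {α : Ordinal.{u}}
    (hκ : Cardinal.aleph0 ≤ κ) (h2 : 2 ≤ μ) (hμκ : μ ≤ κ) (hα : α ≠ 0)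
    (h : PartitionArrow κ (Ordinal.omega0 * α) μ)
    (hleast : ∀ ν < κ, ¬ PartitionArrow ν (Ordinal.omega0 * α) μ) :
    RegressiveArrow κ (Ordinal.omega0 * α) := by
  intro F hF C hC
  have hinf := infinite_ordBelow hκ
  have hpos : (0 : Ordinal.{u}) < κ.ord := by
    rw [Cardinal.lt_ord]
    simpa using Cardinal.aleph0_pos.trans_le hκ
  let bot : OrdBelow κ := ⟨0, hpos⟩
  have hbot : ∀ k : OrdBelow κ, bot ≤ k := fun k => Subtype.mk_le_mk.2 (zero_le)
  have hbot' : ∀ k : OrdBelow κ, k ≠ bot → bot < k := fun k hk => lt_of_le_of_ne (hbot k) hk.symm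
  obtain ⟨P, hP⟩ := exists_pairing bot
  let C' : Set (OrdBelow κ) := {x | x ∈ C ∧ x ≠ bot}
  -- `c k` is the last element of `C'` up to `k`, or `bot` if there is none, and `g k` is the first
  -- element of `C'` from `k` on. Removing `bot` from the club makes `c` regressive at every nonzero
  -- point outside `C'`.
  have hc : ∀ k : OrdBelow κ, ∃ y, (∀ x ∈ C', x ≤ k → x ≤ y) ∧
      (y ∈ C' ∧ y ≤ k ∨ y = bot) := by
    intro k
    by_cases hk : ∃ x ∈ C', x ≤ k
    · obtain ⟨x, hx, hxk⟩ := hk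
      let U := {u : OrdBelow κ | ∀ x ∈ C', x ≤ k → x ≤ u}
      have hU : U.Nonempty := ⟨k, fun x _ h => h⟩
      let y := wellFounded_lt.min U hU
      have hy : y ∈ U := wellFounded_lt.min_mem U hU
      have hyl : ∀ u ∈ U, y ≤ u := fun u hu => not_lt.1 (wellFounded_lt.not_lt_min U hu)
      refine ⟨y, hy, Or.inl ⟨⟨?_, ?_⟩, hyl k fun x _ h => h⟩⟩
      · refine hC.isLUB_mem (t := {x | x ∈ C' ∧ x ≤ k}) (fun x hx => hx.1.1) ⟨x, hx, hxk⟩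
          ⟨fun x hx => hy x hx.1 hx.2, fun u hu => hyl u fun x hx hxk => hu ⟨hx, hxk⟩⟩
      · exact ((hbot' x hx.2).trans_le (hy x hx hxk)).ne'
    · exact ⟨bot, fun x hx hxk => (hk ⟨x, hx, hxk⟩).elim, Or.inr rfl⟩
  choose c hc1 hc2 using hc
  have hg : ∀ k : OrdBelow κ, ∃ y, y ∈ C' ∧ k ≤ y ∧ ∀ x ∈ C', k ≤ x → y ≤ x := by
    intro k
    have hU : {x | x ∈ C' ∧ k ≤ x}.Nonempty := by
      obtain ⟨x0, hx0⟩ := exists_ne bot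
      obtain ⟨x, hx, hle⟩ := hC.isCofinal (max k x0)
      exact ⟨x, ⟨hx, ((hbot' x0 hx0).trans_le ((le_max_right _ _).trans hle)).ne'⟩,
        (le_max_left _ _).trans hle⟩
    exact ⟨_, (wellFounded_lt.min_mem _ hU).1, (wellFounded_lt.min_mem _ hU).2, fun x hx hkx =>
      not_lt.1 (wellFounded_lt.not_lt_min {x | x ∈ C' ∧ k ≤ x} ⟨hx, hkx⟩)⟩
  choose g hg1 hg2 hg3 using hg
  -- `p γ` injects `γ` into its cardinality, and `Q γ` is a colouring that witnesses the failure of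
  -- the partition relation at that smaller cardinal.
  have hp : ∀ γ : OrdBelow κ, ∃ p : OrdBelow κ → OrdBelow κ,
      Set.InjOn p (Set.Iio γ) ∧ ∀ h < γ, (p h).1 < γ.1.card.ord := by
    intro γ
    have : Cardinal.mk (Set.Iio γ.1) = Cardinal.mk (Set.Iio γ.1.card.ord) := by
      simp [Cardinal.mk_Iio_ordinal]
    obtain ⟨e⟩ := Cardinal.eq.1 this
    have hlt : γ.1.card.ord < κ.ord := (Cardinal.ord_card_le _).trans_lt γ.2
    refine ⟨fun h => if hh : h.1 < γ.1 then ⟨(e ⟨h.1, hh⟩).1, (e ⟨h.1, hh⟩).2.trans hlt⟩ else h,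
      ?_, ?_⟩
    · intro x hx y hy hxy
      have hx' : x.1 < γ.1 := hx
      have hy' : y.1 < γ.1 := hy
      simp only [hx', hy', dif_pos] at hxy
      have := e.injective (Subtype.ext (Subtype.mk.inj hxy))
      exact Subtype.ext (Subtype.mk.inj this)
    · intro x hx
      have hx' : x.1 < γ.1 := hx
      simp only [hx', dif_pos]
      exact (e ⟨x.1, hx'⟩).2
  choose p hp1 hp2 using hp
  have hQ : ∀ γ : OrdBelow κ, ∃ Q : Finset (OrdBelow κ) → OrdBelow μ, ∀ X : Set (OrdBelow κ),
      (∀ x ∈ X, x.1 < γ.1.card.ord) → HasOrderType X (Ordinal.omega0 * α) → ¬ Homogeneous Q X :=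
    fun γ => exists_bad_coloring (Cardinal.lt_ord.1 γ.2) (hleast _ (Cardinal.lt_ord.1 γ.2))
  choose Q hQ using hQ
  let ι : OrdBelow μ → OrdBelow κ := fun x => ⟨x.1, x.2.trans_le (Cardinal.ord_le_ord.2 hμκ)⟩
  let π : OrdBelow κ → OrdBelow κ := fun k => p (g k) k
  let chi : OrdBelow κ → OrdBelow κ := fun k => if k ∈ C' then P.zero else (exists_ne P.zero).choose
  let Fn : ℕ → OrdBelow κ → OrdBelow κ := fun n k => F (P.decode n k).toFinset
  -- The relevant `γ` is read off from the first entry of the list, so countably many functions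
  -- cover the colourings `Q γ` for all `γ`.
  let d : ℕ → OrdBelow κ → OrdBelow κ := fun n k =>
    ι (Q (g (P.nth 0 k)) ((P.decode n k).map π).toFinset)
  let base : Set (OrdBelow κ → OrdBelow κ) := {c, g, π, chi} ∪ (Set.range Fn ∪ Set.range d)
  let T := P.genClone base
  have hbase : base ⊆ T.fns := P.base_subset_genClone base
  have hcT : c ∈ T.fns := hbase (Or.inl (by simp))
  have hgT : g ∈ T.fns := hbase (Or.inl (by simp))
  have hπT : π ∈ T.fns := hbase (Or.inl (by simp))
  have hchiT : chi ∈ T.fns := hbase (Or.inl (by simp))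
  have hFT : ∀ n, Fn n ∈ T.fns := fun n => hbase (Or.inr (Or.inl ⟨n, rfl⟩))
  have hdT : ∀ n, d n ∈ T.fns := fun n => hbase (Or.inr (Or.inr ⟨n, rfl⟩))
  have hcount : T.fns.Countable := by
    have hb : base.Countable :=
      (Set.toFinite _).countable.union ((Set.countable_range _).union (Set.countable_range _))
    have := P.card_genClone_le base
    rw [max_eq_left (Cardinal.le_aleph0_iff_set_countable.2 hb)] at this
    exact Cardinal.le_aleph0_iff_set_countable.1 this
  let M : Set (OrdBelow κ) := {k | k.1 < μ.ord}
  have hM : T.zero ∈ M := by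
    change P.zero.1 < μ.ord
    rw [hP]
    exact Cardinal.lt_ord.2 (by simpa [bot] using zero_lt_two.trans_le h2)
  have hT0 : T.zero = bot := hP
  obtain ⟨m, H, hT, hH, hm, hmin⟩ : ∃ m H, HasOrderType H (Ordinal.omega0 * α) ∧
      Indiscernible T M H ∧ m ∈ H ∧ ∀ X, HasOrderType X (Ordinal.omega0 * α) →
        Indiscernible T M X → ∀ x ∈ X, m ≤ x := by
    let S := {x | ∃ H, HasOrderType H (Ordinal.omega0 * α) ∧ Indiscernible T M H ∧ x ∈ H}
    have hS : S.Nonempty := by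
      obtain ⟨H, h1, h2⟩ := h.exists_indiscernible hα h2 T hcount
      exact ⟨_, H, h1, h2, (h1.endless hα).1.some_mem⟩
    obtain ⟨H, h1, h2, h3⟩ := wellFounded_lt.min_mem S hS
    exact ⟨_, H, h1, h2, h3, fun X hX hX' x hx =>
      not_lt.1 (wellFounded_lt.not_lt_min S ⟨X, hX, hX', hx⟩)⟩
  have hend := hT.endless hα
  have single : ∀ {a b}, a ∈ H → b ∈ H → a < b → IncIn H ([a] ++ [b]) := fun ha hb hab =>
    (IncIn.singleton ha).append (IncIn.singleton hb) (by simpa using hab)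
  have hne : ∀ a ∈ H, a ≠ bot := by
    intro a ha hab
    obtain ⟨t, ht, ht'⟩ := T.eq_test_mem T.fst_mem T.zero_mem
    obtain ⟨b, hb, hlt⟩ := hend.2 a ha
    have := (hH.test hM ht (IncIn.singleton ha) (IncIn.singleton hb) rfl).1
      ((ht' _).2 (by simpa [T.fst_pair] using hab.trans hT0.symm))
    have hb0 : b = T.zero := by simpa [ht', T.fst_pair] using this
    rw [hb0, hT0] at hlt
    exact (hbot a).not_gt hlt
  have hchi : ∀ k, chi k = T.zero ↔ k ∈ C' := by
    intro k
    change chi k = P.zero ↔ k ∈ C'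
    have := (exists_ne P.zero).choose_spec
    by_cases hk : k ∈ C' <;> simp [chi, hk, this]
  have hall : ∀ a ∈ H, ∀ b ∈ H, a ∈ C' → b ∈ C' := by
    intro a ha b hb haC
    have := (hH.test hM (T.comp_mem _ hchiT _ T.fst_mem) (IncIn.singleton ha)
      (IncIn.singleton hb) rfl).1 (by simpa [T.fst_pair] using (hchi a).2 haC)
    exact (hchi b).1 (by simpa [T.fst_pair] using this)
  -- Otherwise `H` misses `C'` altogether. Then `c` is regressive, hence constant, on `H`, so `H`
  -- lies in a single gap of the club, below `γ = g m`. There `π` is `p γ`, which maps `H`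
  -- increasingly into `|γ|`, onto a homogeneous set for `Q γ`.
  have hHC : H ⊆ C' := by
    by_contra hcon
    have hnot : ∀ a ∈ H, a ∉ C' := fun a ha haC => hcon fun b hb => hall a ha b hb haC
    have hclt : ∀ a ∈ H, c a < a := by
      intro a ha
      rcases hc2 a with ⟨h1, h2⟩ | h1
      · exact lt_of_le_of_ne h2 fun h => hnot a ha (h ▸ h1)
      · rw [h1]
        exact hbot' a (hne a ha)
    have hcc : ∀ a ∈ H, ∀ b ∈ H, a < b → c a = c b := by
      intro a ha b hb hab
      have := hH.const_of_regressive hM hα hT hm hmin (T.comp_mem _ hcT _ T.fst_mem) one_ne_zero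
        (fun l hl hln x hx => by
          obtain ⟨y, rfl⟩ := List.length_eq_one_iff.1 hln
          rw [List.mem_singleton.1 hx]
          simpa [T.fst_pair] using hclt y (hl.2 y (by simp))) [a] [b] (single ha hb hab) rfl rfl
      simpa [T.fst_pair] using this
    have hgb : ∀ a ∈ H, ∀ b ∈ H, a < b → b ≤ g a := by
      intro a ha b hb hab
      by_contra hlt
      have := hc1 b (g a) (hg1 a) (not_le.1 hlt).le
      rw [← hcc a ha b hb hab] at this
      exact absurd ((hg2 a).trans this) (hclt a ha).not_ge
    have hgg : ∀ a ∈ H, ∀ b ∈ H, a < b → g a = g b := fun a ha b hb hab =>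
      le_antisymm (hg3 a _ (hg1 b) (hab.le.trans (hg2 b))) (hg3 b _ (hg1 a) (hgb a ha b hb hab))
    have hgc : ∀ a ∈ H, g a = g m := by
      intro a ha
      rcases (hmin H hT hH a ha).eq_or_lt with rfl | h
      · rfl
      · exact (hgg m hm a ha h).symm
    have hlt : ∀ a ∈ H, a < g m := by
      intro a ha
      rw [← hgc a ha]
      exact lt_of_le_of_ne (hg2 a) fun h => hnot a ha (h ▸ hg1 a)
    have hπ : StrictMonoOn π H := by
      intro a ha b hb hab
      rcases hH.const_or_increasing hM hα hT (T.comp_mem _ hπT _ T.fst_mem) 1 with h | h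
      · exfalso
        have := h [a] [b] (single ha hb hab) rfl rfl
        have hpe : p (g m) a = p (g m) b := by
          simpa [T.fst_pair, π, hgc a ha, hgc b hb] using this
        exact hab.ne (hp1 _ (hlt a ha) (hlt b hb) hpe)
      · simpa [T.fst_pair] using h [a] [b] (single ha hb hab) rfl rfl
    refine hQ (g m) (π '' H) ?_ (hT.image hπ) ?_
    · rintro _ ⟨a, ha, rfl⟩
      have := hp2 (g m) a (hlt a ha)
      simpa [π, hgc a ha] using this
    · intro w₁ w₂ h₁ h₂ hcard
      have key : ∀ w : Finset (OrdBelow κ), (w : Set (OrdBelow κ)) ⊆ π '' H →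
          ∃ l, IncIn H l ∧ l.length = w.card ∧ (l ≠ [] → d l.length (T.code l) = ι (Q (g m) w)) := by
        intro w hw
        obtain ⟨u, hu, rfl⟩ := Finset.subset_set_image_iff.1 hw
        have hcu : (u.image π).card = u.card :=
          Finset.card_image_of_injOn (hπ.injOn.mono hu)
        refine ⟨u.sort, IncIn.sort hu, by simp [hcu], fun hne => ?_⟩
        have hpos : 0 < u.sort.length := List.length_pos_iff.2 hne
        have h1 : P.nth 0 (P.code u.sort) = u.sort[0] := P.nth_code 0 _ hpos
        have h2 : g u.sort[0] = g m := hgc _ (hu ((Finset.mem_sort _).1 (List.getElem_mem hpos)))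
        change ι (Q (g (P.nth 0 (P.code u.sort)))
          ((P.decode u.sort.length (P.code u.sort)).map π).toFinset) = _
        rw [h1, h2, P.decode_code]
        congr 2
        ext x
        simp
      obtain ⟨l₁, hl₁, hn₁, hd₁⟩ := key w₁ h₁
      obtain ⟨l₂, hl₂, hn₂, hd₂⟩ := key w₂ h₂
      rcases eq_or_ne l₁ [] with rfl | hne₁
      · have e1 : w₁ = ∅ := Finset.card_eq_zero.1 (by simpa using hn₁.symm)
        have e2 : w₂ = ∅ := Finset.card_eq_zero.1 (by rw [← hcard, e1]; rfl)
        rw [e1, e2]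
      · have hlen : l₁.length = l₂.length := by omega
        have hne₂ : l₂ ≠ [] := by
          rw [← List.length_pos_iff] at hne₁ ⊢
          omega
        have hval := hd₁ hne₁
        -- Colours are below `μ`, that is in `M`, so indiscernibility gives equality of the values.
        have := hH _ (hdT l₁.length) l₁ l₂ hl₁ hl₂ hlen (by rw [hval]; exact (Q (g m) w₁).2)
        rw [hval, hlen, hd₂ hne₂] at this
        exact Subtype.ext (congrArg Subtype.val this).symm
  refine ⟨H, fun a ha => (hHC ha).1, hT, ?_⟩
  have hFl : ∀ l, IncIn H l → Fn l.length (T.code l) = F l.toFinset := by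
    intro l hl
    change F (P.decode l.length (P.code l)).toFinset = _
    rw [P.decode_code]
  have hconst : ∀ l l', IncIn H (l ++ l') → l.length = l'.length → l ≠ [] →
      F l.toFinset = F l'.toFinset := by
    intro l l' hl hlen hne'
    have := hH.const_of_regressive hM hα hT hm hmin (hFT l.length)
      (by simpa using hne') (fun l₁ hl₁ hn₁ a ha => by
        rw [← hn₁, hFl l₁ hl₁]
        have hw : l₁.toFinset.Nonempty := ⟨a, by simpa using ha⟩
        have hmem : l₁.toFinset.min' hw ∈ H :=
          hl₁.2 _ (by simpa using l₁.toFinset.min'_mem hw)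
        refine (hF l₁.toFinset hw fun h0 => hne _ hmem (Subtype.ext h0)).trans_le ?_
        exact Finset.min'_le _ _ (by simpa using ha)) l l' hl rfl hlen.symm
    rwa [hFl l hl.left, hlen, hFl l' hl.right] at this
  intro w₁ w₂ h₁ h₂ hcard
  rcases w₁.eq_empty_or_nonempty with rfl | hw
  · rw [Finset.card_empty] at hcard
    rw [Finset.card_eq_zero.1 hcard.symm]
  have hL : ∀ a ∈ w₁.sort ++ w₂.sort, a ∈ H := fun a ha =>
    (List.mem_append.1 ha).elim (fun h => h₁ (by simpa using h)) fun h => h₂ (by simpa using h)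
  -- The two sets may interleave, so each is compared with a common list beyond both.
  obtain ⟨l, hl, hn, hlt⟩ := hend.exists_incIn _ hL w₁.card
  have e1 := hconst w₁.sort l ((IncIn.sort h₁).append hl fun a ha => hlt a (by simp at ha; simp [ha]))
    (by simp [hn]) (by
      intro h
      have := congrArg List.length h
      simp at this
      exact hw.ne_empty this)
  have e2 := hconst w₂.sort l ((IncIn.sort h₂).append hl fun a ha => hlt a (by simp at ha; simp [ha]))
    (by simp [hn, hcard]) (by
      intro h
      have := congrArg List.length h
      simp at this
      rw [this] at hcard
      exact hw.ne_empty (Finset.card_eq_zero.1 (by simpa using hcard)))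
  rw [Finset.sort_toFinset] at e1 e2
  rw [e1, e2]

/-! ### Ramsey cardinals and least cardinals -/

theorem RegressiveArrow.mono {κ : Cardinal.{u}} {β γ : Ordinal.{u}} (h : RegressiveArrow κ β)
    (hγ : γ ≤ β) : RegressiveArrow κ γ := by
  intro F hF C hC
  obtain ⟨A, hAC, ⟨e⟩, hA⟩ := h F hF C hC
  let f : Set.Iio γ → OrdBelow κ := fun x => e ⟨x.1, x.2.trans_le hγ⟩
  have hf : StrictMono f := fun x y hxy => e.lt_iff_lt.2 hxy
  have hr : Set.range f ⊆ A := by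
    rintro _ ⟨x, rfl⟩
    exact (e _).2
  exact ⟨Set.range f, hr.trans hAC, ⟨hf.orderIso⟩,
    fun w₁ w₂ h₁ h₂ hc => hA w₁ w₂ (h₁.trans hr) (h₂.trans hr) hc⟩

theorem RegressiveArrow.zero (κ : Cardinal.{u}) : RegressiveArrow κ 0 := by
  intro F _ C _
  have : IsEmpty (Set.Iio (0 : Ordinal.{u})) := ⟨fun x => not_lt_zero (Set.mem_Iio.1 x.2)⟩
  refine ⟨∅, Set.empty_subset _, ⟨OrderIso.ofIsEmpty _ _⟩, ?_⟩
  intro w₁ w₂ h₁ h₂ _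
  rw [Finset.coe_eq_empty.1 (Set.subset_empty_iff.1 h₁),
    Finset.coe_eq_empty.1 (Set.subset_empty_iff.1 h₂)]

/-- A set of type `κ.ord` has too many elements to fit into `ν`. The exception is genuine: with no
colours there are no colourings, and the relation holds vacuously. -/
theorem not_partitionArrow_of_lt {κ ν μ : Cardinal.{u}} (hν : ν < κ) :
    ¬ PartitionArrow ν κ.ord μ ∨ μ = 0 := by
  rcases eq_or_ne μ 0 with h | h
  · exact Or.inr h
  · refine Or.inl fun hp => ?_
    have hpos : (0 : Ordinal.{u}) < μ.ord := Cardinal.lt_ord.2 (by simpa [pos_iff_ne_zero] using h)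
    obtain ⟨A, ⟨e⟩, -⟩ := hp fun _ => ⟨0, hpos⟩
    have h1 : Cardinal.mk (OrdBelow κ) ≤ Cardinal.mk (OrdBelow ν) :=
      (Cardinal.mk_congr e.toEquiv).le.trans (Cardinal.mk_set_le A)
    rw [mk_ordBelow, mk_ordBelow, Cardinal.lift_le] at h1
    exact h1.not_gt hν

/-- An uncountable initial ordinal is closed under multiplication, so `ω * b` stays below it for all
smaller `b`; the limit gives the equality. -/
theorem omega0_mul_ord {κ : Cardinal.{u}} (hκ : Cardinal.aleph0 < κ) :
    Ordinal.omega0 * κ.ord = κ.ord := by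
  have hlim : Order.IsSuccLimit κ.ord := Cardinal.isSuccLimit_ord hκ.le
  refine le_antisymm ?_ (Ordinal.le_mul_right _ Ordinal.omega0_pos)
  rw [Ordinal.mul_le_iff_of_isSuccLimit hlim]
  intro b hb
  refine (Ordinal.isPrincipal_mul_ord hκ.le ?_ hb).le
  rwa [← Cardinal.ord_aleph0, Cardinal.ord_lt_ord]

/-- Ramsey cardinals, and the least cardinals with a partition relation, have the relation for
regressive functions and clubs. -/
theorem regressiveArrow_of_isRamsey_or_isLeast {κ μ : Cardinal.{u}} {α : Ordinal.{u}}
    (hμ : Cardinal.aleph0 ≤ μ) (hμκ : μ < κ)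
    (h : (IsRamsey κ ∧ α ≤ κ.ord) ∨
      IsLeast {ν : Cardinal.{u} | PartitionArrow ν (Ordinal.omega0 * α) μ} κ) :
    RegressiveArrow κ (Ordinal.omega0 * α) := by
  rcases eq_or_ne α 0 with rfl | hα
  · rw [mul_zero]
    exact RegressiveArrow.zero κ
  have h2 : (2 : Cardinal.{u}) ≤ μ := (Cardinal.natCast_lt_aleph0 (n := 2)).le.trans hμ
  rcases h with ⟨⟨hκ, hr⟩, hακ⟩ | ⟨hp, hl⟩
  · have h0 : κ.ord ≠ 0 := by simpa using (Cardinal.aleph0_pos.trans hκ).ne'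
    have hω := omega0_mul_ord hκ
    have : RegressiveArrow κ (Ordinal.omega0 * κ.ord) := by
      -- With two colours and type `κ.ord` the leastness of `κ` is automatic, since smaller
      -- cardinals have no subsets of that type.
      refine PartitionArrow.regressiveArrow hκ.le le_rfl (h2.trans hμκ.le) h0 (by rwa [hω]) ?_
      intro ν hν
      rw [hω]
      exact (not_partitionArrow_of_lt hν).resolve_right two_ne_zero
    exact this.mono (mul_le_mul_right hακ _)
  · exact PartitionArrow.regressiveArrow (hμ.trans hμκ.le) h2 hμκ.le hα hp
      fun ν hν hν' => (hl hν').not_gt hν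

/-! ### Regularity, closure points and indiscernibility with parameters -/

theorem noMaxOrder_ordBelow {κ : Cardinal.{u}} (hκ : Cardinal.aleph0 ≤ κ) :
    NoMaxOrder (OrdBelow κ) :=
  ⟨fun a => ⟨⟨Order.succ a.1, (Cardinal.isSuccLimit_ord hκ).succ_lt a.2⟩,
    Subtype.mk_lt_mk.2 (Order.lt_succ a.1)⟩⟩

open Classical in
/-- The partition relation for regressive functions and clubs implies regularity. -/
theorem RegressiveArrow.mk_le_cof {κ : Cardinal.{u}} {α : Ordinal.{u}} (hα : α ≠ 0)
    (hκ : Cardinal.aleph0 ≤ κ) (h : RegressiveArrow κ (Ordinal.omega0 * α)) :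
    Cardinal.mk (OrdBelow κ) ≤ Order.cof (OrdBelow κ) := by
  by_contra hcon
  have hnm := noMaxOrder_ordBelow hκ
  have hinf := infinite_ordBelow hκ
  obtain ⟨S, hS, hcard⟩ := Order.exists_cof_eq (OrdBelow κ)
  rw [not_le, ← hcard, mk_ordBelow, Cardinal.lt_lift_iff] at hcon
  obtain ⟨c, hcκ, hc⟩ := hcon
  have hSc : Cardinal.mk S = Cardinal.mk (OrdBelow c) := by rw [mk_ordBelow, hc]
  obtain ⟨e⟩ := Cardinal.eq.1 hSc
  have hcκ' : c.ord < κ.ord := Cardinal.ord_lt_ord.2 hcκ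
  let ρ : OrdBelow κ := ⟨c.ord, hcκ'⟩
  have hn : ∀ γ : OrdBelow κ, ∃ s : S, γ < s ∧ ∀ s' ∈ S, γ < s' → s ≤ s' := by
    intro γ
    obtain ⟨δ, hδ⟩ := exists_gt γ
    obtain ⟨s, hs, hle⟩ := hS δ
    have hU : {s | s ∈ S ∧ γ < s}.Nonempty := ⟨s, hs, hδ.trans_le hle⟩
    exact ⟨⟨_, (wellFounded_lt.min_mem _ hU).1⟩, (wellFounded_lt.min_mem _ hU).2,
      fun s' h1 h2 => not_lt.1 (wellFounded_lt.not_lt_min {s | s ∈ S ∧ γ < s} ⟨h1, h2⟩)⟩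
  choose nx hnx1 hnx2 using hn
  -- From `ρ = c.ord` on, `γ` goes to the index below `c` of the next element of the short cofinal
  -- set `S`, so `val` is regressive. Any two points of the club `C` below are separated by an
  -- element of `S`, hence have different values.
  let val : OrdBelow κ → OrdBelow κ := fun γ =>
    if ρ ≤ γ then ⟨(e (nx γ)).1, (e (nx γ)).2.trans hcκ'⟩ else ⟨0, (zero_le).trans_lt hcκ'⟩
  let F : Finset (OrdBelow κ) → OrdBelow κ := fun w =>
    if hw : w.Nonempty then val (w.min' hw) else ρ
  have hF : Regressive F := by
    intro w hw h0
    simp only [F, hw, dif_pos, val]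
    split_ifs with hρ
    · refine lt_of_lt_of_le ?_ hρ
      exact (e (nx (w.min' hw))).2
    · exact Subtype.mk_lt_mk.2 (pos_iff_ne_zero.2 h0)
  let C : Set (OrdBelow κ) := {γ | ρ ≤ γ ∧ ∀ x < γ, ∃ s ∈ S, x < s ∧ s ≤ γ}
  have hC : IsClub C := by
    refine ⟨?_, fun x => ?_⟩
    · intro t ht ⟨t₀, ht₀⟩ _ a ha
      refine ⟨(ht ht₀).1.trans (ha.1 ht₀), fun x hx => ?_⟩
      obtain ⟨y, hy, hxy⟩ := (lt_isLUB_iff ha).1 hx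
      obtain ⟨s, hs, h1, h2⟩ := (ht hy).2 x hxy
      exact ⟨s, hs, h1, h2.trans (ha.1 hy)⟩
    · obtain ⟨s, hs, hle⟩ := hS (max x ρ)
      exact ⟨s, ⟨(le_max_right _ _).trans hle, fun y hy => ⟨s, hs, hy, le_rfl⟩⟩,
        (le_max_left _ _).trans hle⟩
  obtain ⟨A, hAC, hA, hom⟩ := h F hF C hC
  obtain ⟨⟨a, ha⟩, hA⟩ := hA.endless hα
  obtain ⟨b, hb, hab⟩ := hA a ha
  have := hom {a} {b} (by simpa using ha) (by simpa using hb) (by simp)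
  have hval : val a = val b := by simpa [F] using this
  simp only [val, (hAC ha).1, (hAC hb).1, if_true] at hval
  have hnn : nx a = nx b := e.injective (Subtype.ext (Subtype.mk.inj hval))
  obtain ⟨s, hs, h1, h2⟩ := (hAC hb).2 a hab
  have h3 := (hnx2 a s hs h1).trans h2
  rw [hnn] at h3
  exact h3.not_gt (hnx1 b)

/-- In a regular uncountable order the points closed under a binary function form a club. -/
theorem isClub_closed {K : Type*} [LinearOrder K] [WellFoundedLT K] [NoMaxOrder K]
    (hreg : Cardinal.mk K ≤ Order.cof K) (hunc : Cardinal.aleph0 < Cardinal.mk K)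
    (hK : ∀ a : K, Cardinal.mk (Set.Iic a) < Cardinal.mk K) (f : K → K → K) :
    IsClub {γ | ∀ x < γ, ∀ y < γ, f x y < γ} := by
  have bdd : ∀ s : Set K, Cardinal.mk s < Cardinal.mk K → ∃ b, ∀ x ∈ s, x < b := by
    intro s hs
    by_contra hcon
    push Not at hcon
    exact (hreg.trans (Order.cof_le fun x => hcon x)).not_gt hs
  have hnext : ∀ a, ∃ b, a < b ∧ ∀ x ≤ a, ∀ y ≤ a, f x y < b := by
    intro a
    obtain ⟨b, hb⟩ := bdd (Set.range fun p : Set.Iic a × Set.Iic a => f p.1 p.2) (by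
      refine Cardinal.mk_range_le.trans_lt ?_
      rw [← Cardinal.mul_def]
      exact Cardinal.mul_lt_of_lt hunc.le (hK a) (hK a))
    obtain ⟨c, hc⟩ := exists_gt (max a b)
    exact ⟨c, (le_max_left _ _).trans_lt hc, fun x hx y hy =>
      (hb _ ⟨(⟨x, hx⟩, ⟨y, hy⟩), rfl⟩).trans ((le_max_right _ _).trans_lt hc)⟩
  choose next h1 h2 using hnext
  refine ⟨?_, fun a => ?_⟩
  · intro t ht _ _ a ha x hx y hy
    obtain ⟨z, hz, hlt⟩ := (lt_isLUB_iff ha).1 (max_lt hx hy)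
    exact (ht hz x ((le_max_left _ _).trans_lt hlt) y ((le_max_right _ _).trans_lt hlt)).trans_le
      (ha.1 hz)
  -- The closure point is the least strict bound of the iterates of `next`, which exists because
  -- countable sets are bounded.
  · have hU : {u | ∀ n, next^[n] a < u}.Nonempty := by
      obtain ⟨b, hb⟩ := bdd (Set.range fun n : ℕ => next^[n] a)
        ((Cardinal.le_aleph0_iff_set_countable.2 (Set.countable_range _)).trans_lt hunc)
      exact ⟨b, fun n => hb _ ⟨n, rfl⟩⟩
    have hlt : ∀ x < wellFounded_lt.min _ hU, ∃ n, x ≤ next^[n] a := by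
      intro x hx
      by_contra hcon
      push Not at hcon
      exact wellFounded_lt.not_lt_min {u | ∀ n, next^[n] a < u} hcon hx
    refine ⟨wellFounded_lt.min _ hU, fun x hx y hy => ?_, (wellFounded_lt.min_mem _ hU 0).le⟩
    obtain ⟨n, hn⟩ := hlt _ (max_lt hx hy)
    refine (h2 (next^[n] a) x ((le_max_left _ _).trans hn) y ((le_max_right _ _).trans hn)).trans ?_
    rw [← Function.iterate_succ_apply' next]
    exact wellFounded_lt.min_mem _ hU (n + 1)

/-- The elements of `A` are closed under the functions of the clone, which cannot distinguish
consecutive lists of elements of `A` even with a parameter below these lists. -/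
structure EndIndiscernible {K : Type*} [LinearOrder K] (T : Clone K) (A : Set K) : Prop where
  zero_lt : ∀ a ∈ A, T.zero < a
  fn_lt : ∀ a ∈ A, ∀ f ∈ T.fns, ∀ x < a, f x < a
  pair_lt : ∀ a ∈ A, ∀ x < a, ∀ y < a, T.pair x y < a
  shift : ∀ f ∈ T.fns, ∀ l l', IncIn A (l ++ l') → l.length = l'.length →
    ∀ p, l ≠ [] → (∀ a ∈ l, p < a) →
      (f (T.pair p (T.code l)) = T.zero ↔ f (T.pair p (T.code l')) = T.zero)

-- Consider the function that sends `w` of even size to the least code, below `min w`, of a pair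
-- (function, parameter) distinguishing the two halves of `w`. It is regressive. On a homogeneous
-- set of closure points, a failure of `shift` at one pair of lists would make one and the same pair
-- (function, parameter) distinguish any two of three consecutive lists, whereas a test has only two
-- outcomes.
open Classical in
theorem RegressiveArrow.exists_endIndiscernible {κ μ : Cardinal.{u}} {α : Ordinal.{u}}
    (hα : α ≠ 0) (hμ : Cardinal.aleph0 ≤ μ) (hμκ : μ < κ)
    (h : RegressiveArrow κ (Ordinal.omega0 * α)) (T : Clone (OrdBelow κ))
    (hT : Cardinal.mk T.fns ≤ Cardinal.lift.{u + 1} μ) :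
    ∃ A, HasOrderType A (Ordinal.omega0 * α) ∧ EndIndiscernible T A := by
  have hκ : Cardinal.aleph0 < κ := hμ.trans_lt hμκ
  have hnm := noMaxOrder_ordBelow hκ.le
  have hinf := infinite_ordBelow hκ.le
  have hreg := h.mk_le_cof hα hκ.le
  have hunc : Cardinal.aleph0 < Cardinal.mk (OrdBelow κ) := by
    rw [mk_ordBelow]
    simpa using hκ
  have hIic : ∀ a : OrdBelow κ, Cardinal.mk (Set.Iic a) < Cardinal.mk (OrdBelow κ) := by
    intro a
    obtain ⟨b, hb⟩ := exists_gt a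
    let i : Set.Iic a → Set.Iio b.1 := fun x => ⟨x.1.1, Subtype.coe_lt_coe.2 ((Set.mem_Iic.1 x.2).trans_lt hb)⟩
    have hi : Function.Injective i := fun x y hxy => Subtype.ext (Subtype.ext (Subtype.mk.inj hxy))
    refine (Cardinal.mk_le_of_injective hi).trans_lt ?_
    rw [Cardinal.mk_Iio_ordinal, mk_ordBelow, Cardinal.lift_lt]
    exact Cardinal.lt_ord.1 b.2
  have hclub := isClub_closed hreg hunc hIic
  have hcof : Order.cof (OrdBelow κ) ≠ Cardinal.aleph0 := (hunc.trans_le hreg).ne'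
  have hTlt : Cardinal.mk T.fns < Cardinal.mk (OrdBelow κ) := by
    refine hT.trans_lt ?_
    rw [mk_ordBelow, Cardinal.lift_lt]
    exact hμκ
  have hbpos : (0 : Ordinal.{u}) < κ.ord :=
    Cardinal.lt_ord.2 (by simpa using Cardinal.aleph0_pos.trans hκ)
  let bot : OrdBelow κ := ⟨0, hbpos⟩
  have hbot : ∀ k : OrdBelow κ, k ≠ bot → bot < k := fun k hk =>
    lt_of_le_of_ne (Subtype.mk_le_mk.2 (zero_le)) hk.symm
  -- The value `bot` must stay free to signal that there is no counterexample; it is reserved for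
  -- the added point `none`.
  obtain ⟨c, hc, hcb⟩ : ∃ c : T.fns × OrdBelow κ → OrdBelow κ, Function.Injective c ∧
      ∀ x, c x ≠ bot := by
    have hle : Cardinal.mk (Option (T.fns × OrdBelow κ)) ≤ Cardinal.mk (OrdBelow κ) := by
      rw [Cardinal.mk_option, ← Cardinal.mul_def]
      refine Cardinal.add_le_of_le hunc.le ?_ (Cardinal.one_le_aleph0.trans hunc.le)
      exact (mul_le_mul' hTlt.le le_rfl).trans (Cardinal.mul_eq_self hunc.le).le
    obtain ⟨c₀⟩ := Cardinal.le_def _ _ |>.1 hle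
    refine ⟨fun x => Equiv.swap (c₀ none) bot (c₀ (some x)), ?_, fun x hx => ?_⟩
    · intro x y hxy
      exact Option.some_injective _ (c₀.injective ((Equiv.swap _ _).injective hxy))
    · have := (Equiv.swap (c₀ none) bot).injective (hx.trans (Equiv.swap_apply_left _ _).symm)
      exact Option.some_ne_none _ (c₀.injective this)
  let C₁ : Set (OrdBelow κ) := ⋂ f : T.fns, {γ | ∀ x < γ, ∀ y < γ, f.1 x < γ}
  let C₂ : Set (OrdBelow κ) := ⋂ f : T.fns, {γ | ∀ x < γ, ∀ y < γ, c (f, x) < γ}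
  let C₃ : Set (OrdBelow κ) := {γ | ∀ x < γ, ∀ y < γ, T.pair x y < γ}
  let C₄ : Set (OrdBelow κ) := Set.Ioi bot
  have hC₁ : IsClub C₁ := IsClub.iInter hcof (by simpa using hTlt.trans_le hreg)
    fun f => hclub fun x _ => f.1 x
  have hC₂ : IsClub C₂ := IsClub.iInter hcof (by simpa using hTlt.trans_le hreg)
    fun f => hclub fun x _ => c (f, x)
  have hC₄ : IsClub C₄ := by
    refine ⟨fun t ht ⟨t₀, ht₀⟩ _ a ha => (ht ht₀).trans_le (ha.1 ht₀), fun x => ?_⟩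
    obtain ⟨b, hb⟩ := exists_gt x
    exact ⟨b, (Subtype.mk_le_mk.2 (zero_le) : bot ≤ x).trans_lt hb, hb.le⟩
  have hC : IsClub ((C₁ ∩ C₂) ∩ (C₃ ∩ C₄)) :=
    (hC₁.inter hcof hC₂).inter hcof ((hclub T.pair).inter hcof hC₄)
  let bad : List (OrdBelow κ) → List (OrdBelow κ) → T.fns → OrdBelow κ → Prop := fun l l' f p =>
    ¬ (f.1 (T.pair p (T.code l)) = T.zero ↔ f.1 (T.pair p (T.code l')) = T.zero)
  let Bad : Finset (OrdBelow κ) → Set (OrdBelow κ) := fun w =>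
    {x | (∀ a ∈ w, x < a) ∧ ∃ f p, (∀ a ∈ w, p < a) ∧ x = c (f, p) ∧
      bad (w.sort.take (w.card / 2)) (w.sort.drop (w.card / 2)) f p}
  let F : Finset (OrdBelow κ) → OrdBelow κ := fun w =>
    if hw : (Bad w).Nonempty then wellFounded_lt.min _ hw else bot
  have hF : Regressive F := by
    intro w hw h0
    simp only [F]
    split_ifs with hb
    · exact (wellFounded_lt.min_mem _ hb).1 _ (w.min'_mem hw)
    · exact hbot _ fun h => h0 (congrArg Subtype.val h)
  have hFb : ∀ w, F w ≠ bot → F w ∈ Bad w := by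
    intro w hw
    by_cases hb : (Bad w).Nonempty
    · simp only [F, hb, dif_pos]
      exact wellFounded_lt.min_mem _ hb
    · simp [F, hb] at hw
  have hFn : ∀ w, (Bad w).Nonempty → F w ≠ bot := by
    intro w hb
    simp only [F, hb, dif_pos]
    obtain ⟨-, f, p, -, h, -⟩ := wellFounded_lt.min_mem _ hb
    rw [h]
    exact hcb _
  obtain ⟨A, hAC, hA, hom⟩ := h F hF _ hC
  have hend := hA.endless hα
  refine ⟨A, hA, ?_⟩
  have hz : ∀ a ∈ A, bot < a := fun a ha => (hAC ha).2.2
  have hfn : ∀ a ∈ A, ∀ f ∈ T.fns, ∀ x < a, f x < a := fun a ha f hf x hx =>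
    Set.mem_iInter.1 (hAC ha).1.1 ⟨f, hf⟩ x hx x hx
  refine ⟨fun a ha => hfn a ha _ T.zero_mem bot (hz a ha), hfn, fun a ha => (hAC ha).2.1, ?_⟩
  intro f hf l l' hl hlen p hne hp
  by_contra hbad
  have hpair : ∀ l l', IncIn A (l ++ l') → l.length = l'.length →
      (l ++ l').toFinset.sort.take ((l ++ l').toFinset.card / 2) = l ∧
      (l ++ l').toFinset.sort.drop ((l ++ l').toFinset.card / 2) = l' := by
    intro l l' hl hlen
    have : (l.length + l'.length) / 2 = l.length := by omega
    rw [hl.sort_toFinset, hl.card_toFinset, List.length_append, this]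
    simp
  have hsub : ∀ l, IncIn A l → ((l.toFinset : Finset (OrdBelow κ)) : Set (OrdBelow κ)) ⊆ A :=
    fun l hl a ha => hl.2 a (by simpa using ha)
  have hplt : ∀ a ∈ (l ++ l').toFinset, p < a := by
    intro a ha
    rcases List.mem_append.1 (by simpa using ha : a ∈ l ++ l') with ha | ha
    · exact hp a ha
    · obtain ⟨b, hb⟩ := List.exists_mem_of_ne_nil l hne
      exact (hp b hb).trans (hl.lt_of_append b hb a ha)
  have hB : (Bad (l ++ l').toFinset).Nonempty := by
    -- Elements of `A` are closed under coding, so the code of this counterexample lies below the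
    -- whole set.
    refine ⟨c (⟨f, hf⟩, p), fun a ha => ?_, ⟨f, hf⟩, p, hplt, rfl, ?_⟩
    · exact Set.mem_iInter.1 (hAC (hsub _ hl ha)).1.2 ⟨f, hf⟩ p (hplt a ha) p (hplt a ha)
    · rw [(hpair l l' hl hlen).1, (hpair l l' hl hlen).2]
      exact hbad
  have hx := hFn _ hB
  obtain ⟨-, g, q, -, hxe, hb1⟩ := hFb _ hx
  obtain ⟨l'', hl'', hn'', hlt''⟩ := hend.exists_incIn (l ++ l') hl.2 l.length
  have hother : ∀ m m', IncIn A (m ++ m') → m.length = l.length → m'.length = l.length →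
      bad m m' g q := by
    intro m m' hm h1 h2
    have heq : F (m ++ m').toFinset = F (l ++ l').toFinset :=
      hom _ _ (hsub _ hm) (hsub _ hl) (by
        rw [hm.card_toFinset, hl.card_toFinset, List.length_append, List.length_append]
        omega)
    obtain ⟨-, g', q', -, hxe', hb'⟩ := hFb (m ++ m').toFinset (by rw [heq]; exact hx)
    rw [heq, hxe] at hxe'
    have := hc hxe'
    rw [Prod.mk.injEq] at this
    rw [(hpair m m' hm (by omega)).1, (hpair m m' hm (by omega)).2, ← this.1, ← this.2] at hb'
    exact hb'
  have b1 := hother l l' hl rfl hlen.symm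
  have b2 := hother l l'' (hl.left.append hl'' fun a ha => hlt'' a (by simp [ha])) rfl hn''
  have b3 := hother l' l'' (hl.right.append hl'' fun a ha => hlt'' a (by simp [ha])) hlen.symm hn''
  simp only [bad] at b1 b2 b3
  tauto

/-! ### The sets of stable values -/

/-- `y` is the value of `f` at all lists that prolong `s` in `A` by at least `m` entries. -/
def StableValue {K : Type*} [LinearOrder K] (T : Clone K) (A : Set K) (s : List K) (f : K → K)
    (m : ℕ) (y : K) : Prop :=
  ∀ v, IncIn A (s ++ v) → m ≤ v.length → f (T.code (s ++ v)) = y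

/-- The stable values of functions of the clone at prolongations of `s`. -/
def stableHull {K : Type*} [LinearOrder K] (T : Clone K) (A : Set K) (s : List K) : Set K :=
  {y | ∃ f ∈ T.fns, ∃ m, StableValue T A s f m y}

/-- `y` and `z` are stable values of the same function at the prolongations of `s` and of `t`. -/
def StableRel {K : Type*} [LinearOrder K] (T : Clone K) (A : Set K) (s t : List K) (y z : K) :
    Prop :=
  ∃ f ∈ T.fns, ∃ m, StableValue T A s f m y ∧ StableValue T A t f m z

/-! ### Stable hulls: closure properties and dependence on the list -/

section Basic

variable {K : Type*} [LinearOrder K] {T : Clone K} {A : Set K}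

theorem stableValue_const (s : List K) (c : K) : StableValue T A s (fun _ => c) 0 c :=
  fun _ _ _ => rfl

theorem stableValue_nth (s : List K) (i : ℕ) (hi : i < s.length) :
    StableValue T A s (T.nth i) 0 s[i] := by
  intro v _ _
  rw [T.nth_code i _ (by simp; omega), List.getElem_append_left hi]

theorem StableValue.comp {s : List K} {f : K → K} {m : ℕ} {y : K} (h : StableValue T A s f m y)
    (g : K → K) : StableValue T A s (g ∘ f) m (g y) := by
  intro v hv hm
  simp [h v hv hm]

theorem StableValue.prod {s : List K} {f g : K → K} {m n : ℕ} {y z : K}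
    (hf : StableValue T A s f m y) (hg : StableValue T A s g n z) :
    StableValue T A s (fun x => T.pair (f x) (g x)) (max m n) (T.pair y z) := by
  intro v hv hm
  simp [hf v hv ((le_max_left _ _).trans hm), hg v hv ((le_max_right _ _).trans hm)]

theorem stableHull_fn {s : List K} {f y} (hf : f ∈ T.fns) (hy : y ∈ stableHull T A s) :
    f y ∈ stableHull T A s := by
  obtain ⟨g, hg, m, h⟩ := hy
  exact ⟨_, T.comp_mem _ hf _ hg, m, h.comp f⟩

theorem stableHull_pair {s : List K} {y z} (hy : y ∈ stableHull T A s) (hz : z ∈ stableHull T A s) :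
    T.pair y z ∈ stableHull T A s := by
  obtain ⟨f, hf, m, h⟩ := hy
  obtain ⟨g, hg, n, h'⟩ := hz
  exact ⟨_, T.prod_mem _ hf _ hg, _, h.prod h'⟩

theorem stableHull_code {s : List K} {l : List K} (hl : ∀ a ∈ l, a ∈ stableHull T A s) :
    T.code l ∈ stableHull T A s := by
  induction l with
  | nil => exact ⟨_, T.zero_mem, 0, stableValue_const s _⟩
  | cons a l ih =>
    exact stableHull_pair (hl a (by simp)) (ih fun b hb => hl b (by simp [hb]))

theorem StableRel.symm {s t : List K} {y z : K} (h : StableRel T A s t y z) :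
    StableRel T A t s z y := by
  obtain ⟨f, hf, m, h₁, h₂⟩ := h
  exact ⟨f, hf, m, h₂, h₁⟩

theorem StableRel.left_mem {s t : List K} {y z : K} (h : StableRel T A s t y z) :
    y ∈ stableHull T A s := by
  obtain ⟨f, hf, m, h₁, -⟩ := h
  exact ⟨f, hf, m, h₁⟩

/-- Stable values at a list persist at larger lists. -/
theorem StableRel.mono {s s' : List K} {y z : K} (σ : K → K) (hs : ∀ a ∈ s', a ∈ s)
    (hs₁ : IncIn A s') (ht₁ : IncIn A (s'.map σ))
    (h : StableRel T A s' (s'.map σ) y z) : StableRel T A s (s.map σ) y z := by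
  obtain ⟨f, hf, m, h₁, h₂⟩ := h
  -- Dropping the superfluous entries works by position, so the same function serves `s` and its
  -- image under `σ`.
  obtain ⟨r, hr, hr'⟩ := T.exists_reindex_append s s' hs
  refine ⟨_, T.comp_mem _ hf _ hr, m, fun v hv hm => ?_, fun v hv hm => ?_⟩
  · have := hr' id v
    simp only [List.map_id] at this
    simp only [Function.comp_apply, this]
    exact h₁ v (hs₁.append hv.right fun a ha b hb => hv.lt_of_append a (hs a ha) b hb) hm
  · simp only [Function.comp_apply, hr']
    refine h₂ v (ht₁.append hv.right fun a ha b hb => hv.lt_of_append a ?_ b hb) hm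
    obtain ⟨c, hc, rfl⟩ := List.mem_map.1 ha
    exact List.mem_map.2 ⟨c, hs c hc, rfl⟩

theorem stableHull_mono {s s' : List K} (hs : ∀ a ∈ s', a ∈ s) (hs₁ : IncIn A s') :
    stableHull T A s' ⊆ stableHull T A s := by
  rintro y ⟨f, hf, m, h⟩
  have : StableRel T A s' (s'.map id) y y := ⟨f, hf, m, h, by rwa [List.map_id]⟩
  exact (this.mono id hs hs₁ (by rwa [List.map_id])).left_mem

end Basic

theorem IncIn.exists_split {K : Type*} [LinearOrder K] {A : Set K} {s : List K} (hs : IncIn A s)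
    {b : K} (hb : b ∉ s) : ∃ s₁ s₂, s = s₁ ++ s₂ ∧ (∀ a ∈ s₁, a < b) ∧ ∀ a ∈ s₂, b < a := by
  induction s with
  | nil => exact ⟨[], [], rfl, by simp, by simp⟩
  | cons a s ih =>
    have hs' : IncIn A ([a] ++ s) := hs
    rcases lt_trichotomy a b with h | h | h
    · obtain ⟨s₁, s₂, rfl, h₁, h₂⟩ := ih hs'.right fun hmem => hb (by simp [hmem])
      exact ⟨a :: s₁, s₂, rfl, by simpa [h] using h₁, h₂⟩
    · exact absurd h (fun h => hb (by simp [h]))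
    · refine ⟨[], a :: s, rfl, by simp, fun c hc => ?_⟩
      rcases List.mem_cons.1 hc with rfl | hc
      · exact h
      · exact h.trans (hs'.lt_of_append a (by simp) c hc)

namespace EndIndiscernible

variable {K : Type*} [LinearOrder K] {T : Clone K} {A : Set K}

theorem code_lt (hA : EndIndiscernible T A) {a : K} (ha : a ∈ A) {l : List K} (hl : ∀ b ∈ l, b < a) :
    T.code l < a := by
  induction l with
  | nil => exact hA.zero_lt a ha
  | cons b l ih =>
    exact hA.pair_lt a ha _ (hl b (by simp)) _ (ih fun c hc => hl c (by simp [hc]))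

/-- The field `shift` only compares consecutive lists. Arbitrary ones are compared through a third
list beyond both, with the trivial parameter `T.zero`. -/
theorem test (hA : EndIndiscernible T A) (hE : Endless A) {f : K → K} (hf : f ∈ T.fns) {l l' : List K}
    (hl : IncIn A l) (hl' : IncIn A l') (hlen : l.length = l'.length) :
    f (T.code l) = T.zero ↔ f (T.code l') = T.zero := by
  rcases eq_or_ne l [] with rfl | hne
  · rw [List.length_eq_zero_iff.1 hlen.symm]
  have hne' : l' ≠ [] := by
    rintro rfl
    exact hne (List.length_eq_zero_iff.1 hlen)
  obtain ⟨w, hw, hn, hlt⟩ := hE.exists_incIn (l ++ l')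
    (fun a ha => (List.mem_append.1 ha).elim (hl.2 a) (hl'.2 a)) l.length
  have h₁ := hA.shift _ (T.comp_mem _ hf _ T.snd_mem) l w
    (hl.append hw fun a ha => hlt a (by simp [ha])) hn.symm T.zero hne
    fun a ha => hA.zero_lt a (hl.2 a ha)
  have h₂ := hA.shift _ (T.comp_mem _ hf _ T.snd_mem) l' w
    (hl'.append hw fun a ha => hlt a (by simp [ha])) (hlen.symm.trans hn.symm) T.zero hne'
    fun a ha => hA.zero_lt a (hl'.2 a ha)
  simp only [Function.comp_apply, T.snd_pair] at h₁ h₂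
  rw [h₁, h₂]

/-- Two functions that agree at a list of elements of `A` agree at all lists of the same length. -/
theorem eq_iff (hA : EndIndiscernible T A) (hE : Endless A) {f g : K → K} (hf : f ∈ T.fns)
    (hg : g ∈ T.fns) {l l' : List K} (hl : IncIn A l) (hl' : IncIn A l')
    (hlen : l.length = l'.length) :
    f (T.code l) = g (T.code l) ↔ f (T.code l') = g (T.code l') := by
  obtain ⟨t, ht, h⟩ := T.eq_test_mem hf hg
  rw [← h, ← h]
  exact hA.test hE ht hl hl' hlen

theorem lt_iff (hA : EndIndiscernible T A) (hE : Endless A) {f g : K → K} (hf : f ∈ T.fns)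
    (hg : g ∈ T.fns) {l l' : List K} (hl : IncIn A l) (hl' : IncIn A l')
    (hlen : l.length = l'.length) :
    f (T.code l) < g (T.code l) ↔ f (T.code l') < g (T.code l') := by
  obtain ⟨t, ht, h⟩ := T.lt_test_mem hf hg
  rw [← h, ← h]
  exact hA.test hE ht hl hl' hlen

/-- A value below the prolongation of `s` at which it is taken is stable. -/
theorem mem_stableHull_of_lt (hA : EndIndiscernible T A) (hE : Endless A) {f : K → K}
    (hf : f ∈ T.fns) {s v : List K} (hv : IncIn A (s ++ v)) (hlt : ∀ a ∈ v, f (T.code (s ++ v)) < a) :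
    f (T.code (s ++ v)) ∈ stableHull T A s := by
  obtain ⟨t, ht, ht'⟩ := T.exists_take (s.length + v.length)
  refine ⟨_, T.comp_mem _ hf _ ht, v.length, fun w hw hle => ?_⟩
  rw [← List.take_append_drop v.length w] at hw ⊢
  rw [← List.append_assoc] at hw ⊢
  rw [Function.comp_apply, ht' _ _ (by simp [hle])]
  replace hw := hw.left
  have hwlen : (w.take v.length).length = v.length := by simp [hle]
  generalize w.take v.length = w at hw hwlen
  set y := f (T.code (s ++ v)) with hy
  rcases eq_or_ne v [] with rfl | hne
  · rw [List.length_eq_zero_iff.1 hwlen, hy]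
  obtain ⟨x, hx, hxn, hxlt⟩ := hE.exists_incIn ((s ++ v) ++ (s ++ w))
    (fun a ha => (List.mem_append.1 ha).elim (hv.2 a) (hw.2 a)) v.length
  have hvx : IncIn A ((s ++ v) ++ x) := hv.append hx fun a ha => hxlt a (List.mem_append_left _ ha)
  have hwx : IncIn A ((s ++ w) ++ x) := hw.append hx fun a ha => hxlt a (List.mem_append_right _ ha)
  -- Both `y` and `s` lie below `v` and may serve as parameters, so `shift` replaces `v` by `x`. The
  -- resulting equality of the values at `(s, v)` and `(s, x)` no longer mentions `y`, and so it
  -- transfers to `(s, w)` and `(s, x)`.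
  have hyx : f (T.code (s ++ x)) = y := by
    obtain ⟨r, hr, hr'⟩ := T.exists_append s.length
    obtain ⟨e, he, he'⟩ := T.eq_test_mem
      (T.comp_mem _ hf _ (T.comp_mem _ hr _
        (T.prod_mem _ (T.comp_mem _ T.snd_mem _ T.fst_mem) _ T.snd_mem)))
      (T.comp_mem _ T.fst_mem _ T.fst_mem)
    rw [List.append_assoc] at hvx
    have := hA.shift e he v x hvx.right hxn.symm (T.pair y (T.code s)) hne fun a ha =>
      hA.pair_lt a (hv.2 a (by simp [ha])) _ (hlt a ha) _
        (hA.code_lt (hv.2 a (by simp [ha])) fun b hb => hv.lt_of_append b hb a ha)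
    rw [he', he'] at this
    simp only [Function.comp_apply, T.fst_pair, T.snd_pair, hr' s _ rfl] at this
    exact this.1 hy.symm
  obtain ⟨t₁, ht₁, ht₁'⟩ := T.exists_take (s.length + v.length)
  obtain ⟨r, hr, hr'⟩ := T.exists_remove s.length v.length
  have := hA.eq_iff hE (T.comp_mem _ hf _ ht₁) (T.comp_mem _ hf _ hr) hvx hwx (by simp [hwlen])
  simp only [Function.comp_apply] at this
  rw [ht₁' _ _ (by simp), ht₁' _ _ (by simp [hwlen]), List.append_assoc, List.append_assoc,
    hr' _ _ _ rfl rfl, hr' _ _ _ rfl hwlen, hyx] at this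
  exact this.1 hy.symm

/-- Stable values at `s` are below all later elements of `A`. -/
theorem lt_of_mem_stableHull (hA : EndIndiscernible T A) (hE : Endless A) {s : List K}
    (hs : IncIn A s) {y a : K} (hy : y ∈ stableHull T A s) (ha : a ∈ A) (hlt : ∀ c ∈ s, c < a) :
    y < a := by
  obtain ⟨f, hf, m, h⟩ := hy
  have hsa : IncIn A (s ++ [a]) := hs.append (IncIn.singleton ha) (by simpa using hlt)
  obtain ⟨v, hv, hvn, hvlt⟩ := hE.exists_incIn (s ++ [a]) hsa.2 m
  have hsv : IncIn A (s ++ v) := hs.append hv fun c hc => hvlt c (by simp [hc])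
  -- Beyond `s ++ v` the closure of `b` under the clone bounds the value by `b`. As `y` is also the
  -- value at `s ++ w` with `w` beyond `b`, the inequality transfers back to `a`.
  obtain ⟨b, hb, hblt⟩ := hE.exists_gt (s ++ v) hsv.2
  have hsb : IncIn A (s ++ [b]) := hs.append (IncIn.singleton hb) fun c hc d hd => by
    rw [List.mem_singleton.1 hd]
    exact hblt c (by simp [hc])
  obtain ⟨w, hw, hwn, hwlt⟩ := hE.exists_incIn (s ++ [b]) hsb.2 m
  have hsw : IncIn A (s ++ w) := hs.append hw fun c hc => hwlt c (by simp [hc])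
  obtain ⟨r, hr, hr'⟩ := T.exists_remove s.length 1
  have hlist : ∀ (c : K) (x : List K), IncIn A ((s ++ [c]) ++ x) →
      r (T.code ((s ++ [c]) ++ x)) = T.code (s ++ x) ∧
      T.nth s.length (T.code ((s ++ [c]) ++ x)) = c := by
    intro c x _
    refine ⟨?_, ?_⟩
    · rw [List.append_assoc, hr' _ _ _ rfl rfl]
    · rw [T.nth_code _ _ (by simp)]
      simp
  have h₁ : IncIn A ((s ++ [a]) ++ v) := hsa.append hv hvlt
  have h₂ : IncIn A ((s ++ [b]) ++ w) := hsb.append hw hwlt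
  have := hA.lt_iff hE (T.comp_mem _ hf _ hr) (T.nth_mem s.length) h₁ h₂ (by simp [hvn, hwn])
  simp only [Function.comp_apply] at this
  rw [(hlist a v h₁).1, (hlist a v h₁).2, (hlist b w h₂).1, (hlist b w h₂).2,
    h v hsv hvn.ge, h w hsw hwn.ge] at this
  refine this.2 ?_
  rw [← h v hsv hvn.ge]
  exact hA.fn_lt b hb f hf _ (hA.code_lt hb hblt)

/-- A function with a stable value at `s` has a stable value at every list of the same length. -/
theorem exists_stableValue (hA : EndIndiscernible T A) (hE : Endless A) {s t : List K}
    (hs : IncIn A s) (ht : IncIn A t) (hlen : s.length = t.length) {f : K → K} (hf : f ∈ T.fns)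
    {m : ℕ} {y : K} (h : StableValue T A s f m y) : ∃ z, StableValue T A t f m z := by
  obtain ⟨v₀, hv₀, hn₀, hlt₀⟩ := hE.exists_incIn t ht.2 m
  refine ⟨f (T.code (t ++ v₀)), ?_⟩
  -- Agreement of the values at `v` and at a later `w` is a statement about one list, and it is
  -- known at `s`. Two arbitrary prolongations are then compared through a common later one.
  have key : ∀ v w, IncIn A ((t ++ v) ++ w) → m ≤ v.length → w.length = m →
      f (T.code (t ++ v)) = f (T.code (t ++ w)) := by
    intro v w hvw hv hw
    obtain ⟨v', hv', hn', hlt'⟩ := hE.exists_incIn s hs.2 v.length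
    have hsv := hs.append hv' hlt'
    obtain ⟨w', hw', hm', hlt''⟩ := hE.exists_incIn (s ++ v') hsv.2 m
    obtain ⟨k, hk, hk'⟩ := T.exists_take (s.length + v.length)
    obtain ⟨r, hr, hr'⟩ := T.exists_remove s.length v.length
    have hsvw := hsv.append hw' hlt''
    have := hA.eq_iff hE (T.comp_mem _ hf _ hk) (T.comp_mem _ hf _ hr) hsvw hvw
      (by simp [hlen, hn', hm', hw])
    simp only [Function.comp_apply] at this
    rw [hk' _ _ (by simp [hn']), hk' _ _ (by simp [hlen]), List.append_assoc, List.append_assoc,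
      hr' _ _ _ rfl hn', hr' _ _ _ hlen.symm rfl] at this
    refine this.1 ?_
    rw [h _ hsv (by omega), h _ (hs.append hw' fun a ha => hlt'' a (by simp [ha])) hm'.ge]
  intro v hv hm
  obtain ⟨w, hw, hwn, hlt⟩ := hE.exists_incIn ((t ++ v) ++ v₀)
    (fun a ha => (List.mem_append.1 ha).elim (hv.2 a) (hv₀.2 a)) m
  rw [key v w (hv.append hw fun a ha => hlt a (List.mem_append_left _ ha)) hm hwn,
    key v₀ w ((ht.append hv₀ hlt₀).append hw fun a ha => hlt a (by
      rcases List.mem_append.1 ha with h | h <;> simp [h])) hn₀.ge hwn]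

theorem exists_stableRel (hA : EndIndiscernible T A) (hE : Endless A) {s t : List K}
    (hs : IncIn A s) (ht : IncIn A t) (hlen : s.length = t.length) {y : K}
    (hy : y ∈ stableHull T A s) : ∃ z, StableRel T A s t y z := by
  obtain ⟨f, hf, m, h⟩ := hy
  obtain ⟨z, hz⟩ := hA.exists_stableValue hE hs ht hlen hf h
  exact ⟨z, f, hf, m, h, hz⟩

/-- Relations that are decided by the clone are preserved. -/
theorem stableRel_test (hA : EndIndiscernible T A) (hE : Endless A) {s t : List K}
    (hs : IncIn A s) (ht : IncIn A t) (hlen : s.length = t.length) {y z y' z' : K}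
    (h : StableRel T A s t y z) (h' : StableRel T A s t y' z') {g : K → K} (hg : g ∈ T.fns) :
    g (T.pair y y') = T.zero ↔ g (T.pair z z') = T.zero := by
  obtain ⟨f, hf, m, h₁, h₂⟩ := h
  obtain ⟨f', hf', m', h₁', h₂'⟩ := h'
  obtain ⟨v, hv, hn, hlt⟩ := hE.exists_incIn s hs.2 (max m m')
  obtain ⟨w, hw, hn', hlt'⟩ := hE.exists_incIn t ht.2 (max m m')
  have hsv := hs.append hv hlt
  have htw := ht.append hw hlt'
  have := hA.test hE (T.comp_mem _ hg _ (T.prod_mem _ hf _ hf')) hsv htw (by simp [hlen, hn, hn'])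
  simp only [Function.comp_apply] at this
  rwa [h₁ v hsv (by simp [hn]), h₁' v hsv (by simp [hn]), h₂ w htw (by simp [hn']),
    h₂' w htw (by simp [hn'])] at this

theorem stableRel_eq_iff (hA : EndIndiscernible T A) (hE : Endless A) {s t : List K}
    (hs : IncIn A s) (ht : IncIn A t) (hlen : s.length = t.length) {y z y' z' : K}
    (h : StableRel T A s t y z) (h' : StableRel T A s t y' z') : y = y' ↔ z = z' := by
  obtain ⟨e, he, he'⟩ := T.eq_test
  rw [← he' y y', ← he' z z']
  exact hA.stableRel_test hE hs ht hlen h h' he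

theorem stableRel_refl_iff (hA : EndIndiscernible T A) (hE : Endless A) {s : List K}
    (hs : IncIn A s) {y z : K} (h : StableRel T A s s y z) : y = z := by
  obtain ⟨f, hf, m, h₁, h₂⟩ := h
  exact (hA.stableRel_eq_iff hE hs hs rfl (z := y) (z' := z) ⟨f, hf, m, h₁, h₁⟩
    ⟨f, hf, m, h₁, h₂⟩).1 rfl

/-- The middle element is given by two functions, one from each hypothesis. Their agreement at `s`
transfers to `t`. -/
theorem stableRel_trans (hA : EndIndiscernible T A) (hE : Endless A) {r s t : List K}
    (hs : IncIn A s) (ht : IncIn A t) (hlen' : s.length = t.length) {x y z : K}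
    (h : StableRel T A r s x y) (h' : StableRel T A s t y z) : StableRel T A r t x z := by
  obtain ⟨f, hf, m, h₁, h₂⟩ := h
  obtain ⟨w, hw⟩ := hA.exists_stableValue hE hs ht hlen' hf h₂
  have : w = z := (hA.stableRel_eq_iff hE hs ht hlen' ⟨f, hf, m, h₂, hw⟩ h').1 rfl
  exact ⟨f, hf, m, h₁, this ▸ hw⟩

/-- If `b` were not in `s`, the entries of `s` above `b` could be discarded as lying above the value
`b`. Then `b` would be stable at entries below `b`, hence smaller than itself. -/
theorem mem_of_mem_stableHull (hA : EndIndiscernible T A) (hE : Endless A) {s : List K}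
    (hs : IncIn A s) {b : K} (hb : b ∈ A) (hbs : b ∈ stableHull T A s) : b ∈ s := by
  by_contra hcon
  obtain ⟨s₁, s₂, rfl, h₁, h₂⟩ := hs.exists_split hcon
  have hbs' := hbs
  obtain ⟨f, hf, m, h⟩ := hbs
  obtain ⟨v, hv, hn, hlt⟩ := hE.exists_incIn _ hs.2 m
  have hsv := hs.append hv hlt
  have hval := h v hsv hn.ge
  rw [List.append_assoc] at hval hsv
  have := hA.mem_stableHull_of_lt hE hf hsv (fun a ha => by
    rw [hval]
    rcases List.mem_append.1 ha with ha | ha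
    · exact h₂ a ha
    · exact hA.lt_of_mem_stableHull hE hs hbs' (hv.2 a ha) fun c hc => hlt c hc a ha)
  rw [hval] at this
  exact (hA.lt_of_mem_stableHull hE hs.left this hb h₁).ne rfl

/-- Source of end extension: entries above a value do not contribute to it. -/
theorem mem_stableHull_left (hA : EndIndiscernible T A) (hE : Endless A) {s t : List K}
    (hst : IncIn A (s ++ t)) {y : K} (hy : y ∈ stableHull T A (s ++ t)) (hlt : ∀ a ∈ t, y < a) :
    y ∈ stableHull T A s := by
  have hy' := hy
  obtain ⟨f, hf, m, h⟩ := hy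
  obtain ⟨v, hv, hn, hvlt⟩ := hE.exists_incIn _ hst.2 m
  have hsv := hst.append hv hvlt
  have hval := h v hsv hn.ge
  rw [List.append_assoc] at hval hsv
  have := hA.mem_stableHull_of_lt hE hf hsv (fun a ha => by
    rw [hval]
    rcases List.mem_append.1 ha with ha | ha
    · exact hlt a ha
    · exact hA.lt_of_mem_stableHull hE hst hy' (hv.2 a ha) fun c hc => hvlt c hc a ha)
  rwa [hval] at this

/-- Compare the last entries. If they differ, the larger exceeds `y` and can be dropped. If both are
`b`, then `y` is a function of the code of `s₁` and of `b` with later entries. The least `η` that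
can replace this code is below `b` and is computable from `y`, so it is stable at `s₁` and at `t₁`.
By induction it is stable at their intersection, and `y` is recovered from `η`, `b` and later
entries. -/
theorem mem_stableHull_inter (hA : EndIndiscernible T A) (hE : Endless A) (n : ℕ) (s t : List K)
    (hn : s.length + t.length ≤ n) (hs : IncIn A s) (ht : IncIn A t) {y : K}
    (hys : y ∈ stableHull T A s) (hyt : y ∈ stableHull T A t) :
    y ∈ stableHull T A (s.filter (· ∈ t)) := by
  induction n generalizing s t y with
  | zero =>
    have hs0 : s = [] := List.length_eq_zero_iff.1 (by omega)
    subst hs0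
    simpa using hys
  | succ n ih =>
    rcases s.eq_nil_or_concat' with rfl | ⟨s₁, b, rfl⟩
    · simpa using hys
    rcases t.eq_nil_or_concat' with rfl | ⟨t₁, c, rfl⟩
    · simpa using hyt
    have hsb : ∀ a ∈ s₁, a < b := fun a ha => hs.lt_of_append a ha b (by simp)
    have htc : ∀ a ∈ t₁, a < c := fun a ha => ht.lt_of_append a ha c (by simp)
    have hbA : b ∈ A := hs.2 b (by simp)
    have hcA : c ∈ A := ht.2 c (by simp)
    simp only [List.length_append, List.length_singleton] at hn
    rcases lt_trichotomy b c with hbc | rfl | hbc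
    · have hlt : ∀ a ∈ s₁ ++ [b], a < c := by
        intro a ha
        rcases List.mem_append.1 ha with ha | ha
        · exact (hsb a ha).trans hbc
        · rwa [List.mem_singleton.1 ha]
      have hyc := hA.lt_of_mem_stableHull hE hs hys hcA hlt
      have := ih (s₁ ++ [b]) t₁ (by simp; omega) hs ht.left hys
        (hA.mem_stableHull_left hE ht hyt (by simpa using hyc))
      convert this using 2
      apply List.filter_congr
      intro a ha
      simp [(hlt a ha).ne]
    · have hfil : (s₁ ++ [b]).filter (· ∈ t₁ ++ [b]) = s₁.filter (· ∈ t₁) ++ [b] := by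
        rw [List.filter_append]
        congr 1
        · apply List.filter_congr
          intro a ha
          simp [(hsb a ha).ne]
        · simp
      rw [hfil]
      have hu : IncIn A (s₁.filter (· ∈ t₁)) :=
        ⟨hs.left.1.filter _, fun a ha => hs.left.2 a (List.mem_of_mem_filter ha)⟩
      have hub : IncIn A (s₁.filter (· ∈ t₁) ++ [b]) := hu.append (IncIn.singleton hbA)
        (by simpa using fun a ha _ => hsb a ha)
      rcases lt_or_ge y b with hyb | -
      · exact stableHull_mono (fun a ha => List.mem_append_left _ ha) hu
          (ih s₁ t₁ (by omega) hs.left ht.left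
            (hA.mem_stableHull_left hE hs hys (by simpa using hyb))
            (hA.mem_stableHull_left hE ht hyt (by simpa using hyb)))
      · have hyv := fun a ha h => hA.lt_of_mem_stableHull (a := a) hE hs hys ha h
        obtain ⟨f, hf, m, h⟩ := hys
        obtain ⟨g, hg, m', h'⟩ := hyt
        obtain ⟨v, hv, hvn, hlt⟩ := hE.exists_incIn ((s₁ ++ [b]) ++ (t₁ ++ [b]))
          (fun a ha => (List.mem_append.1 ha).elim (hs.2 a) (ht.2 a)) (max m m')
        have hsv := hs.append hv fun a ha => hlt a (List.mem_append_left _ ha)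
        have htv := ht.append hv fun a ha => hlt a (List.mem_append_right _ ha)
        have hfv := h v hsv (by simp [hvn])
        have hgv := h' v htv (by simp [hvn])
        rw [List.append_assoc] at hsv htv hfv hgv
        obtain ⟨q, hq, hq'⟩ := T.exists_append s₁.length
        obtain ⟨ℓ, hℓ, hℓ'⟩ := T.least _ (T.comp_mem _ hf _ hq)
        obtain ⟨h₁, h₂⟩ := hℓ' (T.code s₁) y (T.code ([b] ++ v))
          (by rw [Function.comp_apply, hq' _ _ rfl, hfv])
        set η := ℓ (T.pair y (T.code ([b] ++ v))) with hη
        have hηb : η < b := h₂.trans_lt (hA.code_lt hbA hsb)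
        have hbv : ∀ a ∈ [b] ++ v, η < a := by
          intro a ha
          rcases List.mem_append.1 ha with ha | ha
          · rwa [List.mem_singleton.1 ha]
          · exact hηb.trans (hlt b (by simp) a ha)
        -- Only the value `y` enters the definition of `η`, so any description of `y` over `x`, `b`
        -- and `v` also describes `η`.
        have hηmem : ∀ (x : List K) (φ : K → K), φ ∈ T.fns → IncIn A (x ++ ([b] ++ v)) →
            φ (T.code (x ++ ([b] ++ v))) = y → η ∈ stableHull T A x := by
          intro x φ hφ hx hxy
          obtain ⟨d, hd, hd'⟩ := T.exists_drop x.length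
          have heq : (ℓ ∘ fun z => T.pair (φ z) (d z)) (T.code (x ++ ([b] ++ v))) = η := by
            rw [Function.comp_apply, hxy, hd' _ _ rfl]
          have := hA.mem_stableHull_of_lt hE (T.comp_mem _ hℓ _ (T.prod_mem _ hφ _ hd)) hx
            (by rw [heq]; exact hbv)
          rwa [heq] at this
        obtain ⟨k, hk, m'', hk'⟩ := ih s₁ t₁ (by omega) hs.left ht.left
          (hηmem s₁ f hf hsv hfv) (hηmem t₁ g hg htv hgv)
        obtain ⟨w, hw, hwn, hwlt⟩ := hE.exists_incIn (s₁ ++ ([b] ++ v)) hsv.2 m''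
        have huv : IncIn A ((s₁.filter (· ∈ t₁) ++ [b]) ++ (v ++ w)) := by
          refine hub.append (hv.append hw fun a ha => hwlt a (by simp [ha])) fun a ha c hc => ?_
          have ha' : a ∈ s₁ ++ [b] := by
            rcases List.mem_append.1 ha with ha | ha
            · exact List.mem_append_left _ (List.mem_of_mem_filter ha)
            · exact List.mem_append_right _ ha
          rcases List.mem_append.1 hc with hc | hc
          · exact hlt a (List.mem_append_left _ ha') c hc
          · exact hwlt a (by rw [← List.append_assoc]; exact List.mem_append_left v ha') c hc
        generalize s₁.filter (· ∈ t₁) = u at hu hub hk' huv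
        obtain ⟨d, hd, hd'⟩ := T.exists_drop u.length
        obtain ⟨p, hp, hp'⟩ := T.exists_take (1 + v.length)
        have hF := T.comp_mem _ (T.comp_mem _ hf _ hq) _ (T.prod_mem _ hk _ (T.comp_mem _ hp _ hd))
        have hval : ((f ∘ q) ∘ fun x => T.pair (k x) ((p ∘ d) x))
            (T.code ((u ++ [b]) ++ (v ++ w))) = y := by
          have e1 : k (T.code ((u ++ [b]) ++ (v ++ w))) = η := by
            rw [List.append_assoc] at huv ⊢
            exact hk' _ huv (by simp; omega)
          have e2 : (p ∘ d) (T.code ((u ++ [b]) ++ (v ++ w))) = T.code ([b] ++ v) := by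
            rw [Function.comp_apply, List.append_assoc, hd' _ _ rfl, ← List.append_assoc,
              hp' _ _ (by simp; omega)]
          rw [Function.comp_apply, e1, e2, h₁]
        have := hA.mem_stableHull_of_lt hE hF huv (fun a ha => by
          rw [hval]
          refine hyv a (huv.2 a (List.mem_append_right _ ha)) fun c hc => ?_
          rcases List.mem_append.1 ha with ha | ha
          · exact hlt c (List.mem_append_left _ hc) a ha
          · exact hwlt c (by rw [← List.append_assoc]; exact List.mem_append_left v hc) a ha)
        rwa [hval] at this
    · have hlt : ∀ a ∈ t₁ ++ [c], a < b := by
        intro a ha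
        rcases List.mem_append.1 ha with ha | ha
        · exact (htc a ha).trans hbc
        · rwa [List.mem_singleton.1 ha]
      have hyb := hA.lt_of_mem_stableHull hE ht hyt hbA hlt
      have := ih s₁ (t₁ ++ [c]) (by simp; omega) hs.left ht
        (hA.mem_stableHull_left hE hs hys (by simpa using hyb)) hyt
      have hb : [b].filter (· ∈ t₁ ++ [c]) = [] := by
        rw [List.filter_eq_nil_iff]
        intro a ha hmem
        rw [List.mem_singleton.1 ha] at hmem
        exact lt_irrefl b (hlt b (by simpa using hmem))
      rwa [List.filter_append, hb, List.append_nil]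

/-- A stable value is recovered from its function and its bound `m` by evaluation at one fixed
prolongation of length `m`. -/
theorem mk_stableHull_le (hE : Endless A) {s : List K} (hs : IncIn A s) :
    Cardinal.mk (stableHull T A s) ≤ max Cardinal.aleph0 (Cardinal.mk T.fns) := by
  choose v hv hn hlt using hE.exists_incIn s hs.2
  have hsub : stableHull T A s ⊆
      Set.range fun x : T.fns × ULift ℕ => x.1.1 (T.code (s ++ v x.2.down)) := by
    rintro y ⟨f, hf, m, h⟩
    exact ⟨(⟨f, hf⟩, ⟨m⟩), h _ (hs.append (hv m) (hlt m)) (hn m).ge⟩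
  refine (Cardinal.mk_le_mk_of_subset hsub).trans (Cardinal.mk_range_le.trans ?_)
  rw [← Cardinal.mul_def]
  refine (Cardinal.mul_le_max _ _).trans (max_le (max_le (le_max_right _ _) ?_) (le_max_left _ _))
  simp

end EndIndiscernible

/-! ### Closure properties of `H(χ)` -/

theorem mem_HSet_of_subset {χ : Cardinal.{u}} {x : ZFSet.{u}} (s : Set ZFSet.{u})
    (h : ∀ y, Relation.TransGen (· ∈ ·) y x → y ∈ s)
    (hs : Cardinal.mk s < Cardinal.lift.{u + 1} χ) : x ∈ HSet χ :=
  (Cardinal.mk_le_mk_of_subset (s := {y | Relation.TransGen (· ∈ ·) y x}) h).trans_lt hs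

theorem mem_HSet_of_mem {χ : Cardinal.{u}} {x y : ZFSet.{u}} (hy : y ∈ HSet χ) (hxy : x ∈ y) :
    x ∈ HSet χ :=
  mem_HSet_of_subset {z | Relation.TransGen (· ∈ ·) z y} (fun _ hz => hz.tail hxy) hy

theorem toZFSet_mem_HSet {χ : Cardinal.{u}} {a : Ordinal.{u}} (ha : a < χ.ord) :
    a.toZFSet ∈ HSet χ := by
  refine mem_HSet_of_subset (Ordinal.toZFSet '' Set.Iio a) (fun y hy => ?_) ?_
  · induction hy using Relation.TransGen.head_induction_on with
    | single h =>
      obtain ⟨b, hb, rfl⟩ := Ordinal.mem_toZFSet_iff.1 h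
      exact ⟨b, hb, rfl⟩
    | head h _ ih =>
      obtain ⟨b, hb, rfl⟩ := ih
      obtain ⟨c, hc, rfl⟩ := Ordinal.mem_toZFSet_iff.1 h
      exact ⟨c, hc.trans hb, rfl⟩
  · refine Cardinal.mk_image_le.trans_lt ?_
    rw [Cardinal.mk_Iio_ordinal, Cardinal.lift_lt]
    exact Cardinal.lt_ord.1 ha

theorem insert_mem_HSet {χ : Cardinal.{u}} (hχ : Cardinal.aleph0 ≤ χ) {a b : ZFSet.{u}}
    (ha : a ∈ HSet χ) (hb : b ∈ HSet χ) : insert a b ∈ HSet χ := by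
  have hχ' : Cardinal.aleph0 ≤ Cardinal.lift.{u + 1} χ := by simpa using hχ
  refine mem_HSet_of_subset ({a} ∪ ({z | Relation.TransGen (· ∈ ·) z a} ∪
    {z | Relation.TransGen (· ∈ ·) z b})) (fun y hy => ?_) ?_
  · induction hy using Relation.TransGen.head_induction_on with
    | single h =>
      rcases ZFSet.mem_insert_iff.1 h with rfl | h
      · exact Or.inl rfl
      · exact Or.inr (Or.inr (Relation.TransGen.single h))
    | head h _ ih =>
      rcases ih with rfl | ih | ih
      · exact Or.inr (Or.inl (Relation.TransGen.single h))
      · exact Or.inr (Or.inl (Relation.TransGen.head h ih))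
      · exact Or.inr (Or.inr (Relation.TransGen.head h ih))
  · refine (Cardinal.mk_union_le _ _).trans_lt (Cardinal.add_lt_of_lt hχ' ?_ ?_)
    · simpa using Cardinal.one_lt_aleph0.trans_le hχ
    · exact (Cardinal.mk_union_le _ _).trans_lt (Cardinal.add_lt_of_lt hχ' ha hb)

namespace HModel

variable {χ : Cardinal.{u}} {R : HSet χ → HSet χ → Prop}

theorem toSet_injective : Function.Injective (toSet : HModel χ R → ZFSet.{u}) :=
  Subtype.val_injective

theorem toSet_mem (y : HModel χ R) : y.toSet ∈ HSet χ := Subtype.property (p := (· ∈ HSet χ)) y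

/-- A member of `H(χ)` as an element of the structure. -/
def mk {z : ZFSet.{u}} (hz : z ∈ HSet χ) : HModel χ R := (⟨z, hz⟩ : HSet χ)

/-- The ordinal `a` as an element of the structure. -/
noncomputable def ofOrd (a : Set.Iio χ.ord) : HModel χ R := mk (toZFSet_mem_HSet a.2)

end HModel

/-- The symbol for membership. -/
def memSymbol : setLanguage.Relations 2 := SetSymbol.mem

/-- The formula saying that the third variable is the second one with the first one inserted. -/
def insertFormula : setLanguage.BoundedFormula Empty 3 :=
  ((memSymbol.boundedFormula₂
      (Language.Term.var (Sum.inr 3)) (Language.Term.var (Sum.inr 2))).iff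
    ((memSymbol.boundedFormula₂
      (Language.Term.var (Sum.inr 3)) (Language.Term.var (Sum.inr 1))) ⊔
      ((Language.Term.var (Sum.inr 3)).bdEqual (Language.Term.var (Sum.inr 0))))).all

theorem realize_insertFormula {χ : Cardinal.{u}} {R : HSet χ → HSet χ → Prop}
    (v : Fin 3 → HModel χ R) :
    insertFormula.Realize default v ↔
      ∀ w : HModel χ R, w.toSet ∈ (v 2).toSet ↔ w.toSet ∈ (v 1).toSet ∨ w = v 0 := by
  rw [insertFormula, Language.BoundedFormula.realize_all]
  refine forall_congr' fun w => ?_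
  rw [Language.BoundedFormula.realize_iff, Language.BoundedFormula.realize_sup,
    Language.BoundedFormula.realize_rel₂, Language.BoundedFormula.realize_rel₂,
    Language.BoundedFormula.realize_bdEqual]
  exact Iff.rfl

namespace ElemSub

variable {χ : Cardinal.{u}} {R : HSet χ → HSet χ → Prop} (N : ElemSub χ R)

theorem exists_realize {n : ℕ} (φ : setLanguage.BoundedFormula Empty (n + 1)) (x : Fin n → N)
    (h : ∃ a, φ.Realize default (Fin.snoc ((↑) ∘ x) a : _ → HModel χ R)) :
    ∃ b : N, φ.Realize default (Fin.snoc ((↑) ∘ x) b : _ → HModel χ R) := by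
  have h1 : φ.ex.Realize default ((↑) ∘ x : Fin n → HModel χ R) :=
    Language.BoundedFormula.realize_ex.2 h
  have h2 : φ.ex.Realize default x := by
    have := N.subtype.map_boundedFormula φ.ex default x
    refine this.1 ?_
    convert h1 using 1
    rfl
  obtain ⟨b, hb⟩ := Language.BoundedFormula.realize_ex.1 h2
  refine ⟨b, ?_⟩
  have := (N.subtype.map_boundedFormula φ default (Fin.snoc x b)).2 hb
  convert this using 1
  rw [Fin.comp_snoc]
  rfl

/-- The set is definable from `a` and `b` and belongs to `H(χ)`. Pairs and finite sets are obtained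
from it by iteration. -/
theorem insert_mem_sets (hχ : Cardinal.aleph0 ≤ χ) {a b : ZFSet.{u}} (ha : a ∈ N.sets)
    (hb : b ∈ N.sets) : insert a b ∈ N.sets := by
  obtain ⟨a, haN, rfl⟩ := ha
  obtain ⟨b, hbN, rfl⟩ := hb
  have hab := insert_mem_HSet hχ a.toSet_mem b.toSet_mem
  obtain ⟨c, hc⟩ := N.exists_realize insertFormula ![⟨a, haN⟩, ⟨b, hbN⟩]
    ⟨HModel.mk hab, by
      rw [realize_insertFormula]
      intro w
      change w.toSet ∈ insert a.toSet b.toSet ↔ w.toSet ∈ b.toSet ∨ w = a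
      rw [ZFSet.mem_insert_iff, or_comm, HModel.toSet_injective.eq_iff]⟩
  rw [realize_insertFormula] at hc
  have hc : ∀ w : HModel χ R, w.toSet ∈ (c : HModel χ R).toSet ↔ w.toSet ∈ b.toSet ∨ w = a := hc
  refine ⟨c, c.2, ?_⟩
  ext z
  rw [ZFSet.mem_insert_iff]
  constructor
  · intro hz
    rcases (hc (HModel.mk (mem_HSet_of_mem (HModel.toSet_mem _) hz))).1 hz with h | h
    · exact Or.inr h
    · exact Or.inl (congrArg HModel.toSet h)
  · rintro (rfl | hz)
    · exact (hc a).2 (Or.inr rfl)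
    · exact (hc (HModel.mk (mem_HSet_of_mem b.toSet_mem hz))).2 (Or.inl hz)

theorem exists_finite_set (hχ : Cardinal.aleph0 ≤ χ) (h0 : ∅ ∈ N.sets) {s : Set ZFSet.{u}}
    (hs : s.Finite) (hsN : s ⊆ N.sets) : ∃ z ∈ N.sets, ∀ w, w ∈ z ↔ w ∈ s := by
  induction s, hs using Set.Finite.induction_on with
  | empty => exact ⟨∅, h0, by simp⟩
  | insert _ _ ih =>
    obtain ⟨z, hz, h⟩ := ih fun w hw => hsN (Or.inr hw)
    exact ⟨_, N.insert_mem_sets hχ (hsN (Or.inl rfl)) hz, fun w => by simp [h]⟩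

/-- Elementary submodels are closed under finite sequences. -/
theorem seq_mem (hχ : Cardinal.aleph0 ≤ χ) (hω : ∀ i < Ordinal.omega0, i ∈ N.ords)
    (i : Ordinal.{u}) (hi : i < Cardinal.aleph0.ord) (y f : ZFSet.{u}) (hy : ∀ z ∈ y, z ∈ N.sets)
    (hf : ZFSet.IsFunc i.toZFSet y f) : f ∈ N.sets := by
  rw [Cardinal.ord_aleph0] at hi
  have h0 : ∅ ∈ N.sets := by
    have h : (0 : Ordinal.{u}).toZFSet ∈ N.sets := hω 0 Ordinal.omega0_pos
    rwa [Ordinal.toZFSet_zero] at h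
  have hsub : ∀ w ∈ f, ∃ a ∈ i.toZFSet, ∃ b ∈ y, w = ZFSet.pair a b := fun w hw =>
    ZFSet.mem_prod.1 (hf.1 hw)
  have hfin : {w | w ∈ f}.Finite := by
    have hi' : (Set.Iio i).Finite := by
      obtain ⟨n, rfl⟩ := Ordinal.lt_omega0.1 hi
      refine (Set.finite_range fun k : Fin n => ((k : ℕ) : Ordinal.{u})).subset fun a ha => ?_
      have ha : a < n := ha
      obtain ⟨k, rfl⟩ := Ordinal.lt_omega0.1 (ha.trans hi)
      exact ⟨⟨k, by exact_mod_cast ha⟩, rfl⟩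
    have himg := hi'.image Ordinal.toZFSet
    choose! g hg using fun z hz => (hf.2 z hz).exists
    refine (himg.image fun a => ZFSet.pair a (g a)).subset fun w hw => ?_
    obtain ⟨a, ha, b, -, rfl⟩ := hsub w hw
    obtain ⟨c, hc, rfl⟩ := Ordinal.mem_toZFSet_iff.1 ha
    refine ⟨c.toZFSet, ⟨c, hc, rfl⟩, ?_⟩
    change ZFSet.pair _ _ = _
    rw [(hf.2 _ ha).unique (hg _ ha) hw]
  have hins : ∀ {a b}, a ∈ N.sets → b ∈ N.sets → insert a b ∈ N.sets := N.insert_mem_sets hχ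
  have hsing : ∀ {a}, a ∈ N.sets → ({a} : ZFSet.{u}) ∈ N.sets := by
    intro a ha
    have := hins ha h0
    rwa [show insert a (∅ : ZFSet.{u}) = {a} by ext; simp] at this
  obtain ⟨z, hz, h⟩ := N.exists_finite_set hχ h0 hfin (by
    intro w hw
    obtain ⟨a, ha, b, hb, rfl⟩ := hsub w hw
    obtain ⟨c, hc, rfl⟩ := Ordinal.mem_toZFSet_iff.1 ha
    have hcN : c.toZFSet ∈ N.sets := hω c (hc.trans hi)
    exact hins (hsing hcN) (hsing (hins hcN (hsing (hy b hb)))))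
  rwa [show f = z from ZFSet.ext fun w => (h w).symm]

end ElemSub

instance countable_setLanguage_relations (n : ℕ) : Countable (setLanguage.Relations n) := by
  refine ⟨⟨fun | SetSymbol.mem => 0 | SetSymbol.extra => 1, ?_⟩⟩
  intro a b h
  cases a <;> cases b <;> first | rfl | simp_all

theorem card_setLanguage_le : setLanguage.card ≤ Cardinal.aleph0 := by
  have h' : IsEmpty (Σ n, setLanguage.Functions n) := ⟨fun x => Empty.elim x.2⟩
  have : Countable setLanguage.Symbols := by
    unfold Language.Symbols
    infer_instance
  exact Cardinal.mk_le_aleph0_iff.2 this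

/-- The elementary submodels of `H(χ)` that contain a given small set. -/
theorem exists_elemSub {χ κ : Cardinal.{u}} {R : HSet χ → HSet χ → Prop}
    (hκ : Cardinal.aleph0 ≤ κ) (hκχ : κ < χ) (x : HModel χ R) :
    ∃ N : ElemSub χ R, x ∈ N ∧ (∀ i ≤ κ.ord, i ∈ N.ords) ∧
      Cardinal.mk N = Cardinal.lift.{u + 1} κ := by
  have hlt : κ.ord < χ.ord := Cardinal.ord_lt_ord.2 hκχ
  let o : Set.Iic κ.ord → HModel χ R := fun a => HModel.ofOrd ⟨a.1, (Set.mem_Iic.1 a.2).trans_lt hlt⟩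
  have ho : Function.Injective o := fun a b h =>
    Subtype.ext (Ordinal.toZFSet_injective (congrArg HModel.toSet h))
  have hκ' : Cardinal.aleph0 ≤ Cardinal.lift.{u + 1} κ := by simpa using hκ
  have hIic : Cardinal.mk (Set.Iic κ.ord) = Cardinal.lift.{u + 1} κ := by
    have : Set.Iic κ.ord = Set.Iio (κ.ord + 1) := by
      ext a
      simp
    rw [this, Cardinal.mk_Iio_ordinal, Ordinal.card_add_one, Cardinal.card_ord,
      Cardinal.add_one_of_aleph0_le hκ]
  obtain ⟨N, hs, hN⟩ := Language.exists_elementarySubstructure_card_eq setLanguage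
    (insert x (Set.range o)) (Cardinal.lift.{u + 1} κ) hκ' (by
      rw [Cardinal.lift_id, Cardinal.lift_id]
      refine (Cardinal.mk_insert_le).trans ?_
      refine Cardinal.add_le_of_le hκ' (Cardinal.mk_range_le.trans hIic.le)
        (Cardinal.one_le_aleph0.trans hκ'))
    (by
      refine (Cardinal.lift_le.2 card_setLanguage_le).trans ?_
      simpa using hκ)
    (by
      rw [Cardinal.lift_id, Cardinal.lift_id, ← hIic]
      exact Cardinal.mk_le_of_injective ho)
  rw [Cardinal.lift_id, Cardinal.lift_id] at hN
  exact ⟨N, hs (Or.inl rfl), fun i hi => ⟨_, hs (Or.inr ⟨⟨i, hi⟩, rfl⟩), rfl⟩, hN⟩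

/-! ### Skolem hulls on the ordinals below `κ` -/

/-- The clone `T` on `κ` contains Skolem functions for the elementary submodel of `H(χ)` that is
enumerated by `e`, together with the correspondence between the ordinals below `κ` and their
indices. -/
structure SkolemFrame {χ κ : Cardinal.{u}} {R : HSet χ → HSet χ → Prop} (θ : Cardinal.{u})
    (x : HModel χ R) (T : Clone (OrdBelow κ)) (e : OrdBelow κ → HModel χ R) : Prop where
  injective : Function.Injective e
  ord : ∃ g ∈ T.fns, (∀ ξ, (e (g ξ)).toSet = ξ.1.toZFSet) ∧ ∃ r ∈ T.fns, ∀ ξ, r (g ξ) = ξ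
  skolem : ∀ (n : ℕ) (φ : setLanguage.BoundedFormula Empty (n + 1)), ∃ g ∈ T.fns,
    ∀ v : Fin n → OrdBelow κ, (∃ a, φ.Realize default (Fin.snoc (e ∘ v) a : _ → HModel χ R)) →
      φ.Realize default (Fin.snoc (e ∘ v) (e (g (T.code (List.ofFn v)))) : _ → HModel χ R)
  rel_test : ∀ r : setLanguage.Relations 2, ∃ g ∈ T.fns, ∀ a b, g (T.pair a b) = T.zero ↔
    Language.Structure.RelMap r ![e a, e b]
  const_ord : ∀ i ≤ θ.ord, ∃ k : OrdBelow κ, (fun _ => k) ∈ T.fns ∧ k.1 = i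
  const_self : ∃ k : OrdBelow κ, (fun _ => k) ∈ T.fns ∧ e k = x

-- The enumerated submodel has size `κ`, which turns its Skolem functions into functions on `κ`.
-- Countably many generators suffice apart from the constants for the ordinals up to `θ`, so the
-- clone has size at most `θ`.
open Classical in
theorem exists_skolemFrame {χ κ θ : Cardinal.{u}} {R : HSet χ → HSet χ → Prop}
    (hθ : Cardinal.aleph0 ≤ θ) (hθκ : θ < κ) (hκχ : κ < χ) (x : HModel χ R) :
    ∃ (T : Clone (OrdBelow κ)) (e : OrdBelow κ → HModel χ R), SkolemFrame θ x T e ∧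
      Cardinal.mk T.fns ≤ Cardinal.lift.{u + 1} θ := by
  have hκ := hθ.trans hθκ.le
  have hinf := infinite_ordBelow hκ
  obtain ⟨N, hxN, hord, hN⟩ := exists_elemSub hκ hκχ x
  obtain ⟨e⟩ : Nonempty (OrdBelow κ ≃ N) := Cardinal.eq.1 (by rw [hN, mk_ordBelow])
  have hθκ' : θ.ord < κ.ord := Cardinal.ord_lt_ord.2 hθκ
  obtain ⟨P, -⟩ := exists_pairing (⟨θ.ord, hθκ'⟩ : OrdBelow κ)
  have hne := (exists_ne P.zero).choose_spec
  have ho : ∀ ξ : OrdBelow κ, ∃ k, (e k : HModel χ R).toSet = ξ.1.toZFSet := by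
    intro ξ
    obtain ⟨y, hy, h⟩ := hord ξ.1 (le_of_lt ξ.2)
    exact ⟨e.symm ⟨y, hy⟩, by rw [e.apply_symm_apply]; exact h⟩
  choose o ho using ho
  have hoi : Function.Injective o := fun ξ ξ' h =>
    Subtype.ext (Ordinal.toZFSet_injective (by rw [← ho, ← ho, h]))
  have : Nonempty (OrdBelow κ) := ⟨P.zero⟩
  obtain ⟨r, hr⟩ := hoi.hasLeftInverse
  have hsk : ∀ p : (Σ n, setLanguage.BoundedFormula Empty (n + 1)), ∃ g : OrdBelow κ → OrdBelow κ,
      ∀ k, (∃ a, p.2.Realize default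
        (Fin.snoc (fun i : Fin p.1 => (e (P.nth i k) : HModel χ R)) a : _ → HModel χ R)) →
        p.2.Realize default
          (Fin.snoc (fun i : Fin p.1 => (e (P.nth i k) : HModel χ R)) (e (g k)) : _ → HModel χ R) := by
    rintro ⟨n, φ⟩
    have : ∀ k, ∃ b, (∃ a, φ.Realize default
        (Fin.snoc (fun i : Fin n => (e (P.nth i k) : HModel χ R)) a : _ → HModel χ R)) →
        φ.Realize default
          (Fin.snoc (fun i : Fin n => (e (P.nth i k) : HModel χ R)) (e b) : _ → HModel χ R) := by
      intro k
      by_cases h : ∃ a, φ.Realize default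
        (Fin.snoc (fun i : Fin n => (e (P.nth i k) : HModel χ R)) a : _ → HModel χ R)
      · obtain ⟨b, hb⟩ := N.exists_realize φ (fun i : Fin n => e (P.nth i k)) h
        refine ⟨e.symm b, fun _ => ?_⟩
        rw [e.apply_symm_apply]
        exact hb
      · exact ⟨k, fun h' => absurd h' h⟩
    choose g hg using this
    exact ⟨g, hg⟩
  choose sk hsk using hsk
  let rt : setLanguage.Relations 2 → OrdBelow κ → OrdBelow κ := fun q k =>
    if Language.Structure.RelMap q ![(e (P.fst k) : HModel χ R), e (P.snd k)] then P.zero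
    else (exists_ne P.zero).choose
  let base₀ : Set (OrdBelow κ → OrdBelow κ) :=
    Set.range sk ∪ (Set.range rt ∪ {o, r, fun _ => e.symm ⟨x, hxN⟩})
  let base₁ : Set (OrdBelow κ → OrdBelow κ) :=
    Set.range fun i : Set.Iio (θ.ord + 1) =>
      fun _ => ⟨i.1, lt_of_le_of_lt (Order.lt_add_one_iff.1 i.2) hθκ'⟩
  have hbase := P.base_subset_genClone (base₀ ∪ base₁)
  refine ⟨P.genClone (base₀ ∪ base₁), fun k => e k, ⟨?_, ?_, ?_, ?_, ?_, ?_⟩, ?_⟩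
  · exact Subtype.val_injective.comp e.injective
  · exact ⟨o, hbase (by simp [base₀]), ho, r, hbase (by simp [base₀]), hr⟩
  · intro n φ
    refine ⟨sk ⟨n, φ⟩, hbase (Or.inl (Or.inl ⟨_, rfl⟩)), fun v hv => ?_⟩
    have hdec : (fun i : Fin n => (e (P.nth i (P.code (List.ofFn v))) : HModel χ R)) =
        (fun k => (e k : HModel χ R)) ∘ v := by
      funext i
      rw [P.nth_code i _ (by simp)]
      simp
    have := hsk ⟨n, φ⟩ (P.code (List.ofFn v))
    simp only [hdec] at this
    exact this hv
  · intro q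
    refine ⟨rt q, hbase (Or.inl (Or.inr (Or.inl ⟨q, rfl⟩))), fun a b => ?_⟩
    change rt q (P.pair a b) = P.zero ↔ _
    simp only [rt, P.fst_pair, P.snd_pair]
    split_ifs with h
    · simp [h]
    · simp [h, hne]
  · intro i hi
    exact ⟨⟨i, hi.trans_lt hθκ'⟩, hbase (Or.inr ⟨⟨i, Order.lt_add_one_iff.2 hi⟩, rfl⟩), rfl⟩
  · exact ⟨e.symm ⟨x, hxN⟩, hbase (by simp [base₀]), by simp⟩
  · have hθ' : Cardinal.aleph0 ≤ Cardinal.lift.{u + 1} θ := by simpa using hθ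
    refine (P.card_genClone_le _).trans (max_le hθ' ?_)
    refine (Cardinal.mk_union_le _ _).trans (Cardinal.add_le_of_le hθ' ?_ ?_)
    · refine le_trans (Cardinal.le_aleph0_iff_set_countable.2 ?_) hθ'
      have : Countable (Σ n, setLanguage.BoundedFormula Empty (n + 1)) := by
        have h1 : Countable (Σ n, setLanguage.BoundedFormula Empty n) := by
          rw [← Cardinal.mk_le_aleph0_iff]
          refine Language.BoundedFormula.card_le.trans (max_le le_rfl ?_)
          simpa using card_setLanguage_le
        have hinj : Function.Injective fun p : (Σ n, setLanguage.BoundedFormula Empty (n + 1)) =>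
            (⟨p.1 + 1, p.2⟩ : Σ n, setLanguage.BoundedFormula Empty n) := by
          rintro ⟨n, φ⟩ ⟨m, ψ⟩ h
          simp only [Sigma.mk.injEq, add_left_inj] at h
          obtain ⟨rfl, h⟩ := h
          rw [eq_of_heq h]
        exact hinj.countable
      exact (Set.countable_range _).union
        ((Set.countable_range _).union (Set.toFinite _).countable)
    · refine Cardinal.mk_range_le.trans ?_
      rw [Cardinal.mk_Iio_ordinal, Cardinal.lift_le, Ordinal.card_add_one, Cardinal.card_ord,
        Cardinal.add_one_of_aleph0_le hθ]

/-! ### Models and isomorphisms from stable values -/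

section Models

variable {χ κ θ : Cardinal.{u}} {R : HSet χ → HSet χ → Prop} {x : HModel χ R}
  {T : Clone (OrdBelow κ)} {e : OrdBelow κ → HModel χ R}

/-- The elementary submodel of `H(χ)` that is indexed by the stable values at `l`. -/
noncomputable def SkolemFrame.model (F : SkolemFrame θ x T e) (A : Set (OrdBelow κ))
    (l : List (OrdBelow κ)) : ElemSub χ R :=
  Language.Substructure.toElementarySubstructure
    (S := { carrier := e '' stableHull T A l
            fun_mem := fun f => Empty.elim f }) (by
      intro n φ v a ha
      obtain ⟨g, hg, h⟩ := F.skolem n φ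
      choose k hk hkv using fun i => (v i).2
      have hv : ((↑) ∘ v : Fin n → HModel χ R) = e ∘ k := funext fun i => (hkv i).symm
      rw [hv] at ha ⊢
      exact ⟨⟨_, _, stableHull_fn hg (stableHull_code fun b hb => by
        obtain ⟨i, rfl⟩ := (List.mem_ofFn' _ _).1 hb
        exact hk i), rfl⟩, h k ⟨a, ha⟩⟩)

variable (F : SkolemFrame θ x T e) {A : Set (OrdBelow κ)} {l l' : List (OrdBelow κ)}

theorem SkolemFrame.mem_sets {z : ZFSet.{u}} :
    z ∈ (F.model A l).sets ↔ ∃ k ∈ stableHull T A l, (e k).toSet = z :=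
  ⟨fun ⟨_, ⟨k, hk, hky⟩, hy⟩ => ⟨k, hk, hky ▸ hy⟩, fun ⟨k, hk, hz⟩ => ⟨e k, ⟨k, hk, rfl⟩, hz⟩⟩

/-- An ordinal and its index in the enumeration are computed from each other within the clone, so
membership in the model does not depend on which of them is stable. -/
theorem SkolemFrame.mem_ords (ξ : OrdBelow κ) :
    ξ.1 ∈ (F.model A l).ords ↔ ξ ∈ stableHull T A l := by
  obtain ⟨g, hg, hgo, r, hr, hrg⟩ := F.ord
  change ξ.1.toZFSet ∈ (F.model A l).sets ↔ _
  rw [F.mem_sets]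
  constructor
  · rintro ⟨k, hk, h⟩
    have : k = g ξ := F.injective (HModel.toSet_injective (h.trans (hgo ξ).symm))
    rw [← hrg ξ, ← this]
    exact stableHull_fn hr hk
  · exact fun h => ⟨g ξ, stableHull_fn hg h, hgo ξ⟩

theorem SkolemFrame.ord_mem_ords {i : Ordinal.{u}} (hi : i ≤ θ.ord) : i ∈ (F.model A l).ords := by
  obtain ⟨k, hk, rfl⟩ := F.const_ord i hi
  exact (F.mem_ords k).2 ⟨_, hk, 0, stableValue_const l k⟩

theorem SkolemFrame.card_model (hθ : Cardinal.aleph0 ≤ θ)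
    (hT : Cardinal.mk T.fns ≤ Cardinal.lift.{u + 1} θ) (hE : Endless A) (hl : IncIn A l) :
    Cardinal.mk (F.model A l) = Cardinal.lift.{u + 1} θ := by
  have h : Cardinal.mk (F.model A l) = Cardinal.mk (stableHull T A l) :=
    Cardinal.mk_image_eq F.injective
  rw [h]
  apply le_antisymm
  · exact (EndIndiscernible.mk_stableHull_le hE hl).trans (max_le (by simpa using hθ) hT)
  · rw [← mk_ordBelow]
    choose k hk hki using F.const_ord
    let f : OrdBelow θ → stableHull T A l := fun i =>
      ⟨k i.1 (le_of_lt i.2), _, hk i.1 (le_of_lt i.2), 0, stableValue_const l _⟩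
    refine Cardinal.mk_le_of_injective (f := f) fun i j hij => ?_
    have := congrArg Subtype.val (Subtype.mk.inj hij)
    rw [hki, hki] at this
    exact Subtype.ext this

/-- The correspondence between the models of two lists. -/
def ModelRel (T : Clone (OrdBelow κ)) (e : OrdBelow κ → HModel χ R) (A : Set (OrdBelow κ))
    (l l' : List (OrdBelow κ)) (y z : HModel χ R) : Prop :=
  ∃ j k, e j = y ∧ e k = z ∧ StableRel T A l l' j k

theorem ModelRel.symm {y z : HModel χ R} (h : ModelRel T e A l l' y z) :
    ModelRel T e A l' l z y := by
  obtain ⟨j, k, hj, hk, h⟩ := h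
  exact ⟨k, j, hk, hj, h.symm⟩

namespace SkolemFrame

theorem exists_modelRel (hA : EndIndiscernible T A) (hE : Endless A) (hl : IncIn A l)
    (hl' : IncIn A l') (hlen : l.length = l'.length) (y : F.model A l) :
    ∃ z : F.model A l', ModelRel T e A l l' y z := by
  obtain ⟨y, j, hj, rfl⟩ := y
  obtain ⟨k, hk⟩ := hA.exists_stableRel hE hl hl' hlen hj
  exact ⟨⟨e k, k, hk.symm.left_mem, rfl⟩, j, k, rfl, rfl, hk⟩

theorem modelRel_unique (F : SkolemFrame θ x T e) (hA : EndIndiscernible T A) (hE : Endless A) (hl : IncIn A l)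
    (hl' : IncIn A l') (hlen : l.length = l'.length) {y z z' : HModel χ R}
    (h : ModelRel T e A l l' y z) (h' : ModelRel T e A l l' y z') : z = z' := by
  obtain ⟨j, k, rfl, rfl, h⟩ := h
  obtain ⟨j', k', hj, rfl, h'⟩ := h'
  rw [F.injective hj] at h'
  rw [(hA.stableRel_eq_iff hE hl hl' hlen h h').1 rfl]

theorem modelRel_trans (F : SkolemFrame θ x T e) (hA : EndIndiscernible T A) (hE : Endless A) {l'' : List (OrdBelow κ)}
    (hl' : IncIn A l') (hl'' : IncIn A l'') (hlen : l'.length = l''.length) {y z w : HModel χ R}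
    (h : ModelRel T e A l l' y z) (h' : ModelRel T e A l' l'' z w) : ModelRel T e A l l'' y w := by
  obtain ⟨j, k, rfl, rfl, h⟩ := h
  obtain ⟨j', k', hj, rfl, h'⟩ := h'
  rw [F.injective hj] at h'
  exact ⟨j, k', rfl, rfl, hA.stableRel_trans hE hl' hl'' hlen h h'⟩

/-- The isomorphism between the models of two lists of the same length. -/
noncomputable def equiv (hA : EndIndiscernible T A) (hE : Endless A) (hl : IncIn A l)
    (hl' : IncIn A l') (hlen : l.length = l'.length) :
    F.model A l ≃[setLanguage] F.model A l' where
  toFun y := (F.exists_modelRel hA hE hl hl' hlen y).choose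
  invFun z := (F.exists_modelRel hA hE hl' hl hlen.symm z).choose
  left_inv y := Subtype.ext <| F.modelRel_unique hA hE hl' hl hlen.symm
    (F.exists_modelRel hA hE hl' hl hlen.symm _).choose_spec
    (F.exists_modelRel hA hE hl hl' hlen y).choose_spec.symm
  right_inv z := Subtype.ext <| F.modelRel_unique hA hE hl hl' hlen
    (F.exists_modelRel hA hE hl hl' hlen _).choose_spec
    (F.exists_modelRel hA hE hl' hl hlen.symm z).choose_spec.symm
  map_fun' f := Empty.elim f
  map_rel' {n} r v := by
    have hn : n = 2 := by cases r <;> rfl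
    subst hn
    obtain ⟨g, hg, hgr⟩ := F.rel_test r
    have key : ∀ (m : List (OrdBelow κ)) (w : Fin 2 → F.model A m) (a b : OrdBelow κ),
        e a = w 0 → e b = w 1 →
        (g (T.pair a b) = T.zero ↔ Language.Structure.RelMap r w) := by
      intro m w a b ha hb
      rw [hgr]
      change _ ↔ Language.Structure.RelMap r ((↑) ∘ w : Fin 2 → HModel χ R)
      have : ![e a, e b] = ((↑) ∘ w : Fin 2 → HModel χ R) := by
        funext i
        fin_cases i
        exacts [ha, hb]
      rw [this]
    obtain ⟨j, k, hj, hk, h⟩ := (F.exists_modelRel hA hE hl hl' hlen (v 0)).choose_spec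
    obtain ⟨j', k', hj', hk', h'⟩ := (F.exists_modelRel hA hE hl hl' hlen (v 1)).choose_spec
    rw [← key l v j j' hj hj', ← key l' _ k k' hk hk']
    exact (hA.stableRel_test hE hl hl' hlen h h' hg).symm

theorem equiv_spec (hA : EndIndiscernible T A) (hE : Endless A) (hl : IncIn A l)
    (hl' : IncIn A l') (hlen : l.length = l'.length) (y : F.model A l) :
    ModelRel T e A l l' y (F.equiv hA hE hl hl' hlen y) :=
  (F.exists_modelRel hA hE hl hl' hlen y).choose_spec

end SkolemFrame

end Models

/-! ### Lists of ordinals below `κ` -/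

/-- The increasing list of the elements of `s` below `κ`. -/
noncomputable def ordList (κ : Cardinal.{u}) (s : Finset Ordinal.{u}) : List (OrdBelow κ) :=
  (s.preimage Subtype.val Subtype.val_injective.injOn).sort

section OrdList

variable {κ : Cardinal.{u}} {A : Set (OrdBelow κ)} {s : Finset Ordinal.{u}}

@[simp] theorem mem_ordList {k : OrdBelow κ} : k ∈ ordList κ s ↔ k.1 ∈ s := by
  simp [ordList]

theorem incIn_ordList (hs : (s : Set Ordinal.{u}) ⊆ Subtype.val '' A) : IncIn A (ordList κ s) := by
  refine ⟨(Finset.sortedLT_sort _).pairwise, fun k hk => ?_⟩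
  obtain ⟨a, ha, hak⟩ := hs (mem_ordList.1 hk)
  rwa [← Subtype.ext hak]

theorem length_ordList (hs : (s : Set Ordinal.{u}) ⊆ Subtype.val '' A) :
    (ordList κ s).length = s.card := by
  classical
  rw [ordList, Finset.length_sort, Finset.card_preimage, Finset.filter_true_of_mem]
  intro a ha
  obtain ⟨k, -, rfl⟩ := hs ha
  exact ⟨k, rfl⟩

/-- Increasing lists with the same elements are equal. -/
theorem IncIn.eq_of_mem_iff {K : Type*} [LinearOrder K] {A : Set K} {l l' : List K}
    (hl : IncIn A l) (hl' : IncIn A l') (h : ∀ a, a ∈ l ↔ a ∈ l') : l = l' := by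
  classical
  rw [← hl.sort_toFinset, ← hl'.sort_toFinset]
  congr 1
  ext a
  simp [h]

theorem posIn_getElem (hs : (s : Set Ordinal.{u}) ⊆ Subtype.val '' A) (i : ℕ)
    (hi : i < (ordList κ s).length) : posIn s (ordList κ s)[i].1 = i := by
  classical
  have hl := incIn_ordList hs
  have hlt : ∀ j (hj : j < (ordList κ s).length), (ordList κ s)[j] < (ordList κ s)[i] ↔ j < i := by
    intro j hj
    have hmono := List.pairwise_iff_getElem.1 hl.1
    rcases lt_trichotomy j i with h | rfl | h
    · exact iff_of_true (hmono j i hj hi h) h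
    · simp
    · exact iff_of_false (hmono i j hi hj h).not_gt h.not_gt
  have heq : s.filter (· < (ordList κ s)[i].1) =
      (((ordList κ s).take i).toFinset).image Subtype.val := by
    ext a
    simp only [Finset.mem_filter, Finset.mem_image, List.mem_toFinset]
    constructor
    · rintro ⟨ha, hlta⟩
      obtain ⟨k, -, rfl⟩ := hs ha
      obtain ⟨j, hj, rfl⟩ := List.mem_iff_getElem.1 (mem_ordList.2 ha)
      have hji := (hlt j hj).1 hlta
      exact ⟨_, List.mem_take_iff_getElem.2 ⟨j, by simp [hj, hji], rfl⟩, rfl⟩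
    · rintro ⟨k, hk, rfl⟩
      obtain ⟨j, hj, rfl⟩ := List.mem_take_iff_getElem.1 hk
      have hj' := lt_min_iff.1 hj
      exact ⟨mem_ordList.1 (List.getElem_mem _), (hlt j hj'.2).2 hj'.1⟩
  rw [posIn, heq, Finset.card_image_of_injective _ Subtype.val_injective,
    List.toFinset_card_of_nodup ((hl.1.sublist (List.take_sublist _ _)).imp fun h => h.ne),
    List.length_take]
  omega

theorem posIn_lt {a : OrdBelow κ} (hs : (s : Set Ordinal.{u}) ⊆ Subtype.val '' A) (ha : a.1 ∈ s) :
    ∃ h : posIn s a.1 < (ordList κ s).length, (ordList κ s)[posIn s a.1] = a := by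
  obtain ⟨j, hj, rfl⟩ := List.mem_iff_getElem.1 (mem_ordList.2 ha)
  have := posIn_getElem hs j hj
  simp [this, hj]

/-- The order isomorphism between two finite sets of ordinals of the same size, and its
restrictions. -/
theorem exists_map_ordList {t s' t' : Finset Ordinal.{u}}
    (hs : (s : Set Ordinal.{u}) ⊆ Subtype.val '' A) (ht : (t : Set Ordinal.{u}) ⊆ Subtype.val '' A)
    (hst : s.card = t.card) (hs' : s' ⊆ s)
    (ht' : ∀ a, a ∈ t' ↔ a ∈ t ∧ ∃ b ∈ s', posIn s b = posIn t a) :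
    ∃ σ : OrdBelow κ → OrdBelow κ, (ordList κ s).map σ = ordList κ t ∧
      (ordList κ s').map σ = ordList κ t' := by
  have hlen : (ordList κ s).length = (ordList κ t).length := by
    rw [length_ordList hs, length_ordList ht, hst]
  -- The default value is never reached at entries of `s`, because the two lists have equal length.
  let σ : OrdBelow κ → OrdBelow κ := fun k => (ordList κ t).getD (posIn s k.1) k
  have hσ : (ordList κ s).map σ = ordList κ t := by
    apply List.ext_getElem (by simp [hlen])
    intro i h₁ h₂
    simp only [List.getElem_map, σ]
    rw [posIn_getElem hs i (by omega)]
    simp [h₂]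
  refine ⟨σ, hσ, ?_⟩
  have hls := incIn_ordList hs
  have hlt := incIn_ordList ht
  have hls' := incIn_ordList (κ := κ) ((Finset.coe_subset.2 hs').trans hs)
  have hlt' := incIn_ordList (κ := κ) (s := t') (A := A) fun a ha => ht ((ht' a).1 ha).1
  have hmono : ∀ a ∈ ordList κ s, ∀ b ∈ ordList κ s, a < b → σ a < σ b := by
    have := hlt.1
    rw [← hσ, List.pairwise_map] at this
    intro a ha b hb hab
    obtain ⟨i, hi, rfl⟩ := List.mem_iff_getElem.1 ha
    obtain ⟨j, hj, rfl⟩ := List.mem_iff_getElem.1 hb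
    have hij : i < j := by
      by_contra hcon
      rcases (not_lt.1 hcon).lt_or_eq with h | rfl
      · exact (List.pairwise_iff_getElem.1 hls.1 j i hj hi h).not_gt hab
      · exact lt_irrefl _ hab
    exact List.pairwise_iff_getElem.1 this i j hi hj hij
  have hsub : ∀ a ∈ ordList κ s', a ∈ ordList κ s := fun a ha =>
    mem_ordList.2 (hs' (mem_ordList.1 ha))
  have hmem : ∀ a ∈ ordList κ s, σ a ∈ ordList κ t := fun a ha =>
    hσ ▸ List.mem_map_of_mem ha
  have hpos : ∀ a ∈ ordList κ s, posIn t (σ a).1 = posIn s a.1 := by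
    intro a ha
    obtain ⟨h, -⟩ := posIn_lt hs (mem_ordList.1 ha)
    have hs : σ a = (ordList κ t)[posIn s a.1]'(by omega) := by
      simp [σ, List.getD, hlen ▸ h]
    rw [hs, posIn_getElem ht]
  have hinc : IncIn A ((ordList κ s').map σ) := by
    refine ⟨?_, fun b hb => ?_⟩
    · rw [List.pairwise_map]
      exact List.Pairwise.imp_of_mem (fun {a b} ha hb h => hmono a (hsub a ha) b (hsub b hb) h) hls'.1
    · obtain ⟨a, ha, rfl⟩ := List.mem_map.1 hb
      exact hlt.2 _ (hmem a (hsub a ha))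
  refine hinc.eq_of_mem_iff hlt' fun b => ?_
  rw [mem_ordList, ht', List.mem_map]
  constructor
  · rintro ⟨a, ha, rfl⟩
    exact ⟨mem_ordList.1 (hmem a (hsub a ha)), a.1, mem_ordList.1 ha, (hpos a (hsub a ha)).symm⟩
  · rintro ⟨hb, a, ha, hab⟩
    obtain ⟨k, -, rfl⟩ := hs (hs' ha)
    have hk : k ∈ ordList κ s := mem_ordList.2 (hs' ha)
    refine ⟨k, mem_ordList.2 ha, ?_⟩
    obtain ⟨h₁, h₂⟩ := posIn_lt ht (mem_ordList.1 (hmem k hk))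
    obtain ⟨h₃, h₄⟩ := posIn_lt ht hb
    rw [← h₂, ← h₄]
    congr 1
    rw [hpos k hk, hab]

end OrdList

/-! ### Systems of models -/

-- Treated separately because a set of type `ω * 0` is empty, hence not endless. The only index is
-- `∅`, and one model suffices.
open Classical in
theorem exists_modelSystem_zero {χ κ θ : Cardinal.{u}} {R : HSet χ → HSet χ → Prop}
    (hθ : Cardinal.aleph0 ≤ θ) (hθκ : θ < κ) (hκχ : κ < χ) (x : HModel χ R) :
    ∃ S : ModelSystem χ κ R 0 θ Cardinal.aleph0 ⊤, S.IsStrong ∧ S.IsEndExtension ∧ S.IsFor x := by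
  obtain ⟨N, hx, hord, hN⟩ := exists_elemSub hθ (hθκ.trans hκχ) x
  have hempty : ∀ s : FinSub ∅ ⊤, s.1 = ∅ := fun s =>
    Finset.coe_eq_empty.1 (Set.subset_empty_iff.1 s.2.1)
  have h0 : IsEmpty (Set.Iio (0 : Ordinal.{u})) := ⟨fun x => not_lt_zero (Set.mem_Iio.1 x.2)⟩
  refine ⟨{ B := ∅
            N := fun _ => N
            H := fun _ _ _ => Language.Equiv.refl _ _
            succ_subset := fun _ => hord
            card_eq := fun _ => hN
            seq_closed := fun _ => N.seq_mem (hθ.trans (hθκ.trans hκχ).le) fun i hi =>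
              hord i (hi.le.trans (by rwa [← Cardinal.ord_aleph0, Cardinal.ord_le_ord]))
            subset_ord := Set.empty_subset _
            otp_eq := ⟨OrderIso.ofIsEmpty _ _⟩
            inter_subset := fun _ _ _ _ _ h => h.1
            inter_index := fun s => by rw [hempty s]; simp
            H_compat := fun _ _ _ _ _ _ _ _ _ _ _ => rfl
            H_refl := fun _ _ => rfl
            H_order := fun s _ _ a ha => by rw [hempty s] at ha; simp at ha
            H_trans := fun _ _ _ _ _ _ => rfl
            H_symm := fun _ _ _ _ => rfl
            sup_lt := fun _ b hb => hb.elim }, ?_, ?_, ?_⟩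
  · intro s t r _
    exact Set.inter_self _
  · intro s t h
    have := h.1
    rw [hempty t] at this
    simp at this
  · exact ⟨fun _ => hx, fun _ _ _ _ => rfl⟩

/-- An unbounded set of type `ω * α` contains a set of type `α` with gaps. -/
theorem HasOrderType.exists_gaps {κ : Cardinal.{u}} {A : Set (OrdBelow κ)} {α : Ordinal.{u}}
    (h : HasOrderType A (Ordinal.omega0 * α)) :
    ∃ B ⊆ A, HasOrderType (Subtype.val '' B) α ∧
      ∀ b ∈ B, ∃ a ∈ A, a < b ∧ ∀ c ∈ B, c < b → c < a := by
  obtain ⟨e⟩ := h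
  have hlt : ∀ i : Set.Iio α, Ordinal.omega0 * i.1 < Ordinal.omega0 * α := fun i =>
    mul_lt_mul_of_pos_left i.2 Ordinal.omega0_pos
  -- Position `ω * i + 1` goes into `B`; position `ω * i` is left out and separates it from all
  -- earlier elements of `B`.
  let a : Set.Iio α → OrdBelow κ := fun i => e ⟨_, hlt i⟩
  let b : Set.Iio α → OrdBelow κ := fun i => e ⟨_, Ordinal.omega0_mul_add_one_lt (hlt i)⟩
  have hba : ∀ i j, i < j → b i < a j := by
    intro i j hij
    refine Subtype.coe_lt_coe.2 (e.lt_iff_lt.2 (Subtype.mk_lt_mk.2 ?_))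
    exact Ordinal.omega0_mul_add_one_lt (mul_lt_mul_of_pos_left hij Ordinal.omega0_pos)
  have hab : ∀ i, a i < b i := fun i =>
    Subtype.coe_lt_coe.2 (e.lt_iff_lt.2 (Subtype.mk_lt_mk.2 (lt_add_one _)))
  have hb : StrictMono b := fun i j hij => (hba i j hij).trans (hab j)
  refine ⟨Set.range b, ?_, ?_, ?_⟩
  · rintro _ ⟨i, rfl⟩
    exact (e _).2
  · rw [← Set.range_comp]
    exact ⟨StrictMono.orderIso (f := Subtype.val ∘ b) fun i j hij => hb hij⟩
  · rintro _ ⟨j, rfl⟩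
    refine ⟨a j, (e _).2, hab j, ?_⟩
    rintro _ ⟨i, rfl⟩ hij
    exact hba i j (hb.lt_iff_lt.1 hij)

/-- The stable values at a proper initial segment form a proper initial segment. -/
theorem SkolemFrame.properInit {χ κ θ : Cardinal.{u}} {R : HSet χ → HSet χ → Prop} {x : HModel χ R}
    {T : Clone (OrdBelow κ)} {e : OrdBelow κ → HModel χ R} (F : SkolemFrame θ x T e)
    {A : Set (OrdBelow κ)} (hA : EndIndiscernible T A) (hE : Endless A) {s t : Finset Ordinal.{u}}
    (ht : (t : Set Ordinal.{u}) ⊆ Subtype.val '' A)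
    (hst : ProperInit (s : Set Ordinal.{u}) (t : Set Ordinal.{u})) :
    ProperInit ((F.model A (ordList κ s)).ords ∩ Set.Iio κ.ord)
      ((F.model A (ordList κ t)).ords ∩ Set.Iio κ.ord) := by
  obtain ⟨⟨d, hdt, hds⟩, heq⟩ := hst
  have hsub : (s : Set Ordinal.{u}) ⊆ t := by
    rw [heq]
    exact Set.inter_subset_left
  have hlt := incIn_ordList ht
  have hls := incIn_ordList (hsub.trans ht)
  have hdiff : ((t \ s : Finset Ordinal.{u}) : Set Ordinal.{u}) ⊆ Subtype.val '' A := fun a ha =>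
    ht (Finset.sdiff_subset ha)
  have hld := incIn_ordList hdiff
  have happ : IncIn A (ordList κ s ++ ordList κ (t \ s)) := by
    refine hls.append hld fun a ha b hb => Subtype.coe_lt_coe.1 ?_
    have ha' : a.1 ∈ (s : Set Ordinal.{u}) := mem_ordList.1 ha
    rw [heq] at ha'
    refine (Set.mem_Iio.1 ha'.2).trans_le (csInf_le' ?_)
    have := mem_ordList.1 hb
    simpa using this
  have hts : ordList κ t = ordList κ s ++ ordList κ (t \ s) := by
    refine hlt.eq_of_mem_iff happ fun a => ?_
    have := @hsub a.1
    simp only [Finset.mem_coe] at this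
    simp only [mem_ordList, List.mem_append, Finset.mem_sdiff]
    tauto
  obtain ⟨δ, hδA, rfl⟩ := ht hdt
  have hδ : δ ∈ ordList κ (t \ s) := by simpa using ⟨hdt, hds⟩
  set D := ((F.model A (ordList κ t)).ords ∩ Set.Iio κ.ord) \
    ((F.model A (ordList κ s)).ords ∩ Set.Iio κ.ord) with hD
  have hDmem : ∀ ξ : OrdBelow κ, ξ.1 ∈ D ↔
      ξ ∈ stableHull T A (ordList κ t) ∧ ξ ∉ stableHull T A (ordList κ s) := by
    intro ξ
    rw [hD, Set.mem_sdiff, Set.mem_inter_iff, Set.mem_inter_iff, F.mem_ords, F.mem_ords]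
    have : ξ.1 ∈ Set.Iio κ.ord := ξ.2
    tauto
  have hδD : δ.1 ∈ D := by
    rw [hDmem]
    constructor
    · obtain ⟨i, hi, rfl⟩ := List.mem_iff_getElem.1 (show δ ∈ ordList κ t by simpa using hdt)
      exact ⟨_, T.nth_mem i, 0, stableValue_nth _ i hi⟩
    · intro h
      exact hds (mem_ordList.1 (hA.mem_of_mem_stableHull hE hls hδA h))
  refine ⟨⟨_, hδD⟩, ?_⟩
  have hinf : sInf D ∈ D := csInf_mem ⟨_, hδD⟩
  ext ξ
  constructor
  · rintro ⟨hξ, hξκ⟩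
    have hξs := (F.mem_ords ⟨ξ, hξκ⟩).1 hξ
    have hξt : (⟨ξ, hξκ⟩ : OrdBelow κ) ∈ stableHull T A (ordList κ t) := by
      rw [hts]
      exact stableHull_mono (fun a ha => List.mem_append_left _ ha) hls hξs
    refine ⟨⟨(F.mem_ords ⟨ξ, hξκ⟩).2 hξt, hξκ⟩, ?_⟩
    by_contra hcon
    -- A new ordinal not above the old ordinal `ξ` would lie below all of `t \ s`, hence would be
    -- stable at `s` already.
    have hle : sInf D ≤ ξ := not_lt.1 hcon
    have hm := (hDmem ⟨sInf D, hle.trans_lt hξκ⟩).1 hinf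
    refine hm.2 ?_
    rw [hts] at hm
    refine hA.mem_stableHull_left hE happ hm.1 fun a ha => ?_
    refine lt_of_le_of_lt (b := (⟨ξ, hξκ⟩ : OrdBelow κ)) hle ?_
    exact hA.lt_of_mem_stableHull hE hls hξs (hld.2 a ha) fun c hc => happ.lt_of_append c hc a ha
  · rintro ⟨⟨hξ, hξκ⟩, hlt⟩
    by_contra hcon
    exact (csInf_le' (s := D) ⟨⟨hξ, hξκ⟩, hcon⟩).not_gt hlt

/-- The indices come from the sparse set `B`, while stability is taken with respect to all of `A`.
The skipped elements of `A` make the supremum in condition 4 strictly smaller than `b`. -/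
theorem exists_modelSystem {χ κ θ : Cardinal.{u}} {α : Ordinal.{u}} {R : HSet χ → HSet χ → Prop}
    (hθ : Cardinal.aleph0 ≤ θ) (hθκ : θ < κ) (hκχ : κ < χ) (x : HModel χ R)
    (h : RegressiveArrow κ (Ordinal.omega0 * α)) :
    ∃ S : ModelSystem χ κ R α θ Cardinal.aleph0 ⊤, S.IsStrong ∧ S.IsEndExtension ∧ S.IsFor x := by
  rcases eq_or_ne α 0 with rfl | hα
  · exact exists_modelSystem_zero hθ hθκ hκχ x
  obtain ⟨T, e, F, hT⟩ := exists_skolemFrame hθ hθκ hκχ x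
  obtain ⟨A, hAα, hA⟩ := h.exists_endIndiscernible hα hθ hθκ T hT
  have hE := hAα.endless hα
  obtain ⟨B, hBA, hB, hgap⟩ := hAα.exists_gaps
  have hBA' : (Subtype.val '' B : Set Ordinal.{u}) ⊆ Subtype.val '' A := Set.image_mono hBA
  have hsub : ∀ s : FinSub (Subtype.val '' B) ⊤, (s.1 : Set Ordinal.{u}) ⊆ Subtype.val '' A :=
    fun s => s.2.1.trans hBA'
  have hl : ∀ s : FinSub (Subtype.val '' B) ⊤, IncIn A (ordList κ s.1) := fun s =>
    incIn_ordList (hsub s)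
  have hlen : ∀ s t : FinSub (Subtype.val '' B) ⊤, s.1.card = t.1.card →
      (ordList κ s.1).length = (ordList κ t.1).length := fun s t hst => by
    rw [length_ordList (hsub s), length_ordList (hsub t), hst]
  have hstrong : ∀ s t r : FinSub (Subtype.val '' B) ⊤, r.1 = s.1 ∩ t.1 →
      (F.model A (ordList κ s.1)).sets ∩ (F.model A (ordList κ t.1)).sets =
        (F.model A (ordList κ r.1)).sets := by
    intro s t r hr
    ext z
    rw [Set.mem_inter_iff, F.mem_sets, F.mem_sets, F.mem_sets]
    constructor
    · rintro ⟨⟨j, hj, rfl⟩, k, hk, hjk⟩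
      rw [F.injective (HModel.toSet_injective hjk)] at hk
      refine ⟨j, ?_, rfl⟩
      have hmem := hA.mem_stableHull_inter hE _ _ _ le_rfl (hl s) (hl t) hj hk
      refine cast (congrArg (j ∈ stableHull T A ·) ?_) hmem
      exact IncIn.eq_of_mem_iff (A := A) ⟨(hl s).1.filter _, fun a ha =>
        (hl s).2 a (List.mem_of_mem_filter ha)⟩ (hl r) fun a => by simp [hr]
    · rintro ⟨j, hj, rfl⟩
      refine ⟨⟨j, stableHull_mono (fun a ha => ?_) (hl r) hj, rfl⟩, j,
        stableHull_mono (fun a ha => ?_) (hl r) hj, rfl⟩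
      · rw [mem_ordList, hr, Finset.mem_inter] at ha
        exact mem_ordList.2 ha.1
      · rw [mem_ordList, hr, Finset.mem_inter] at ha
        exact mem_ordList.2 ha.2
  let H : ∀ s t : FinSub (Subtype.val '' B) ⊤, s.1.card = t.1.card →
      (F.model A (ordList κ s.1) ≃[setLanguage] F.model A (ordList κ t.1)) := fun s t hst =>
    F.equiv hA hE (hl s) (hl t) (hlen s t hst)
  have hH : ∀ (s t : FinSub (Subtype.val '' B) ⊤) (hst : s.1.card = t.1.card)
      (y : F.model A (ordList κ s.1)),
      ModelRel T e A (ordList κ s.1) (ordList κ t.1) y (H s t hst y) := fun s t hst y =>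
    F.equiv_spec hA hE (hl s) (hl t) (hlen s t hst) y
  have huniq : ∀ (s t : FinSub (Subtype.val '' B) ⊤) (_ : s.1.card = t.1.card) {y z z'},
      ModelRel T e A (ordList κ s.1) (ordList κ t.1) y z →
      ModelRel T e A (ordList κ s.1) (ordList κ t.1) y z' → z = z' := fun s t hst _ _ _ =>
    F.modelRel_unique hA hE (hl s) (hl t) (hlen s t hst)
  obtain ⟨kx, hkx, hex⟩ := F.const_self
  have hω : ∀ i < Ordinal.omega0, i ≤ θ.ord := fun i hi =>
    hi.le.trans (by rwa [← Cardinal.ord_aleph0, Cardinal.ord_le_ord])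
  refine ⟨{ B := Subtype.val '' B
            N := fun s => F.model A (ordList κ s.1)
            H := H
            succ_subset := fun s i hi => F.ord_mem_ords hi
            card_eq := fun s => F.card_model hθ hT hE (hl s)
            seq_closed := fun s => ElemSub.seq_mem _ (hθ.trans (hθκ.trans hκχ).le) fun i hi =>
              F.ord_mem_ords (hω i hi)
            subset_ord := ?_
            otp_eq := hB
            inter_subset := fun s t r hr => (hstrong s t r hr).subset
            inter_index := ?_
            H_compat := ?_
            H_refl := ?_
            H_order := ?_
            H_trans := ?_
            H_symm := ?_
            sup_lt := ?_ }, hstrong, ?_, ?_, ?_⟩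
  · rintro _ ⟨b, -, rfl⟩
    exact b.2
  · intro s
    ext a
    constructor
    · rintro ⟨ha, b, hb, rfl⟩
      exact mem_ordList.1 (hA.mem_of_mem_stableHull hE (hl s) (hBA hb) ((F.mem_ords b).1 ha))
    · intro ha
      obtain ⟨b, hb, rfl⟩ := s.2.1 ha
      obtain ⟨i, hi, rfl⟩ := List.mem_iff_getElem.1 (mem_ordList.2 ha)
      exact ⟨(F.mem_ords _).2 ⟨_, T.nth_mem i, 0, stableValue_nth _ i hi⟩, s.2.1 ha⟩
  · intro s t s' t' hst hst' hs' ht' y hy hy'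
    obtain ⟨σ, hσ, hσ'⟩ := exists_map_ordList (hsub s) (hsub t) hst hs' ht'
    -- A correspondence over the smaller lists is also one over the larger lists, so uniqueness
    -- identifies the two images.
    refine huniq s t hst (hH s t hst ⟨y, hy⟩) ?_
    obtain ⟨j, k, hj, hk, hjk⟩ := hH s' t' hst' ⟨y, hy'⟩
    refine ⟨j, k, hj, hk, ?_⟩
    rw [← hσ'] at hjk
    rw [← hσ]
    exact hjk.mono σ (fun a ha => mem_ordList.2 (hs' (mem_ordList.1 ha))) (hl s') (hσ' ▸ hl t')
  · intro s y
    obtain ⟨j, k, hj, hk, hjk⟩ := hH s s rfl y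
    refine Subtype.ext ?_
    rw [← hj, ← hk, hA.stableRel_refl_iff hE (hl s) hjk]
  · intro s t hst a ha b hb hab y hy
    obtain ⟨g, hg, hgo, -⟩ := F.ord
    obtain ⟨ka, -, rfl⟩ := s.2.1 ha
    obtain ⟨kb, -, rfl⟩ := t.2.1 hb
    obtain ⟨hi, hia⟩ := posIn_lt (hsub s) ha
    obtain ⟨hi', hib⟩ := posIn_lt (hsub t) hb
    -- Corresponding entries are values of the same projection; composing with `g` passes to their
    -- indices in the enumeration.
    have hrel : StableRel T A (ordList κ s.1) (ordList κ t.1) (g ka) (g kb) := by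
      refine ⟨_, T.comp_mem _ hg _ (T.nth_mem (posIn s.1 ka.1)), 0, ?_, ?_⟩
      · have := stableValue_nth (T := T) (A := A) (ordList κ s.1) _ hi
        rw [hia] at this
        exact this.comp g
      · have := stableValue_nth (T := T) (A := A) (ordList κ t.1) _ hi'
        rw [hib, ← hab] at this
        exact this.comp g
    have hy' : e (g ka) = y := HModel.toSet_injective ((hgo ka).trans hy.symm)
    rw [← huniq s t hst ⟨_, _, hy', rfl, hrel⟩ (hH s t hst y), hgo]
  · intro r s t hrs hst y
    refine Subtype.ext (huniq r t (hrs.trans hst) ?_ (hH r t (hrs.trans hst) y))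
    exact F.modelRel_trans hA hE (hl s) (hl t) (hlen s t hst) (hH r s hrs y) (hH s t hst _)
  · intro s t hst y
    exact Subtype.ext (huniq t s hst.symm (hH t s hst.symm _) (hH s t hst y).symm)
  · intro s b hb hsb
    obtain ⟨b, hbB, rfl⟩ := hb
    obtain ⟨a, haA, hab, hgap⟩ := hgap b hbB
    refine lt_of_le_of_lt (csSup_le' (a := a.1) ?_) (Subtype.coe_lt_coe.2 hab)
    rintro ξ ⟨hξ, hξκ⟩
    have hξ' := (F.mem_ords ⟨ξ, hξκ⟩).1 hξ
    refine le_of_lt (Subtype.coe_lt_coe.2 (hA.lt_of_mem_stableHull hE (hl s) hξ' haA fun c hc => ?_))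
    have hcs := mem_ordList.1 hc
    obtain ⟨c', hc', hcc⟩ := s.2.1 hcs
    rw [← Subtype.ext hcc]
    refine hgap c' hc' (Subtype.coe_lt_coe.1 ?_)
    rw [hcc]
    exact hsb _ hcs
  · intro s t hst
    exact F.properInit hA hE (hsub t) hst
  · intro s
    exact ⟨kx, ⟨_, hkx, 0, stableValue_const _ _⟩, hex⟩
  · intro s t hst hx
    exact huniq s t hst (hH s t hst ⟨x, hx⟩)
      ⟨kx, kx, hex, hex, _, hkx, 0, stableValue_const _ _, stableValue_const _ _⟩

theorem claim1p3 (χ κ μ : Cardinal.{u}) (α : Ordinal.{u})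
    (hμ : Cardinal.aleph0 ≤ μ) (hμκ : μ < κ) (hκχ : κ < χ)
    (R : HSet χ → HSet χ → Prop) (hR : IsWellOrder (HSet χ) R) (x : HModel χ R) :
    (RegressiveArrow κ (Ordinal.omega0 * α) →
      ∃ S : ModelSystem χ κ R α μ Cardinal.aleph0 ⊤,
        S.IsStrong ∧ S.IsEndExtension ∧ S.IsFor x) ∧
    ((IsRamsey κ ∧ α ≤ κ.ord) ∨
        IsLeast {ν : Cardinal.{u} | PartitionArrow ν (Ordinal.omega0 * α) μ} κ →
      RegressiveArrow κ (Ordinal.omega0 * α) ∧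
      ∀ θ : Cardinal.{u}, Cardinal.aleph0 ≤ θ → θ ≤ μ →
        ∃ S : ModelSystem χ κ R α θ Cardinal.aleph0 ⊤,
          S.IsStrong ∧ S.IsEndExtension ∧ S.IsFor x) := by
  refine ⟨exists_modelSystem hμ hμκ hκχ x, fun h => ?_⟩
  have hreg := regressiveArrow_of_isRamsey_or_isLeast hμ hμκ h
  -- The regressive relation does not involve `μ`, so the construction can be carried out with `θ`
  -- in its place.
  exact ⟨hreg, fun θ hθ hθμ => exists_modelSystem hθ (hθμ.trans_lt hμκ) hκχ x hreg⟩
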